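/- Let $\mathfrak g$ be a finite dimensional simple complex Lie algebra with Cartan subalgebra $\mathfrak h$, root system $\Phi$, basis of simple roots $\Pi$, triangular decomposition $\mathfrak g=\mathfrak n^-\oplus\mathfrak h\oplus\mathfrak n^+$ and a Chevalley basis $\mathcal B=\{e_\gamma : \gamma\in\Phi\}\cup\{h_\alpha : \alpha\in\Pi\}$. Let $(e,h,f)$ be an $\mathfrak{sl}_2$-triple in $\mathfrak g$, let $(\cdot,\cdot)=\kappa(e,f)^{-1}\kappa$ be the multiple of the Killing form $\kappa$ with $(e,f)=1$, put $\chi=(e,\cdot)\in\mathfrak g^*$, let $\mathcal O_\chi$ be the coadjoint orbit of $\chi$ under the adjoint group, and $d(e)=\tfrac12\dim\mathcal O_\chi$. Let $\mu\in\mathfrak h^*$, let $L(\mu)=M(\mu)/M^{\max}(\mu)$ be the simple quotient of the Verma module $M(\mu)$, with highest weight vector $v_\mu$, and suppose that the associated variety (the zero locus of $\mathrm{gr}\,\mathcal I$ in $\mathfrak g^*$) of the primitive ideal $\mathcal I=\mathrm{Ann}_{U(\mathfrak g)}L(\mu)$ is the Zariski closure of $\mathcal O_\chi$. Let $A=S^{-1}\mathbb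 Z\subset\mathbb Q$, where $S$ is a finitely generated multiplicative set of nonzero integers, and assume that $\mu(h_\alpha)\in A$ for all $\alpha\in\Pi$ and that $\kappa(e,f)$ and the Gram determinant of $(\cdot,\cdot)$ with respect to $\mathcal B$ are units of $A$. Let $\mathfrak g_A$ be the $A$-span of $\mathcal B$ and $L_A(\mu)=U(\mathfrak g_A)v_\mu$; write $U_n(\mathfrak g_A)$ for the canonical filtration, $\mathrm{gr}\,L_A(\mu)=\bigoplus_{n\ge0}U_n(\mathfrak g_A)v_\mu/U_{n-1}(\mathfrak g_A)v_\mu$, a module over the symmetric algebra $S(\mathfrak g_A)$, and $\mathcal R_A=S(\mathfrak g_A)/\mathrm{Ann}_{S(\mathfrak g_A)}\mathrm{gr}\,L_A(\mu)$. Assume that $\mathcal R_A$ is torsion free over $A$ and that $$\mathcal R_A=A[y_1,\dots,y_d]v_1+\cdots+A[y_1,\dots,y_d]v_D$$ for some $v_1,\dots,v_D\in\mathcal R_A$ and some homogeneous $y_1,\dots,y_d\in\mathcal R_A$ that are algebraically independent over $A$. Let $p$ be a prime with $pA\ne A$, let $\Bbbk$ be an algebraic closure of $\mathbb F_p$, and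 put $\mathfrak g_\Bbbk=\mathfrak g_A\otimes_A\Bbbk$ and $L_p(\mu)=L_A(\mu)\otimes_A\Bbbk$. The Lie algebra $\mathfrak g_\Bbbk$ has trivial centre, and for $x\in\mathfrak g_\Bbbk$ we write $x^{[p]}$ for the element with $\mathrm{ad}\,x^{[p]}=(\mathrm{ad}\,x)^p$. For $\eta\in\mathfrak g_\Bbbk^*$ let $I_\eta$ be the two-sided ideal of $U(\mathfrak g_\Bbbk)$ generated by all $x^p-x^{[p]}-\eta(x)^p$ with $x\in\mathfrak g_\Bbbk$, and put $L_p^\eta(\mu)=L_p(\mu)/I_\eta L_p(\mu)$. Then for every $\eta\in\mathfrak g_\Bbbk^*$, $$\dim_\Bbbk L_p^\eta(\mu)\le D\,p^{d(e)} .$$ In particular the constant $D$, which is chosen before $p$, depends neither on $p$ nor on $\eta$. -/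

import Mathlib

open scoped TensorProduct DirectSum
open Module

/-! ### Universal enveloping algebras, filtered modules and annihilators in `S(𝔩)` -/

section Filtered

attribute [local instance 100] LieRing.ofAssociativeRing

variable (R : Type*) (𝔩 : Type*) [CommRing R] [LieRing 𝔩] [LieAlgebra R 𝔩]

/-- The `n`-th component `U_n(𝔩)` of the canonical filtration of `U(𝔩)`: the span of all products
of at most `n` elements of `𝔩`. -/
noncomputable def envFiltration (n : ℕ) : Submodule R (UniversalEnvelopingAlgebra R 𝔩) :=
  (1 ⊔ LinearMap.range (UniversalEnvelopingAlgebra.ι R (L := 𝔩)).toLinearMap) ^ n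

variable (M : Type*) [AddCommGroup M] [Module R M] [LieRingModule 𝔩 M] [LieModule R 𝔩 M]

/-- The action of `U(𝔩)` on an `𝔩`-module. -/
noncomputable def envAct : UniversalEnvelopingAlgebra R 𝔩 →ₐ[R] Module.End R M :=
  UniversalEnvelopingAlgebra.lift R (LieModule.toEnd R 𝔩 M)

theorem envAct_ι_apply (x : 𝔩) (m : M) :
    envAct R 𝔩 M (UniversalEnvelopingAlgebra.ι R x) m = ⁅x, m⁆ := by
  rw [envAct, UniversalEnvelopingAlgebra.lift_ι_apply]; rfl

variable {M}

/-- The subspace `U_n(𝔩) v` of a module `M`. -/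
noncomputable def cyclicFiltration (v : M) (n : ℕ) : Submodule R M :=
  (envFiltration R 𝔩 n).map ((LinearMap.applyₗ v).comp (envAct R 𝔩 M).toLinearMap)

/-- The subspace `U_{n-1}(𝔩) v` of a module `M`, where `U_{-1}(𝔩) v = 0`. -/
noncomputable def cyclicFiltrationLT (v : M) : ℕ → Submodule R M
  | 0 => ⊥
  | n + 1 => cyclicFiltration R 𝔩 v n

variable {R 𝔩} in
theorem lie_mem_cyclicFiltration (v : M) (n : ℕ) (x : 𝔩) {m : M}
    (hm : m ∈ cyclicFiltration R 𝔩 v n) : ⁅x, m⁆ ∈ cyclicFiltration R 𝔩 v (n + 1) := by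
  obtain ⟨u, hu, rfl⟩ := hm
  refine ⟨UniversalEnvelopingAlgebra.ι R x * u, ?_, ?_⟩
  · unfold envFiltration at hu ⊢
    rw [pow_succ']
    exact Submodule.mul_mem_mul (Submodule.mem_sup_right ⟨x, rfl⟩) hu
  · simp only [LinearMap.comp_apply, AlgHom.toLinearMap_apply, LinearMap.applyₗ_apply_apply,
      map_mul, Module.End.mul_apply, envAct_ι_apply]

variable {R 𝔩} in
theorem lie_mem_cyclicFiltrationLT (v : M) (n : ℕ) (x : 𝔩) {m : M}
    (hm : m ∈ cyclicFiltrationLT R 𝔩 v n) : ⁅x, m⁆ ∈ cyclicFiltrationLT R 𝔩 v (n + 1) := by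
  cases n with
  | zero =>
    rw [cyclicFiltrationLT, Submodule.mem_bot] at hm
    rw [hm, lie_zero]
    exact Submodule.zero_mem _
  | succ n => exact lie_mem_cyclicFiltration v n x hm

/-- The graded component `gr_n = U_n(𝔩) v / U_{n-1}(𝔩) v`. -/
abbrev GrPiece (v : M) (n : ℕ) : Type _ :=
  cyclicFiltration R 𝔩 v n ⧸ (cyclicFiltrationLT R 𝔩 v n).submoduleOf (cyclicFiltration R 𝔩 v n)

/-- The associated graded module `⨁_n U_n(𝔩) v / U_{n-1}(𝔩) v` of `U(𝔩) v`. -/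
abbrev GrModule (v : M) : Type _ := ⨁ n, GrPiece R 𝔩 v n

/-- The map `gr_n → gr_{n+1}` induced by an element of `𝔩`. -/
noncomputable def grPieceAct (v : M) (n : ℕ) (x : 𝔩) :
    GrPiece R 𝔩 v n →ₗ[R] GrPiece R 𝔩 v (n + 1) :=
  Submodule.mapQ _ _
    ((LieModule.toEnd R 𝔩 M x).restrict fun _ hm => lie_mem_cyclicFiltration v n x hm)
    fun _ hm => lie_mem_cyclicFiltrationLT v n x hm

theorem grPieceAct_mk (v : M) (n : ℕ) (x : 𝔩) (m : cyclicFiltration R 𝔩 v n) :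
    grPieceAct R 𝔩 v n x (Submodule.Quotient.mk m) =
      Submodule.Quotient.mk ⟨⁅x, (m : M)⁆, lie_mem_cyclicFiltration v n x m.2⟩ := rfl

/-- The action of `𝔩` on the associated graded module by operators of degree one. -/
noncomputable def grAct (v : M) : 𝔩 →ₗ[R] Module.End R (GrModule R 𝔩 v) where
  toFun x := DirectSum.toModule R ℕ _ fun n =>
    (DirectSum.lof R ℕ (GrPiece R 𝔩 v) (n + 1)).comp (grPieceAct R 𝔩 v n x)
  map_add' x y := by
    refine DirectSum.linearMap_ext R fun n => LinearMap.ext fun q => ?_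
    obtain ⟨m, rfl⟩ := Submodule.Quotient.mk_surjective _ q
    simp only [LinearMap.comp_apply, LinearMap.add_apply, DirectSum.toModule_lof, ← map_add,
      grPieceAct_mk]
    rw [← Submodule.Quotient.mk_add]
    congr 2
    exact Subtype.ext (add_lie x y (m : M))
  map_smul' r x := by
    refine DirectSum.linearMap_ext R fun n => LinearMap.ext fun q => ?_
    obtain ⟨m, rfl⟩ := Submodule.Quotient.mk_surjective _ q
    simp only [LinearMap.comp_apply, LinearMap.smul_apply, DirectSum.toModule_lof, RingHom.id_apply]
    rw [← map_smul, grPieceAct_mk, grPieceAct_mk, ← Submodule.Quotient.mk_smul]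
    congr 2
    exact Subtype.ext (smul_lie r x (m : M))

theorem grAct_comm (v : M) (x y : 𝔩) :
    grAct R 𝔩 v x * grAct R 𝔩 v y = grAct R 𝔩 v y * grAct R 𝔩 v x := by
  refine DirectSum.linearMap_ext R fun n => LinearMap.ext fun q => ?_
  obtain ⟨m, rfl⟩ := Submodule.Quotient.mk_surjective _ q
  simp only [grAct, LinearMap.coe_mk, AddHom.coe_mk, LinearMap.comp_apply, Module.End.mul_apply,
    DirectSum.toModule_lof, grPieceAct_mk]
  congr 1
  rw [Submodule.Quotient.eq]
  change ⁅x, ⁅y, (m : M)⁆⁆ - ⁅y, ⁅x, (m : M)⁆⁆ ∈ cyclicFiltration R 𝔩 v (n + 1)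
  rw [← lie_lie]
  exact lie_mem_cyclicFiltration v n _ m.2

open scoped IsMulCommutative in
/-- The action of the symmetric algebra `S(𝔩) = gr U(𝔩)` on the associated graded module. It
extends the action of `𝔩`, and is obtained by corestricting the latter to the commutative algebra
of operators that it generates. -/
noncomputable def grSymAct (v : M) : SymmetricAlgebra R 𝔩 →ₐ[R] Module.End R (GrModule R 𝔩 v) :=
  haveI : IsMulCommutative (Algebra.adjoin R (Set.range (grAct R 𝔩 v))) :=
    Algebra.isMulCommutative_adjoin R (by
      rintro _ ⟨x, rfl⟩ _ ⟨y, rfl⟩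
      exact grAct_comm R 𝔩 v x y)
  (Algebra.adjoin R (Set.range (grAct R 𝔩 v))).val.comp
    (SymmetricAlgebra.lift (A := Algebra.adjoin R (Set.range (grAct R 𝔩 v)))
      (LinearMap.codRestrict
        (Subalgebra.toSubmodule (Algebra.adjoin R (Set.range (grAct R 𝔩 v)))) (grAct R 𝔩 v)
        fun x => Algebra.subset_adjoin ⟨x, rfl⟩))

theorem grSymAct_ι (v : M) (x : 𝔩) :
    grSymAct R 𝔩 v (SymmetricAlgebra.ι R 𝔩 x) = grAct R 𝔩 v x := by
  simp [grSymAct]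
  rfl

/-- The annihilator in `S(𝔩)` of the associated graded module of `U(𝔩) v`. -/
noncomputable def grAnnihilator (v : M) : Ideal (SymmetricAlgebra R 𝔩) :=
  RingHom.ker (grSymAct R 𝔩 v)

end Filtered

/-! ### Quotients of `U(𝔩)` by left ideals -/

/-- The quotient `U(𝔩) / J` by a left ideal, as an `𝔩`-module under left multiplication. -/
def EnvQuot {R 𝔩 : Type*} [CommRing R] [LieRing 𝔩] [LieAlgebra R 𝔩]
    (J : Submodule (UniversalEnvelopingAlgebra R 𝔩) (UniversalEnvelopingAlgebra R 𝔩)) : Type _ :=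
  UniversalEnvelopingAlgebra R 𝔩 ⧸ J

namespace EnvQuot

attribute [local instance 100] LieRing.ofAssociativeRing

variable {R 𝔩 : Type*} [CommRing R] [LieRing 𝔩] [LieAlgebra R 𝔩]
  (J : Submodule (UniversalEnvelopingAlgebra R 𝔩) (UniversalEnvelopingAlgebra R 𝔩))

noncomputable instance : AddCommGroup (EnvQuot J) :=
  inferInstanceAs (AddCommGroup (UniversalEnvelopingAlgebra R 𝔩 ⧸ J))

noncomputable instance : Module (UniversalEnvelopingAlgebra R 𝔩) (EnvQuot J) :=
  inferInstanceAs (Module (UniversalEnvelopingAlgebra R 𝔩) (UniversalEnvelopingAlgebra R 𝔩 ⧸ J))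

noncomputable instance : Module R (EnvQuot J) :=
  inferInstanceAs (Module R (UniversalEnvelopingAlgebra R 𝔩 ⧸ J))

instance : IsScalarTower R (UniversalEnvelopingAlgebra R 𝔩) (EnvQuot J) :=
  inferInstanceAs (IsScalarTower R (UniversalEnvelopingAlgebra R 𝔩)
    (UniversalEnvelopingAlgebra R 𝔩 ⧸ J))

noncomputable instance : LieRingModule 𝔩 (EnvQuot J) where
  bracket x m := UniversalEnvelopingAlgebra.ι R x • m
  add_lie x y m := by
    change UniversalEnvelopingAlgebra.ι R (x + y) • m = _
    rw [map_add, add_smul]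
  lie_add x m n := smul_add _ m n
  leibniz_lie x y m := by
    change UniversalEnvelopingAlgebra.ι R x • UniversalEnvelopingAlgebra.ι R y • m =
      UniversalEnvelopingAlgebra.ι R ⁅x, y⁆ • m +
        UniversalEnvelopingAlgebra.ι R y • UniversalEnvelopingAlgebra.ι R x • m
    rw [LieHom.map_lie, LieRing.of_associative_ring_bracket, sub_smul, mul_smul, mul_smul,
      sub_add_cancel]

instance : LieModule R 𝔩 (EnvQuot J) where
  smul_lie t x m := by
    change UniversalEnvelopingAlgebra.ι R (t • x) • m = t • (UniversalEnvelopingAlgebra.ι R x • m)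
    rw [map_smul, smul_assoc]
  lie_smul t x m := by
    change UniversalEnvelopingAlgebra.ι R x • (t • m) = t • (UniversalEnvelopingAlgebra.ι R x • m)
    rw [← algebraMap_smul (UniversalEnvelopingAlgebra R 𝔩) t m, smul_smul,
      ← Algebra.commutes t (UniversalEnvelopingAlgebra.ι R x), mul_smul, algebraMap_smul]

/-- The class of `1`. -/
noncomputable def gen : EnvQuot J :=
  (Submodule.Quotient.mk 1 : UniversalEnvelopingAlgebra R 𝔩 ⧸ J)

end EnvQuot

/-! ### Zariski geometry of `𝔤*` -/

section Zariski

variable {K 𝔤 : Type*} [Field K] [AddCommGroup 𝔤] [Module K 𝔤]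

/-- The value `f(η)` of `f ∈ S(𝔤)`, viewed as a polynomial function on `𝔤*`, at `η ∈ 𝔤*`. -/
noncomputable def symEval (η : Dual K 𝔤) : SymmetricAlgebra K 𝔤 →ₐ[K] K := SymmetricAlgebra.lift η

/-- The zero locus in `𝔤*` of an ideal of `S(𝔤)`. -/
def symZeroLocus (J : Ideal (SymmetricAlgebra K 𝔤)) : Set (Dual K 𝔤) :=
  {η | ∀ f ∈ J, symEval η f = 0}

/-- The ideal of all elements of `S(𝔤)` vanishing on a subset of `𝔤*`. -/
noncomputable def symVanishingIdeal (Z : Set (Dual K 𝔤)) : Ideal (SymmetricAlgebra K 𝔤) :=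
  ⨅ η ∈ Z, RingHom.ker (symEval η)

/-- The Zariski closure of a subset of `𝔤*`. -/
def zariskiClosure (Z : Set (Dual K 𝔤)) : Set (Dual K 𝔤) := symZeroLocus (symVanishingIdeal Z)

/-- The dimension of a (locally closed, nonempty) subset of `𝔤*`: the Krull dimension of the
coordinate ring of its Zariski closure. -/
noncomputable def varietyDim (Z : Set (Dual K 𝔤)) : ℕ :=
  ((ringKrullDim (SymmetricAlgebra K 𝔤 ⧸ symVanishingIdeal Z)).unbotD 0).toNat

end Zariski

/-! ### Simple complex Lie algebras -/

section Complex

variable {𝔤 : Type*} [LieRing 𝔤] [LieAlgebra ℂ 𝔤]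

/-- The adjoint group of `𝔤`, generated by all `exp (ad x)` with `ad x` nilpotent. For a semisimple
`𝔤` this is the image of any connected algebraic group with Lie algebra `𝔤` under `Ad`. -/
noncomputable def adjointGroup (𝔤 : Type*) [LieRing 𝔤] [LieAlgebra ℂ 𝔤] : Subgroup (𝔤 ≃ₗ[ℂ] 𝔤) :=
  Subgroup.closure {g | ∃ x : 𝔤, IsNilpotent (LieAlgebra.ad ℂ 𝔤 x) ∧
    (g : 𝔤 →ₗ[ℂ] 𝔤) = ∑ k ∈ Finset.range (nilpotencyClass (LieAlgebra.ad ℂ 𝔤 x)),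
      (k.factorial : ℂ)⁻¹ • (LieAlgebra.ad ℂ 𝔤 x ^ k : Module.End ℂ 𝔤)}

/-- The coadjoint orbit of a linear function. -/
def coadjointOrbit (χ : Dual ℂ 𝔤) : Set (Dual ℂ 𝔤) :=
  {ξ | ∃ g ∈ adjointGroup 𝔤, ξ = χ ∘ₗ (g : 𝔤 →ₗ[ℂ] 𝔤)}

/-- The multiple `(· , ·)` of the Killing form for which `(e, f) = 1`. -/
noncomputable def normalizedForm (e f : 𝔤) : LinearMap.BilinForm ℂ 𝔤 :=
  (killingForm ℂ 𝔤 e f)⁻¹ • killingForm ℂ 𝔤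

/-- The associated variety of a two-sided ideal `I` of `U(𝔤)`: the zero locus in `𝔤*` of
`gr I ⊆ S(𝔤)`. Here `gr I` is the kernel of `S(𝔤) = gr U(𝔤) → gr (U(𝔤)/I)`, that is, the
annihilator of `gr (U(𝔤)/I)` in `S(𝔤)`. -/
noncomputable def assocVariety (I : Ideal (UniversalEnvelopingAlgebra ℂ 𝔤)) : Set (Dual ℂ 𝔤) :=
  symZeroLocus (grAnnihilator ℂ 𝔤 (EnvQuot.gen I))

/-- Half the dimension of the coadjoint orbit of `(e, ·)` (orbits have even dimension). -/
noncomputable def halfOrbitDim (e f : 𝔤) : ℕ :=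
  varietyDim (coadjointOrbit (normalizedForm e f e)) / 2

end Complex

section RestrictScalars

/-- A complex Lie algebra as a Lie algebra over a subring of `ℂ`. -/
instance subringLieAlgebra {𝔤 : Type*} [LieRing 𝔤] [LieAlgebra ℂ 𝔤] (A : Subring ℂ) :
    LieAlgebra A 𝔤 where
  lie_smul a x y := lie_smul (a : ℂ) x y

/-- A module over a complex Lie algebra as a module over a subring of `ℂ`. -/
instance subringLieModule {𝔤 M : Type*} [LieRing 𝔤] [LieAlgebra ℂ 𝔤] [AddCommGroup M] [Module ℂ M]
    [LieRingModule 𝔤 M] [LieModule ℂ 𝔤 M] (A : Subring ℂ) : LieModule A 𝔤 M where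
  smul_lie a x m := smul_lie (a : ℂ) x m
  lie_smul a x m := lie_smul (a : ℂ) x m

end RestrictScalars

section HighestWeight

open LieAlgebra LieAlgebra.IsKilling

variable {𝔤 : Type*} [LieRing 𝔤] [LieAlgebra ℂ 𝔤] [FiniteDimensional ℂ 𝔤] [IsKilling ℂ 𝔤]
  {H : LieSubalgebra ℂ 𝔤} [H.IsCartanSubalgebra]

/-- The left ideal of `U(𝔤)` generated by `𝔫⁺` and all `h - μ(h)` with `h ∈ 𝔥`. -/
noncomputable def vermaIdeal (b : (rootSystem H).Base) (μ : Dual ℂ H) :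
    Submodule (UniversalEnvelopingAlgebra ℂ 𝔤) (UniversalEnvelopingAlgebra ℂ 𝔤) :=
  Submodule.span _
    ({u | ∃ γ : H.root, b.IsPos γ ∧ ∃ x ∈ rootSpace H γ.1, u = UniversalEnvelopingAlgebra.ι ℂ x} ∪
      {u | ∃ h : H, u = UniversalEnvelopingAlgebra.ι ℂ (h : 𝔤) - algebraMap ℂ _ (μ h)})

/-- The Verma module `M(μ)`. -/
abbrev VermaModule (b : (rootSystem H).Base) (μ : Dual ℂ H) : Type _ := EnvQuot (vermaIdeal b μ)

/-- The maximal submodule `M^max(μ)` of `M(μ)`: the sum of all proper submodules. -/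
noncomputable def vermaMax (b : (rootSystem H).Base) (μ : Dual ℂ H) :
    Submodule (UniversalEnvelopingAlgebra ℂ 𝔤) (VermaModule b μ) :=
  sSup {N | N ≠ ⊤}

/-- The annihilator in `U(𝔤)` of the image of the highest weight vector in `M(μ) / M^max(μ)`. -/
noncomputable def simpleIdeal (b : (rootSystem H).Base) (μ : Dual ℂ H) :
    Submodule (UniversalEnvelopingAlgebra ℂ 𝔤) (UniversalEnvelopingAlgebra ℂ 𝔤) :=
  (vermaMax b μ).comap (vermaIdeal b μ).mkQ

/-- The simple highest weight module `L(μ) = M(μ) / M^max(μ)`, written as the quotient of `U(𝔤)` by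
the preimage of `M^max(μ)`. -/
abbrev SimpleHighestWeight (b : (rootSystem H).Base) (μ : Dual ℂ H) : Type _ := EnvQuot (simpleIdeal b μ)

/-- The highest weight vector `v_μ` of `L(μ)`. -/
noncomputable abbrev highestVec (b : (rootSystem H).Base) (μ : Dual ℂ H) : SimpleHighestWeight b μ :=
  EnvQuot.gen (simpleIdeal b μ)

/-- The ideal `Ann_{U(𝔤)} L(μ)`. -/
noncomputable def primitiveIdeal (b : (rootSystem H).Base) (μ : Dual ℂ H) :
    Ideal (UniversalEnvelopingAlgebra ℂ 𝔤) :=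
  RingHom.ker (envAct ℂ 𝔤 (SimpleHighestWeight b μ))

/-- The root vectors `e_γ` of a Chevalley basis: `[e_γ, e_{-γ}] = h_γ`, and if `α + β` is a root,
then `[e_α, e_β] = N_{α,β} e_{α+β}` with `N_{α,β} = ±(r + 1)`, where `r` is the largest integer such
that `β - rα` is a root, and with `N_{-α,-β} = -N_{α,β}`. -/
structure IsChevalleySystem (X : H.root → 𝔤) : Prop where
  mem_rootSpace (γ : H.root) : X γ ∈ rootSpace H γ.1
  lie_neg (α β : H.root) (h : (rootSystem H).root β = -(rootSystem H).root α) :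
    ⁅X α, X β⁆ = ((rootSystem H).coroot α : 𝔤)
  lie_add : ∃ N : H.root → H.root → ℤ,
    (∀ α β γ : H.root,
      (rootSystem H).root γ = (rootSystem H).root α + (rootSystem H).root β →
        ⁅X α, X β⁆ = N α β • X γ ∧
          (N α β = (rootSystem H).chainBotCoeff α β + 1 ∨
            N α β = -((rootSystem H).chainBotCoeff α β + 1))) ∧
    (∀ α β γ α' β' : H.root,
      (rootSystem H).root γ = (rootSystem H).root α + (rootSystem H).root β →
      (rootSystem H).root α' = -(rootSystem H).root α →
      (rootSystem H).root β' = -(rootSystem H).root β → N α' β' = -N α β)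

/-- The Chevalley basis `{h_α : α ∈ Π} ∪ {e_γ : γ ∈ Φ}`. -/
noncomputable def chevalleyBasis (b : (rootSystem H).Base) (X : H.root → 𝔤) :
    b.support ⊕ H.root → 𝔤 :=
  Sum.elim (fun i => ((rootSystem H).coroot i : 𝔤)) X

theorem coroot_mem_span (b : (rootSystem H).Base) (X : H.root → 𝔤) (A : Subring ℂ) (α : H.root) :
    ((rootSystem H).coroot α : 𝔤) ∈ Submodule.span A (Set.range (chevalleyBasis b X)) := by
  have key : ∀ h : H, h ∈ AddSubmonoid.closure ((rootSystem H).coroot '' b.support) →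
      (h : 𝔤) ∈ Submodule.span A (Set.range (chevalleyBasis b X)) := by
    intro h hh
    induction hh using AddSubmonoid.closure_induction with
    | mem x hx =>
      obtain ⟨i, hi, rfl⟩ := hx
      exact Submodule.subset_span ⟨Sum.inl ⟨i, hi⟩, rfl⟩
    | zero => exact Submodule.zero_mem _
    | add x y _ _ hx hy => exact Submodule.add_mem _ hx hy
  rcases b.coroot_mem_or_neg_mem α with h | h
  · exact key _ h
  · have := Submodule.neg_mem _ (key _ h)
    simpa using this

theorem lie_mem_span_chevalleyBasis {b : (rootSystem H).Base} {X : H.root → 𝔤}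
    (hX : IsChevalleySystem X) (A : Subring ℂ) {x y : 𝔤}
    (hx : x ∈ Submodule.span A (Set.range (chevalleyBasis b X)))
    (hy : y ∈ Submodule.span A (Set.range (chevalleyBasis b X))) :
    ⁅x, y⁆ ∈ Submodule.span A (Set.range (chevalleyBasis b X)) := by
  have hint : ∀ (n : ℤ) (z : 𝔤), z ∈ Submodule.span A (Set.range (chevalleyBasis b X)) →
      n • z ∈ Submodule.span A (Set.range (chevalleyBasis b X)) :=
    fun n z hz => zsmul_mem hz n
  have hroot : ∀ γ : H.root, X γ ∈ Submodule.span A (Set.range (chevalleyBasis b X)) :=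
    fun γ => Submodule.subset_span ⟨Sum.inr γ, rfl⟩
  have hcr : ∀ α β : H.root, ⁅((rootSystem H).coroot α : 𝔤), X β⁆ ∈
      Submodule.span A (Set.range (chevalleyBasis b X)) := by
    intro α β
    have h1 := lie_eq_smul_of_mem_rootSpace (hX.mem_rootSpace β) ((rootSystem H).coroot α)
    have h2 : ⁅((rootSystem H).coroot α : 𝔤), X β⁆ =
        β.1 (coroot α.1) • X β := h1
    rw [h2, apply_coroot_eq_cast, Int.cast_smul_eq_zsmul]
    exact hint _ _ (hroot β)
  induction hx, hy using Submodule.span_induction₂ with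
  | zero_left y hy => rw [zero_lie]; exact Submodule.zero_mem _
  | zero_right x hx => rw [lie_zero]; exact Submodule.zero_mem _
  | add_left x y z _ _ _ h1 h2 => rw [add_lie]; exact Submodule.add_mem _ h1 h2
  | add_right x y z _ _ _ h1 h2 => rw [lie_add]; exact Submodule.add_mem _ h1 h2
  | smul_left r x y _ _ h => rw [smul_lie]; exact Submodule.smul_mem _ r h
  | smul_right r x y _ _ h => rw [lie_smul]; exact Submodule.smul_mem _ r h
  | mem_mem x y hx hy =>
    obtain ⟨i, rfl⟩ := hx
    obtain ⟨j, rfl⟩ := hy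
    rcases i with i | α <;> rcases j with j | β
    · have : ⁅(rootSystem H).coroot i.1, (rootSystem H).coroot j.1⁆ = 0 := trivial_lie_zero _ _ _ _
      have h0 : ⁅((rootSystem H).coroot i.1 : 𝔤), ((rootSystem H).coroot j.1 : 𝔤)⁆ = 0 := by
        rw [← LieSubalgebra.coe_bracket, this]; rfl
      simp only [chevalleyBasis, Sum.elim_inl, h0]
      exact Submodule.zero_mem _
    · exact hcr i.1 β
    · simp only [chevalleyBasis, Sum.elim_inl, Sum.elim_inr]
      rw [← lie_skew]
      exact Submodule.neg_mem _ (hcr j.1 α)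
    · simp only [chevalleyBasis, Sum.elim_inr]
      by_cases hneg : (rootSystem H).root β = -(rootSystem H).root α
      · rw [hX.lie_neg α β hneg]
        exact coroot_mem_span b X A α
      by_cases hsum : ∃ γ : H.root,
          (rootSystem H).root γ = (rootSystem H).root α + (rootSystem H).root β
      · obtain ⟨γ, hγ⟩ := hsum
        obtain ⟨N, hN, -⟩ := hX.lie_add
        rw [(hN α β γ hγ).1]
        exact hint _ _ (hroot γ)
      · have hmem := lie_mem_genWeightSpace_of_mem_genWeightSpace (hX.mem_rootSpace α)
          (hX.mem_rootSpace β)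
        have hbot : rootSpace H ((α.1 : H → ℂ) + (β.1 : H → ℂ)) = ⊥ := by
          by_contra hne
          let γ : LieModule.Weight ℂ H 𝔤 := ⟨(α.1 : H → ℂ) + (β.1 : H → ℂ), hne⟩
          have hγ : γ.IsNonZero := by
            intro h0
            apply hneg
            ext z
            have := congr_fun h0 z
            have h2 : α.1 z + β.1 z = 0 := this
            simpa using eq_neg_of_add_eq_zero_right h2
          apply hsum
          refine ⟨⟨γ, by simpa [LieSubalgebra.root] using hγ⟩, ?_⟩
          ext z
          rfl
        have hmem' : ⁅X α, X β⁆ ∈ rootSpace H ((α.1 : H → ℂ) + (β.1 : H → ℂ)) := hmem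
        rw [hbot, LieSubmodule.mem_bot] at hmem'
        rw [hmem']
        exact Submodule.zero_mem _

/-- The `A`-form `𝔤_A` of `𝔤`: the `A`-span of the Chevalley basis. -/
noncomputable def latticeLie (b : (rootSystem H).Base) {X : H.root → 𝔤} (hX : IsChevalleySystem X)
    (A : Subring ℂ) : LieSubalgebra A 𝔤 where
  toSubmodule := Submodule.span A (Set.range (chevalleyBasis b X))
  lie_mem' hx hy := lie_mem_span_chevalleyBasis hX A hx hy

/-- The `A`-form `L_A(μ) = U(𝔤_A) v_μ` of `L(μ)`, as a `𝔤_A`-module. -/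
noncomputable def latticeModule (b : (rootSystem H).Base) {X : H.root → 𝔤}
    (hX : IsChevalleySystem X) (μ : Dual ℂ H) (A : Subring ℂ) :
    LieSubmodule A (latticeLie b hX A) (SimpleHighestWeight b μ) :=
  LieSubmodule.lieSpan A (latticeLie b hX A) {highestVec b μ}

/-- The graded ring `R_A = S(𝔤_A) / J_A`, where `J_A` is the annihilator in `S(𝔤_A)` of
`gr L_A(μ) = ⨁_n U_n(𝔤_A) v_μ / U_{n-1}(𝔤_A) v_μ`. -/
abbrev GrQuotient (b : (rootSystem H).Base) {X : H.root → 𝔤} (hX : IsChevalleySystem X)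
    (μ : Dual ℂ H) (A : Subring ℂ) : Type _ :=
  SymmetricAlgebra A (latticeLie b hX A) ⧸
    grAnnihilator A (latticeLie b hX A) (highestVec b μ)

/-- `y ∈ R_A` is homogeneous: it is the image of an element of some `S^n(𝔤_A)`. -/
def IsHomogeneousElt (b : (rootSystem H).Base) {X : H.root → 𝔤} (hX : IsChevalleySystem X)
    (μ : Dual ℂ H) (A : Subring ℂ) (y : GrQuotient b hX μ A) : Prop :=
  ∃ n : ℕ, ∃ s ∈ (LinearMap.range (SymmetricAlgebra.ι A (latticeLie b hX A))) ^ n,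
    Ideal.Quotient.mk _ s = y

open scoped Classical in
/-- The standing assumptions on the ring `A`: it is `S⁻¹ℤ` for a finitely generated multiplicative
set `S` of nonzero integers, it contains all `μ(h_α)` with `α` simple, the numbers `κ(e, f)` and the
Gram determinant of `(· , ·)` with respect to the Chevalley basis are invertible in it, and `R_A` is
a torsion-free `A`-module. -/
structure IsAdmissibleRing (b : (rootSystem H).Base) {X : H.root → 𝔤} (hX : IsChevalleySystem X)
    (μ : Dual ℂ H) (e f : 𝔤) (A : Subring ℂ) : Prop where
  localization : ∃ T : Finset ℤ, 0 ∉ T ∧ A = Subring.closure ((fun t : ℤ => (t : ℂ)⁻¹) '' T)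
  weight_mem : ∀ i ∈ b.support, μ ((rootSystem H).coroot i) ∈ A
  killing_unit : ∃ u : Aˣ, ((u : A) : ℂ) = killingForm ℂ 𝔤 e f
  gram_unit : ∃ u : Aˣ, ((u : A) : ℂ) = (Matrix.of fun i j =>
    normalizedForm e f (chevalleyBasis b X i) (chevalleyBasis b X j)).det
  torsionFree : Module.IsTorsionFree A (GrQuotient b hX μ A)

end HighestWeight

/-! ### Reduced modules in characteristic `p` -/

section Modular

variable {k 𝔩 : Type*} [Field k] [LieRing 𝔩] [LieAlgebra k 𝔩]

/-- The two-sided ideal `I_η` of `U(𝔩)` generated by all `x^p - x^{[p]} - η(x)^p`, where `x^{[p]}`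
is the element `y ∈ 𝔩` with `ad y = (ad x)^p`. (Used for restricted `𝔩` with trivial centre, where
there is exactly one such `y`.) -/
def reducedIdeal (p : ℕ) (η : Dual k 𝔩) : TwoSidedIdeal (UniversalEnvelopingAlgebra k 𝔩) :=
  TwoSidedIdeal.span {u | ∃ x y : 𝔩, LieAlgebra.ad k 𝔩 y = LieAlgebra.ad k 𝔩 x ^ p ∧
    u = UniversalEnvelopingAlgebra.ι k x ^ p - UniversalEnvelopingAlgebra.ι k y -
      algebraMap k _ (η x ^ p)}

/-- The subspace `I_η · M` of an `𝔩`-module `M`. -/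
def reducedSubspace (p : ℕ) (η : Dual k 𝔩) (M : Type*) [AddCommGroup M] [Module k M]
    [LieRingModule 𝔩 M] [LieModule k 𝔩 M] : Submodule k M :=
  Submodule.span k {w | ∃ u ∈ reducedIdeal p η, ∃ m : M, w = envAct k 𝔩 M u m}

end Modular

section Reduction

open LieAlgebra LieAlgebra.IsKilling

variable {𝔤 : Type*} [LieRing 𝔤] [LieAlgebra ℂ 𝔤] [FiniteDimensional ℂ 𝔤] [IsKilling ℂ 𝔤]
  {H : LieSubalgebra ℂ 𝔤} [H.IsCartanSubalgebra]

/-- The Lie algebra `𝔤_k = k ⊗_A 𝔤_A`. -/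
abbrev ModularLie (b : (rootSystem H).Base) {X : H.root → 𝔤} (hX : IsChevalleySystem X)
    (A : Subring ℂ) (k : Type*) [Field k] [Algebra A k] : Type _ :=
  k ⊗[A] latticeLie b hX A

/-- The `𝔤_k`-module `L_p(μ) = k ⊗_A L_A(μ)`. -/
abbrev ModularModule (b : (rootSystem H).Base) {X : H.root → 𝔤} (hX : IsChevalleySystem X)
    (μ : Dual ℂ H) (A : Subring ℂ) (k : Type*) [Field k] [Algebra A k] : Type _ :=
  k ⊗[A] latticeModule b hX μ A

/-- The reduced module `L_p^η(μ) = L_p(μ) / I_η L_p(μ)`. -/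
abbrev ReducedModule (b : (rootSystem H).Base) {X : H.root → 𝔤} (hX : IsChevalleySystem X)
    (μ : Dual ℂ H) (A : Subring ℂ) (k : Type*) [Field k] [Algebra A k] (p : ℕ)
    (η : Dual k (ModularLie b hX A k)) : Type _ :=
  ModularModule b hX μ A k ⧸ reducedSubspace p η (ModularModule b hX μ A k)

end Reduction

/-! The bound splits into two independent inequalities: `dim L_p^η(μ) ≤ D p^d`, and `d ≤ d(e)`.

For the first, filter the reduced module by the powers of `U(𝔤_k)` acting on the image of `v_μ`. Its
associated graded module is spanned over `k` by the image of `gr L_A(μ)`. If `x` is a Chevalley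
basis element, `x^p` acts on the reduced module as `x^{[p]} + η(x)^p`, which has filtration degree
at most `1 < p`, so the symbol of `x` has zero `p`-th power on the graded module. Since `S(𝔤_k)` is
commutative of characteristic `p`, the same follows for every element coming from a homogeneous
element of positive degree, in particular for each `y_i`. Monomials in the `y_i` with exponents
below `p`, applied to the `D` generators, therefore span (`LieSpecialization.rank_grModule_le`,
`rank_quotient_reducedSubspace_le`).

For the second, compare growth rates. The `t^d` monomials in the `y_i` with exponents below `t` lift
to elements of `U_{O(t)}(𝔤_A) v_μ` that are independent over `A`. They stay independent over `ℂ`,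
because functionals that read off the `v_μ`-coefficient after applying raising words separate points
of `L(μ)` and are `A`-valued on the lattice (`HighestWeightDatum.linearIndependent_of_mem_lattice`).
Hence the part of `L(μ)` of depth `O(t)` has dimension `r ≥ t^d`. Products of `r` lowering words and
`r` raising words give `r^2` independent elements in degree `O(t)` of `U(𝔤)/Ann L(μ)`
(`HighestWeightDatum.finrank_negSpan_sq_le`). By Noether normalization, going up and the
Nullstellensatz, that quotient grows with exponent at most the dimension of its associated variety,
which is `dim O_χ` (`exists_finrank_cyclicFiltration_le_varietyDim`). Letting `t` grow gives `2d ≤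
dim O_χ`. -/

/-! ### The associated graded module of a cyclic module. -/

section CyclicFiltration

variable (R : Type*) (𝔩 : Type*) [CommRing R] [LieRing 𝔩] [LieAlgebra R 𝔩]
  {M : Type*} [AddCommGroup M] [Module R M] [LieRingModule 𝔩 M] [LieModule R 𝔩 M]

theorem cyclicFiltration_zero (v : M) : cyclicFiltration R 𝔩 v 0 = Submodule.span R {v} := by
  rw [cyclicFiltration, envFiltration, pow_zero, Submodule.one_eq_span, Submodule.map_span,
    Set.image_singleton]
  simp

theorem cyclicFiltration_succ (v : M) (n : ℕ) :
    cyclicFiltration R 𝔩 v (n + 1) = cyclicFiltration R 𝔩 v n ⊔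
      Submodule.span R {w | ∃ x : 𝔩, ∃ m ∈ cyclicFiltration R 𝔩 v n, w = ⁅x, m⁆} := by
  apply le_antisymm
  · rintro _ ⟨u, hu, rfl⟩
    rw [SetLike.mem_coe, envFiltration, pow_succ', Submodule.sup_mul, one_mul] at hu
    obtain ⟨a, ha, c, hc, rfl⟩ := Submodule.mem_sup.1 hu
    rw [map_add]
    refine Submodule.add_mem _ (Submodule.mem_sup_left ⟨a, ha, rfl⟩) (Submodule.mem_sup_right ?_)
    refine (Submodule.mul_le (P := (Submodule.span R _).comap (LinearMap.applyₗ v ∘ₗ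
      (envAct R 𝔩 M).toLinearMap))).2 ?_ hc
    rintro _ ⟨x, rfl⟩ z hz
    refine Submodule.subset_span ⟨x, _, ⟨z, hz, rfl⟩, ?_⟩
    simp only [LinearMap.comp_apply, AlgHom.toLinearMap_apply, LinearMap.applyₗ_apply_apply,
      map_mul, Module.End.mul_apply]
    exact envAct_ι_apply R 𝔩 M x _
  · refine sup_le (Submodule.map_mono ?_) (Submodule.span_le.2 ?_)
    · rw [envFiltration, envFiltration, pow_succ', Submodule.sup_mul, one_mul]
      exact le_sup_left
    · rintro _ ⟨x, m, hm, rfl⟩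
      exact lie_mem_cyclicFiltration v n x hm

theorem cyclicFiltration_mono (v : M) : Monotone (cyclicFiltration R 𝔩 v) :=
  monotone_nat_of_le_succ fun n => by rw [cyclicFiltration_succ]; exact le_sup_left

theorem self_mem_cyclicFiltration (v : M) (n : ℕ) : v ∈ cyclicFiltration R 𝔩 v n :=
  cyclicFiltration_mono R 𝔩 v (Nat.zero_le n)
    (by rw [cyclicFiltration_zero]; exact Submodule.mem_span_singleton_self v)

variable {R 𝔩}

/-- Minimality of the cyclic filtration among increasing filtrations that start at `v` and are
raised by one under `𝔩`; every later containment is obtained from it. -/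
theorem cyclicFiltration_le_of_lie_mem {v : M} {W : ℕ → Submodule R M} (hv : v ∈ W 0)
    (hW : Monotone W) (h : ∀ n (x : 𝔩), ∀ m ∈ W n, ⁅x, m⁆ ∈ W (n + 1)) (n : ℕ) :
    cyclicFiltration R 𝔩 v n ≤ W n := by
  induction n with
  | zero => rwa [cyclicFiltration_zero, Submodule.span_singleton_le_iff_mem]
  | succ n ih =>
    rw [cyclicFiltration_succ]
    refine sup_le (ih.trans (hW n.le_succ)) (Submodule.span_le.2 ?_)
    rintro _ ⟨x, m, hm, rfl⟩
    exact h n x m (ih hm)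

/-- The class in `gr_n` of an element of `U_n(𝔩) v`, as an element of the associated graded
module. -/
noncomputable def grMk (v : M) (n : ℕ) : cyclicFiltration R 𝔩 v n →ₗ[R] GrModule R 𝔩 v :=
  (DirectSum.lof R ℕ (GrPiece R 𝔩 v) n).comp (Submodule.mkQ _)

/-- The canonical generator of the associated graded module. -/
noncomputable def grGen (R : Type*) (𝔩 : Type*) [CommRing R] [LieRing 𝔩] [LieAlgebra R 𝔩]
    {M : Type*} [AddCommGroup M] [Module R M] [LieRingModule 𝔩 M] [LieModule R 𝔩 M] (v : M) :
    GrModule R 𝔩 v :=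
  grMk v 0 ⟨v, self_mem_cyclicFiltration R 𝔩 v 0⟩

theorem grMk_eq_zero_iff {v : M} {n : ℕ} {m : cyclicFiltration R 𝔩 v n} :
    grMk v n m = 0 ↔ (m : M) ∈ cyclicFiltrationLT R 𝔩 v n := by
  rw [grMk, LinearMap.comp_apply, DirectSum.lof_eq_of,
    map_eq_zero_iff _ (DirectSum.of_injective n), Submodule.mkQ_apply,
    Submodule.Quotient.mk_eq_zero]
  rfl

theorem grMk_succ_eq_zero {v : M} {n : ℕ} {m : M} (hm : m ∈ cyclicFiltration R 𝔩 v n)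
    (hm' : m ∈ cyclicFiltration R 𝔩 v (n + 1)) : grMk (R := R) (𝔩 := 𝔩) v (n + 1) ⟨m, hm'⟩ = 0 :=
  grMk_eq_zero_iff.2 hm

theorem grAct_grMk (v : M) (x : 𝔩) (n : ℕ) (m : cyclicFiltration R 𝔩 v n) :
    grAct R 𝔩 v x (grMk v n m) =
      grMk v (n + 1) ⟨⁅x, (m : M)⁆, lie_mem_cyclicFiltration v n x m.2⟩ := by
  simp only [grAct, grMk, LinearMap.coe_mk, AddHom.coe_mk, LinearMap.comp_apply,
    DirectSum.toModule_lof]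
  rfl

theorem range_grMk_zero (v : M) :
    LinearMap.range (grMk (R := R) (𝔩 := 𝔩) v 0) = Submodule.span R {grGen R 𝔩 v} := by
  apply le_antisymm
  · rintro _ ⟨⟨m, hm⟩, rfl⟩
    have hm' := hm
    rw [cyclicFiltration_zero, Submodule.mem_span_singleton] at hm'
    obtain ⟨r, rfl⟩ := hm'
    exact Submodule.mem_span_singleton.2 ⟨r, ((grMk v 0).map_smul r _).symm⟩
  · rw [Submodule.span_singleton_le_iff_mem]
    exact ⟨_, rfl⟩

/-- In `U_{n+1} v = U_n v + 𝔩 U_n v` the first summand has zero class in degree `n + 1`, so only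
brackets survive. -/
theorem range_grMk_succ_le (v : M) (n : ℕ) :
    LinearMap.range (grMk (R := R) (𝔩 := 𝔩) v (n + 1)) ≤
      Submodule.span R {w | ∃ x : 𝔩, ∃ m, w = grAct R 𝔩 v x (grMk v n m)} := by
  rintro _ ⟨⟨m, hm⟩, rfl⟩
  have hm' := hm
  rw [cyclicFiltration_succ, Submodule.mem_sup] at hm'
  obtain ⟨a, ha, c, hc, rfl⟩ := hm'
  have ha' := cyclicFiltration_mono R 𝔩 v n.le_succ ha
  have hle : Submodule.span R {w | ∃ x : 𝔩, ∃ m ∈ cyclicFiltration R 𝔩 v n, w = ⁅x, m⁆} ≤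
      cyclicFiltration R 𝔩 v (n + 1) := by
    rw [cyclicFiltration_succ]; exact le_sup_right
  have : grMk (R := R) (𝔩 := 𝔩) v (n + 1) ⟨a + c, hm⟩ = grMk v (n + 1) ⟨c, hle hc⟩ := by
    have h := (grMk (R := R) (𝔩 := 𝔩) v (n + 1)).map_add ⟨a, ha'⟩ ⟨c, hle hc⟩
    rw [grMk_succ_eq_zero ha, zero_add] at h
    exact h
  rw [this]
  have hall : ∀ c (hc : c ∈ Submodule.span R
      {w | ∃ x : 𝔩, ∃ m ∈ cyclicFiltration R 𝔩 v n, w = ⁅x, m⁆}), grMk v (n + 1) ⟨c, hle hc⟩ ∈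
      Submodule.span R {w | ∃ x : 𝔩, ∃ m, w = grAct R 𝔩 v x (grMk v n m)} := by
    intro c hc
    induction hc using Submodule.span_induction with
    | mem c hc =>
      obtain ⟨x, m, hm, rfl⟩ := hc
      exact Submodule.subset_span ⟨x, ⟨m, hm⟩, (grAct_grMk v x n ⟨m, hm⟩).symm⟩
    | zero =>
      convert Submodule.zero_mem _
      exact grMk_eq_zero_iff.2 (Submodule.zero_mem _)
    | add c c' hc hc' h h' =>
      have := LinearMap.map_add (grMk (R := R) (𝔩 := 𝔩) v (n + 1)) ⟨c, hle hc⟩ ⟨c', hle hc'⟩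
      exact this ▸ Submodule.add_mem _ h h'
    | smul r c hc h =>
      have := LinearMap.map_smul (grMk (R := R) (𝔩 := 𝔩) v (n + 1)) r ⟨c, hle hc⟩
      exact this ▸ Submodule.smul_mem _ r h
  exact hall c hc

theorem iSup_range_grMk (v : M) : ⨆ n, LinearMap.range (grMk (R := R) (𝔩 := 𝔩) v n) = ⊤ := by
  rw [eq_top_iff]
  rintro g -
  induction g using DirectSum.induction_on with
  | zero => exact Submodule.zero_mem _
  | of n q =>
    obtain ⟨m, rfl⟩ := Submodule.Quotient.mk_surjective _ q
    exact Submodule.mem_iSup_of_mem n ⟨m, rfl⟩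
  | add g h hg hh => exact Submodule.add_mem _ hg hh

/-- The homogeneous component of the symmetric algebra. -/
noncomputable abbrev symPow (R : Type*) (𝔩 : Type*) [CommRing R] [AddCommGroup 𝔩] [Module R 𝔩]
    (n : ℕ) : Submodule R (SymmetricAlgebra R 𝔩) :=
  (LinearMap.range (SymmetricAlgebra.ι R 𝔩)) ^ n

theorem range_grMk_le (v : M) (n : ℕ) :
    LinearMap.range (grMk (R := R) (𝔩 := 𝔩) v n) ≤
      (symPow R 𝔩 n).map ((LinearMap.applyₗ (grGen R 𝔩 v)).comp
        (grSymAct R 𝔩 v).toLinearMap) := by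
  induction n with
  | zero =>
    rw [range_grMk_zero, Submodule.span_singleton_le_iff_mem]
    exact ⟨1, by rw [symPow, pow_zero]; exact Submodule.one_le.1 le_rfl, by simp⟩
  | succ n ih =>
    refine (range_grMk_succ_le v n).trans (Submodule.span_le.2 ?_)
    rintro _ ⟨x, m, rfl⟩
    obtain ⟨s, hs, h⟩ := ih ⟨m, rfl⟩
    refine ⟨SymmetricAlgebra.ι R 𝔩 x * s, ?_, ?_⟩
    · rw [symPow, pow_succ']
      exact Submodule.mul_mem_mul ⟨x, rfl⟩ hs
    · rw [← h]
      simp [grSymAct_ι]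

theorem grSymAct_grGen_surjective (v : M) (g : GrModule R 𝔩 v) :
    ∃ s, grSymAct R 𝔩 v s (grGen R 𝔩 v) = g := by
  have h : LinearMap.range ((LinearMap.applyₗ (grGen R 𝔩 v)).comp
      (grSymAct R 𝔩 v).toLinearMap) = ⊤ := by
    rw [eq_top_iff, ← iSup_range_grMk v, iSup_le_iff]
    exact fun n => (range_grMk_le v n).trans LinearMap.map_le_range
  exact LinearMap.range_eq_top.1 h g

/-- The graded module is cyclic over a commutative ring, so what kills the generator kills
everything. Hence `S(𝔩)/Ann` embeds in the graded module by evaluation at the generator. -/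
theorem mem_grAnnihilator_iff {v : M} {s : SymmetricAlgebra R 𝔩} :
    s ∈ grAnnihilator R 𝔩 v ↔ grSymAct R 𝔩 v s (grGen R 𝔩 v) = 0 := by
  refine ⟨fun h => ?_, fun h => ?_⟩
  · rw [grAnnihilator, RingHom.mem_ker] at h
    rw [h, LinearMap.zero_apply]
  · rw [grAnnihilator, RingHom.mem_ker]
    refine LinearMap.ext fun g => ?_
    obtain ⟨t, rfl⟩ := grSymAct_grGen_surjective v g
    rw [← Module.End.mul_apply, ← map_mul, mul_comm, map_mul, Module.End.mul_apply, h, map_zero,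
      LinearMap.zero_apply]

theorem grSymAct_grMk_mem (v : M) {k : ℕ} {s : SymmetricAlgebra R 𝔩} (hs : s ∈ symPow R 𝔩 k)
    (n : ℕ) (m : cyclicFiltration R 𝔩 v n) :
    grSymAct R 𝔩 v s (grMk v n m) ∈ LinearMap.range (grMk (R := R) (𝔩 := 𝔩) v (n + k)) := by
  induction k generalizing s with
  | zero =>
    rw [symPow, pow_zero, Submodule.mem_one] at hs
    obtain ⟨r, rfl⟩ := hs
    exact ⟨r • m, by simp [Algebra.algebraMap_eq_smul_one]⟩
  | succ k ih =>
    rw [symPow, pow_succ'] at hs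
    refine (Submodule.mul_le (P := (LinearMap.range (grMk (R := R) (𝔩 := 𝔩) v (n + (k + 1)))).comap
      ((LinearMap.applyₗ (grMk v n m)).comp (grSymAct R 𝔩 v).toLinearMap))).2 ?_ hs
    rintro _ ⟨x, rfl⟩ t ht
    obtain ⟨m', hm'⟩ := ih ht
    rw [Submodule.mem_comap, LinearMap.comp_apply, AlgHom.toLinearMap_apply,
      LinearMap.applyₗ_apply_apply, map_mul, Module.End.mul_apply, ← hm', grSymAct_ι, grAct_grMk]
    exact ⟨_, rfl⟩

end CyclicFiltration

/-! ### Comparison of a filtered module over a field with its graded module. -/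

section Splitting

variable {K : Type*} {𝔩 : Type*} [Field K] [LieRing 𝔩] [LieAlgebra K 𝔩]
  {M : Type*} [AddCommGroup M] [Module K M] [LieRingModule 𝔩 M] [LieModule K 𝔩 M]

/-- Over a field each projection `U_n v → gr_n` has a linear section; `T` is the sum of the
sections. An element of `U_n v` differs from the lift of its class by an element one step lower, so
induction on `n` applies. -/
theorem exists_linearMap_grModule (v : M) : ∃ T : GrModule K 𝔩 v →ₗ[K] M, ∀ n,
    cyclicFiltration K 𝔩 v n ≤
      (⨆ i ∈ Finset.range (n + 1), LinearMap.range (grMk (R := K) (𝔩 := 𝔩) v i)).map T := by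
  have hsec : ∀ n, ∃ σ : GrPiece K 𝔩 v n →ₗ[K] cyclicFiltration K 𝔩 v n,
      (Submodule.mkQ _) ∘ₗ σ = LinearMap.id := fun n =>
    LinearMap.exists_rightInverse_of_surjective _ (Submodule.range_mkQ _)
  choose σ hσ using hsec
  refine ⟨DirectSum.toModule K ℕ M fun n => (Submodule.subtype _).comp (σ n), fun n => ?_⟩
  have key : ∀ n (m : cyclicFiltration K 𝔩 v n), ∃ m' ∈ cyclicFiltrationLT K 𝔩 v n,
      (m : M) = DirectSum.toModule K ℕ M (fun n => (Submodule.subtype _).comp (σ n))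
        (grMk v n m) + m' := by
    intro n m
    refine ⟨(m : M) - DirectSum.toModule K ℕ M (fun n => (Submodule.subtype _).comp (σ n))
        (grMk v n m), ?_, by abel⟩
    have h := LinearMap.congr_fun (hσ n) (Submodule.mkQ _ m)
    simp only [LinearMap.comp_apply, LinearMap.id_apply] at h
    rw [← sub_eq_zero, ← map_sub, Submodule.mkQ_apply, Submodule.Quotient.mk_eq_zero] at h
    change _ ∈ cyclicFiltrationLT K 𝔩 v n at h
    rw [← Submodule.neg_mem_iff, neg_sub]
    simpa [grMk] using h
  induction n with
  | zero =>
    intro m hm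
    obtain ⟨m', hm', h⟩ := key 0 ⟨m, hm⟩
    rw [cyclicFiltrationLT, Submodule.mem_bot] at hm'
    rw [hm', add_zero] at h
    exact ⟨_, Submodule.mem_iSup_of_mem 0 (Submodule.mem_iSup_of_mem (by simp) ⟨_, rfl⟩), h.symm⟩
  | succ n ih =>
    intro m hm
    obtain ⟨m', hm', h⟩ := key (n + 1) ⟨m, hm⟩
    change m = _ at h
    rw [h]
    refine Submodule.add_mem _ ⟨_, Submodule.mem_iSup_of_mem (n + 1)
      (Submodule.mem_iSup_of_mem (by simp) ⟨_, rfl⟩), rfl⟩ (Submodule.map_mono ?_ (ih hm'))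
    exact biSup_mono fun i hi => by simp at hi ⊢; omega

theorem rank_le_rank_grModule (v : M) (h : ⨆ n, cyclicFiltration K 𝔩 v n = ⊤) :
    Module.rank K M ≤ Module.rank K (GrModule K 𝔩 v) := by
  obtain ⟨T, hT⟩ := exists_linearMap_grModule (K := K) (𝔩 := 𝔩) v
  refine LinearMap.rank_le_of_surjective T (LinearMap.range_eq_top.1 ?_)
  rw [eq_top_iff, ← h, iSup_le_iff]
  exact fun n => (hT n).trans LinearMap.map_le_range

theorem biSup_range_grMk_le (v : M) (n : ℕ) :
    ⨆ i ∈ Finset.range (n + 1), LinearMap.range (grMk (R := K) (𝔩 := 𝔩) v i) ≤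
      ((1 ⊔ LinearMap.range (SymmetricAlgebra.ι K 𝔩)) ^ n).map
        ((LinearMap.applyₗ (grGen K 𝔩 v)).comp (grSymAct K 𝔩 v).toLinearMap) := by
  refine iSup₂_le fun i hi => (range_grMk_le v i).trans (Submodule.map_mono ?_)
  exact (pow_le_pow_left' le_sup_right i).trans
    (pow_le_pow_right' le_sup_left (by simp at hi; omega))

/-- Evaluation at the generator followed by the splitting `T` maps the degree `≤ n` part of
`S(𝔩)/Ann` onto a space containing `U_n v`. Growth of the module is thereby bounded by growth of a
commutative algebra. -/
theorem finrank_cyclicFiltration_le [FiniteDimensional K 𝔩] (v : M) (n : ℕ) :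
    finrank K (cyclicFiltration K 𝔩 v n) ≤
      finrank K (((1 ⊔ LinearMap.range (SymmetricAlgebra.ι K 𝔩)) ^ n).map
        (Ideal.Quotient.mkₐ K (grAnnihilator K 𝔩 v)).toLinearMap) := by
  obtain ⟨T, hT⟩ := exists_linearMap_grModule (K := K) (𝔩 := 𝔩) v
  let ev : (SymmetricAlgebra K 𝔩 ⧸ grAnnihilator K 𝔩 v) →ₗ[K] GrModule K 𝔩 v :=
    (LinearMap.applyₗ (grGen K 𝔩 v)).comp
      (Ideal.Quotient.liftₐ (grAnnihilator K 𝔩 v) (grSymAct K 𝔩 v) fun s hs => hs).toLinearMap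
  have hfin : FiniteDimensional K (((1 ⊔ LinearMap.range (SymmetricAlgebra.ι K 𝔩)) ^ n).map
        (Ideal.Quotient.mkₐ K (grAnnihilator K 𝔩 v)).toLinearMap) := by
    have : ((1 ⊔ LinearMap.range (SymmetricAlgebra.ι K 𝔩)) ^ n).FG := by
      refine Submodule.FG.pow (Submodule.FG.sup ?_ ?_) n
      · rw [Submodule.one_eq_span]; exact Submodule.fg_span_singleton _
      · rw [LinearMap.range_eq_map]; exact (Module.Finite.fg_top (R := K) (M := 𝔩)).map _
    exact Module.Finite.iff_fg.2 (this.map _)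
  have hle : cyclicFiltration K 𝔩 v n ≤ (((1 ⊔ LinearMap.range (SymmetricAlgebra.ι K 𝔩)) ^ n).map
        (Ideal.Quotient.mkₐ K (grAnnihilator K 𝔩 v)).toLinearMap).map (T.comp ev) := by
    refine (hT n).trans ?_
    rw [Submodule.map_comp]
    refine Submodule.map_mono ((biSup_range_grMk_le v n).trans ?_)
    rintro _ ⟨s, hs, rfl⟩
    exact ⟨_, ⟨s, hs, rfl⟩, rfl⟩
  exact (Submodule.finrank_mono hle).trans (Submodule.finrank_map_le _ _)

end Splitting

/-! ### Growth of a finitely generated commutative algebra and its Krull dimension. -/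

section Growth

variable {K B : Type*} [Field K] [CommRing B] [Algebra K B] {s : ℕ}

/-- The span of all monomials in a family `t` with exponents at most `n`. -/
def boxSpan (K : Type*) {B : Type*} [Field K] [CommRing B] [Algebra K B] {s : ℕ} (t : Fin s → B)
    (n : ℕ) : Submodule K B :=
  Submodule.span K (Set.range fun a : Fin s → Fin (n + 1) => ∏ i, t i ^ (a i : ℕ))

theorem prod_pow_mem_boxSpan (t : Fin s → B) {n : ℕ} (a : Fin s → ℕ) (ha : ∀ i, a i ≤ n) :
    ∏ i, t i ^ a i ∈ boxSpan K t n :=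
  Submodule.subset_span ⟨fun i => ⟨a i, Nat.lt_succ_of_le (ha i)⟩, rfl⟩

theorem boxSpan_mono (t : Fin s → B) : Monotone (boxSpan K t) := by
  intro n m h
  refine Submodule.span_le.2 ?_
  rintro _ ⟨a, rfl⟩
  exact prod_pow_mem_boxSpan t _ fun i => (Nat.le_of_lt_succ (a i).2).trans h

theorem boxSpan_mul_le (t : Fin s → B) (n m : ℕ) :
    boxSpan K t n * boxSpan K t m ≤ boxSpan K t (n + m) := by
  rw [boxSpan, boxSpan, Submodule.span_mul_span, Submodule.span_le]
  rintro _ ⟨_, ⟨a, rfl⟩, _, ⟨c, rfl⟩, rfl⟩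
  have := prod_pow_mem_boxSpan (K := K) (n := n + m) t (fun i => (a i : ℕ) + (c i : ℕ))
    fun i => add_le_add (Nat.le_of_lt_succ (a i).2) (Nat.le_of_lt_succ (c i).2)
  simp only [pow_add, Finset.prod_mul_distrib] at this
  exact this

theorem one_mem_boxSpan (t : Fin s → B) (n : ℕ) : (1 : B) ∈ boxSpan K t n := by
  simpa using prod_pow_mem_boxSpan (K := K) (n := n) t 0 (by simp)

theorem exists_aeval_mem_boxSpan (t : Fin s → B) (f : MvPolynomial (Fin s) K) :
    ∃ n, MvPolynomial.aeval t f ∈ boxSpan K t n := by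
  induction f using MvPolynomial.induction_on with
  | C a =>
    refine ⟨0, ?_⟩
    rw [MvPolynomial.algHom_C, Algebra.algebraMap_eq_smul_one]
    exact Submodule.smul_mem _ _ (one_mem_boxSpan t 0)
  | add f g hf hg =>
    obtain ⟨n, hn⟩ := hf
    obtain ⟨m, hm⟩ := hg
    refine ⟨max n m, ?_⟩
    rw [map_add]
    exact Submodule.add_mem _ (boxSpan_mono t (le_max_left n m) hn)
      (boxSpan_mono t (le_max_right n m) hm)
  | mul_X f i hf =>
    obtain ⟨n, hn⟩ := hf
    refine ⟨n + 1, ?_⟩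
    rw [map_mul, MvPolynomial.aeval_X]
    refine boxSpan_mul_le t n 1 (Submodule.mul_mem_mul hn ?_)
    have := prod_pow_mem_boxSpan (K := K) (n := 1) t (Pi.single i 1)
      fun j => by by_cases h : j = i <;> simp [h]
    simpa [Pi.single_apply, pow_ite] using this

theorem finrank_boxSpan_mul_le (t : Fin s → B) (S : Finset B) (n : ℕ) :
    finrank K (boxSpan K t n * Submodule.span K (S : Set B) : Submodule K B) ≤
      (n + 1) ^ s * S.card := by
  classical
  have h : (boxSpan K t n * Submodule.span K (S : Set B) : Submodule K B) = Submodule.span K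
      (Finset.image (fun q : (Fin s → Fin (n + 1)) × S => (∏ i, t i ^ (q.1 i : ℕ)) * q.2)
        Finset.univ : Finset B) := by
    rw [boxSpan, Submodule.span_mul_span]
    congr 1
    ext z
    simp [Set.mem_mul]
  rw [h]
  refine (finrank_span_finset_le_card _).trans (Finset.card_image_le.trans ?_)
  simp

/-- Multiplying by `1 + V` enlarges the box of exponents by a fixed amount, so `(1 + V)^n` lies in a
box of side linear in `n`, and such a box has `O(n^s)` monomials. -/
theorem exists_finrank_pow_le_of_finite (t : Fin s → B) (S : Finset B)
    (hS : ∀ z : B, ∃ n, z ∈ boxSpan K t n * Submodule.span K (S : Set B)) (V : Submodule K B)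
    (hV : V.FG) : ∃ C, ∀ n, finrank K ((1 ⊔ V) ^ n : Submodule K B) ≤ C * (n + 1) ^ s := by
  set W : ℕ → Submodule K B := fun n => boxSpan K t n * Submodule.span K (S : Set B) with hW
  have hWmono : Monotone W := fun n m h => mul_le_mul' (boxSpan_mono t h) le_rfl
  have hone : (1 : Submodule K B).FG := by
    rw [Submodule.one_eq_span]; exact Submodule.fg_span_singleton _
  -- `N` absorbs both `1`, for the start of the induction, and `(1 + V) S`, for its step. The left
  -- side is finitely generated, so one box suffices.
  obtain ⟨N, hN⟩ : ∃ N, 1 ⊔ (1 ⊔ V) * Submodule.span K (S : Set B) ≤ W N := by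
    obtain ⟨F, hF⟩ := hone.sup ((hone.sup hV).mul ⟨S, rfl⟩)
    choose f hf using hS
    refine ⟨F.sup f, ?_⟩
    rw [← hF, Submodule.span_le]
    exact fun z hz => hWmono (Finset.le_sup hz) (hf z)
  have hstep : ∀ n, (1 ⊔ V) * W n ≤ W (n + N) := by
    intro n
    calc (1 ⊔ V) * W n = boxSpan K t n * ((1 ⊔ V) * Submodule.span K (S : Set B)) := by
          rw [hW, ← mul_assoc, mul_comm (1 ⊔ V), mul_assoc]
      _ ≤ boxSpan K t n * W N := mul_le_mul' le_rfl (le_sup_right.trans hN)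
      _ ≤ W (n + N) := by
          rw [hW, ← mul_assoc]
          exact mul_le_mul' (boxSpan_mul_le t n N) le_rfl
  have hpow : ∀ n, (1 ⊔ V) ^ n ≤ W (N * (n + 1)) := by
    intro n
    induction n with
    | zero => simpa using le_sup_left.trans hN
    | succ n ih =>
      rw [pow_succ']
      exact (mul_le_mul' le_rfl ih).trans (hstep _)
  refine ⟨(N + 1) ^ s * S.card, fun n => ?_⟩
  have : Module.Finite K (W (N * (n + 1))) :=
    Module.Finite.iff_fg.2 (Submodule.FG.mul (Submodule.fg_span (Set.finite_range _)) ⟨S, rfl⟩)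
  refine (Submodule.finrank_mono (hpow n)).trans ((finrank_boxSpan_mul_le t S _).trans ?_)
  calc (N * (n + 1) + 1) ^ s * S.card ≤ ((N + 1) * (n + 1)) ^ s * S.card := by
        gcongr; nlinarith
    _ = _ := by rw [mul_pow]; ring

/-- Chains of primes of `P` lift to `B` by lying over and going up; the lifted chain is strict
because its contractions are distinct. -/
theorem ringKrullDim_le_of_isIntegral {P B : Type*} [CommRing P] [CommRing B] [Algebra P B]
    [Algebra.IsIntegral P B] (hinj : Function.Injective (algebraMap P B)) :
    ringKrullDim P ≤ ringKrullDim B := by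
  have key : ∀ l : LTSeries (PrimeSpectrum P), ∃ l' : LTSeries (PrimeSpectrum B),
      l'.length = l.length ∧ PrimeSpectrum.comap (algebraMap P B) l'.last = l.last := by
    intro l
    induction l using RelSeries.inductionOn' with
    | singleton x =>
      obtain ⟨Q, -, hQ, hQx⟩ := Ideal.exists_ideal_over_prime_of_isIntegral x.asIdeal (⊥ : Ideal B)
        (by rw [← RingHom.ker_eq_comap_bot, (RingHom.injective_iff_ker_eq_bot _).1 hinj]
            exact bot_le)
      exact ⟨RelSeries.singleton _ ⟨Q, hQ⟩, rfl, PrimeSpectrum.ext hQx⟩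
    | snoc l x hx ih =>
      obtain ⟨l', hl', hlast⟩ := ih
      obtain ⟨Q, hle, hQ, hQx⟩ := Ideal.exists_ideal_over_prime_of_isIntegral x.asIdeal
        l'.last.asIdeal (by
          have := congrArg PrimeSpectrum.asIdeal hlast
          rw [PrimeSpectrum.comap_asIdeal] at this
          rw [this]
          exact le_of_lt hx)
      refine ⟨l'.snoc ⟨Q, hQ⟩ (lt_of_le_of_ne hle fun h => ?_), by simp [hl'], ?_⟩
      · refine ne_of_lt hx (PrimeSpectrum.ext ?_)
        rw [← hQx, ← hlast, PrimeSpectrum.comap_asIdeal, h]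
      · simp only [RelSeries.last_snoc]
        exact PrimeSpectrum.ext hQx
  rw [ringKrullDim, ringKrullDim, Order.krullDim]
  refine iSup_le fun l => ?_
  obtain ⟨l', h, -⟩ := key l
  rw [← h]
  exact Order.LTSeries.length_le_krullDim l'

/-- Noether normalization makes `B` finite over a polynomial ring in `s` variables. This `s` bounds
the growth, and `s ≤ dim B` is the only relation with the dimension that is needed. -/
theorem exists_finrank_pow_le_ringKrullDim [Nontrivial B] (V : Submodule K B) (hV : V.FG)
    (hgen : Algebra.adjoin K (V : Set B) = ⊤) : ∃ s C : ℕ, (s : WithBot ℕ∞) ≤ ringKrullDim B ∧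
      ∀ n, finrank K ((1 ⊔ V) ^ n : Submodule K B) ≤ C * (n + 1) ^ s := by
  have : Algebra.FiniteType K B := by
    obtain ⟨F, hF⟩ := hV
    refine ⟨F, ?_⟩
    rw [← hgen, ← hF, Algebra.adjoin_span]
  obtain ⟨s, g, hinj, hfin⟩ := exists_finite_inj_algHom_of_fg K B
  let := g.toRingHom.toAlgebra
  have : IsScalarTower K (MvPolynomial (Fin s) K) B := IsScalarTower.of_algebraMap_eq fun r =>
    (g.commutes r).symm
  have : Module.Finite (MvPolynomial (Fin s) K) B := hfin
  refine ⟨s, ?_⟩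
  obtain ⟨S, hS⟩ := Module.Finite.fg_top (R := MvPolynomial (Fin s) K) (M := B)
  have hg : g = MvPolynomial.aeval fun i => g (MvPolynomial.X i) := MvPolynomial.aeval_unique g
  obtain ⟨C, hC⟩ := exists_finrank_pow_le_of_finite (fun i => g (MvPolynomial.X i)) S (fun z => by
    have hz : z ∈ Submodule.span (MvPolynomial (Fin s) K) (S : Set B) := hS ▸ Submodule.mem_top
    induction hz using Submodule.span_induction with
    | mem z hz =>
      refine ⟨0, ?_⟩
      rw [← one_mul z]
      exact Submodule.mul_mem_mul (one_mem_boxSpan _ 0) (Submodule.subset_span hz)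
    | zero => exact ⟨0, Submodule.zero_mem _⟩
    | add z w _ _ hz hw =>
      obtain ⟨n, hn⟩ := hz
      obtain ⟨m, hm⟩ := hw
      exact ⟨max n m, Submodule.add_mem _
        (mul_le_mul' (boxSpan_mono _ (le_max_left n m)) le_rfl hn)
        (mul_le_mul' (boxSpan_mono _ (le_max_right n m)) le_rfl hm)⟩
    | smul f z _ hz =>
      obtain ⟨n, hn⟩ := hz
      obtain ⟨m, hm⟩ := exists_aeval_mem_boxSpan (K := K) (fun i => g (MvPolynomial.X i)) f
      refine ⟨m + n, ?_⟩
      have : f • z = MvPolynomial.aeval (fun i => g (MvPolynomial.X i)) f * z := by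
        rw [← hg]; rfl
      rw [this]
      refine mul_le_mul' (boxSpan_mul_le _ m n) le_rfl ?_
      rw [mul_assoc]
      exact Submodule.mul_mem_mul hm hn) V hV
  refine ⟨C, ?_, hC⟩
  have h1 := ringKrullDim_le_of_isIntegral (P := MvPolynomial (Fin s) K) (B := B) hinj
  rw [MvPolynomial.ringKrullDim_of_isNoetherianRing, ringKrullDim_eq_zero_of_field, zero_add,
    Nat.card_fin] at h1
  exact h1

end Growth

/-! ### Dimension of zero loci in the dual space. -/

section Nullstellensatz

variable {K 𝔤 : Type*} [Field K] [AddCommGroup 𝔤] [Module K 𝔤]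

theorem mem_radical_of_symEval_eq_zero [IsAlgClosed K] [FiniteDimensional K 𝔤]
    (J : Ideal (SymmetricAlgebra K 𝔤)) {f : SymmetricAlgebra K 𝔤}
    (hf : ∀ η ∈ symZeroLocus J, symEval η f = 0) : f ∈ J.radical := by
  let b := Module.finBasis K 𝔤
  let e := SymmetricAlgebra.equivMvPolynomial b
  have heval : ∀ (x : Fin (finrank K 𝔤) → K) (g : SymmetricAlgebra K 𝔤),
      symEval (b.constr K x) g = MvPolynomial.aeval x (e g) := by
    intro x g
    have : symEval (b.constr K x) = (MvPolynomial.aeval x).comp e.toAlgHom := by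
      refine SymmetricAlgebra.algHom_ext (b.ext fun i => ?_)
      simp [symEval, e]
    rw [this]; rfl
  have hmem : e f ∈ MvPolynomial.vanishingIdeal K
      (MvPolynomial.zeroLocus K (J.comap e.symm.toAlgHom)) := by
    intro x hx
    rw [← heval]
    refine hf _ fun g hg => ?_
    rw [heval]
    exact hx _ (by simpa using hg)
  rw [MvPolynomial.vanishingIdeal_zeroLocus_eq_radical] at hmem
  obtain ⟨n, hn⟩ := hmem
  exact ⟨n, by simpa using hn⟩

theorem ringKrullDim_quotient_le_of_le_radical {S : Type*} [CommRing S] {I J : Ideal S}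
    (h : I ≤ J.radical) : ringKrullDim (S ⧸ J) ≤ ringKrullDim (S ⧸ I) := by
  rw [ringKrullDim_quotient, ringKrullDim_quotient]
  have hle : PrimeSpectrum.zeroLocus (J : Set S) ⊆ PrimeSpectrum.zeroLocus (I : Set S) := by
    rw [← PrimeSpectrum.zeroLocus_radical J]
    exact PrimeSpectrum.zeroLocus_anti_mono h
  exact Order.krullDim_le_of_strictMono (Set.inclusion hle) fun _ _ h => h

/-- The Nullstellensatz puts the ideal of `Z` inside the radical of `J`, and passing to the radical
does not change the primes containing an ideal. -/
theorem le_varietyDim [IsAlgClosed K] [FiniteDimensional K 𝔤] {J : Ideal (SymmetricAlgebra K 𝔤)}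
    {Z : Set (Dual K 𝔤)} (h : symZeroLocus J = zariskiClosure Z) {n : ℕ}
    (hn : (n : WithBot ℕ∞) ≤ ringKrullDim (SymmetricAlgebra K 𝔤 ⧸ J)) : n ≤ varietyDim Z := by
  have hrad : symVanishingIdeal Z ≤ J.radical := fun f hf =>
    mem_radical_of_symEval_eq_zero J fun η hη => by
      rw [h] at hη
      exact hη f hf
  have h1 := hn.trans (ringKrullDim_quotient_le_of_le_radical hrad)
  -- `varietyDim` sends an infinite dimension to `0`, so finiteness must be known before the lower
  -- bound can be read as one in `ℕ`.
  have h2 : ringKrullDim (SymmetricAlgebra K 𝔤 ⧸ symVanishingIdeal Z) ≤ (finrank K 𝔤 : ℕ) := by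
    refine (ringKrullDim_quotient_le _).trans ?_
    rw [ringKrullDim_eq_of_ringEquiv
      (SymmetricAlgebra.equivMvPolynomial (Module.finBasis K 𝔤)).toRingEquiv,
      MvPolynomial.ringKrullDim_of_isNoetherianRing, ringKrullDim_eq_zero_of_field, zero_add,
      Nat.card_fin]
  rw [varietyDim]
  generalize ringKrullDim (SymmetricAlgebra K 𝔤 ⧸ symVanishingIdeal Z) = r at h1 h2
  induction r with
  | bot => simp at h1
  | coe r =>
    rw [WithBot.unbotD_coe]
    have h1' : (n : ℕ∞) ≤ r := by exact_mod_cast h1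
    have h2' : r ≤ (finrank K 𝔤 : ℕ) := by exact_mod_cast h2
    lift r to ℕ using ne_top_of_le_ne_top (ENat.natCast_ne_top _) h2'
    simpa using h1'

end Nullstellensatz

theorem SymmetricAlgebra.adjoin_range_ι (R 𝔩 : Type*) [CommRing R] [AddCommGroup 𝔩] [Module R 𝔩] :
    Algebra.adjoin R (Set.range (SymmetricAlgebra.ι R 𝔩)) = ⊤ := by
  rw [eq_top_iff]
  rintro a -
  induction a using SymmetricAlgebra.induction with
  | algebraMap r => exact Subalgebra.algebraMap_mem _ r
  | ι x => exact Algebra.subset_adjoin ⟨x, rfl⟩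
  | mul a b ha hb => exact Subalgebra.mul_mem _ ha hb
  | add a b ha hb => exact Subalgebra.add_mem _ ha hb

/-- Applied below to `U(𝔤)/Ann L(μ)`. The condition `v ≠ 0` makes `S(𝔩)/Ann` nontrivial, as Noether
normalization requires. -/
theorem exists_finrank_cyclicFiltration_le_varietyDim {K 𝔩 M : Type*} [Field K] [IsAlgClosed K]
    [LieRing 𝔩] [LieAlgebra K 𝔩] [FiniteDimensional K 𝔩] [AddCommGroup M] [Module K M]
    [LieRingModule 𝔩 M] [LieModule K 𝔩 M] {v : M} (hv : v ≠ 0) {Z : Set (Dual K 𝔩)}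
    (h : symZeroLocus (grAnnihilator K 𝔩 v) = zariskiClosure Z) :
    ∃ s C : ℕ, s ≤ varietyDim Z ∧ ∀ n, finrank K (cyclicFiltration K 𝔩 v n) ≤ C * (n + 1) ^ s := by
  have hJ : grAnnihilator K 𝔩 v ≠ ⊤ := by
    intro h
    have h1 : (1 : SymmetricAlgebra K 𝔩) ∈ grAnnihilator K 𝔩 v := h ▸ Submodule.mem_top
    rw [mem_grAnnihilator_iff, map_one, Module.End.one_apply, grGen, grMk_eq_zero_iff] at h1
    exact hv h1
  have : Nontrivial (SymmetricAlgebra K 𝔩 ⧸ grAnnihilator K 𝔩 v) :=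
    Ideal.Quotient.nontrivial_iff.2 hJ
  let q := Ideal.Quotient.mkₐ K (grAnnihilator K 𝔩 v)
  let V := (LinearMap.range (SymmetricAlgebra.ι K 𝔩)).map q.toLinearMap
  have hV : V.FG := by
    refine Submodule.FG.map _ ?_
    rw [LinearMap.range_eq_map]
    exact (Module.Finite.fg_top (R := K) (M := 𝔩)).map _
  have hgen : Algebra.adjoin K (V : Set (SymmetricAlgebra K 𝔩 ⧸ grAnnihilator K 𝔩 v)) = ⊤ := by
    have : (V : Set (SymmetricAlgebra K 𝔩 ⧸ grAnnihilator K 𝔩 v)) =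
        q '' Set.range (SymmetricAlgebra.ι K 𝔩) := rfl
    rw [this, ← AlgHom.map_adjoin, SymmetricAlgebra.adjoin_range_ι, Algebra.map_top,
      AlgHom.range_eq_top]
    exact Ideal.Quotient.mkₐ_surjective _ _
  obtain ⟨s, C, hs, hC⟩ := exists_finrank_pow_le_ringKrullDim V hV hgen
  refine ⟨s, C, le_varietyDim h hs, fun n => (finrank_cyclicFiltration_le v n).trans ?_⟩
  have := hC n
  rwa [← Submodule.map_one (A' := SymmetricAlgebra K 𝔩 ⧸ grAnnihilator K 𝔩 v) q,
    ← Submodule.map_sup, ← Submodule.map_pow] at this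

/-! ### Reduction to characteristic `p` on associated graded modules. -/

section Specialization

/-- A semilinear map from a Lie submodule `N` containing `v` to a module `Q` over another Lie
algebra, compatible with a semilinear map of Lie algebras and sending `v` to `q`. -/
structure LieSpecialization (R k : Type*) [CommRing R] [Field k] [Algebra R k]
    {𝔩 : Type*} [LieRing 𝔩] [LieAlgebra R 𝔩]
    {M : Type*} [AddCommGroup M] [Module R M] [LieRingModule 𝔩 M] [LieModule R 𝔩 M]
    {𝔩' : Type*} [LieRing 𝔩'] [LieAlgebra k 𝔩']
    {Q : Type*} [AddCommGroup Q] [Module k Q] [LieRingModule 𝔩' Q] [LieModule k 𝔩' Q]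
    (v : M) (q : Q) where
  N : LieSubmodule R 𝔩 M
  mem : v ∈ N
  toLie : 𝔩 →ₛₗ[algebraMap R k] 𝔩'
  toFun : N →ₛₗ[algebraMap R k] Q
  map_lie (x : 𝔩) (m : N) : toFun ⁅x, m⁆ = ⁅toLie x, toFun m⁆
  map_gen : toFun ⟨v, mem⟩ = q

variable {R k : Type*} [CommRing R] [Field k] [Algebra R k]
  {𝔩 : Type*} [LieRing 𝔩] [LieAlgebra R 𝔩]
  {M : Type*} [AddCommGroup M] [Module R M] [LieRingModule 𝔩 M] [LieModule R 𝔩 M]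
  {𝔩' : Type*} [LieRing 𝔩'] [LieAlgebra k 𝔩']
  {Q : Type*} [AddCommGroup Q] [Module k Q] [LieRingModule 𝔩' Q] [LieModule k 𝔩' Q]
  {v : M} {q : Q}

theorem cyclicFiltration_le_of_mem {N : LieSubmodule R 𝔩 M} (h : v ∈ N) (n : ℕ) :
    cyclicFiltration R 𝔩 v n ≤ N.toSubmodule :=
  cyclicFiltration_le_of_lie_mem (W := fun _ => N.toSubmodule) h monotone_const
    (fun _ _ _ hm => N.lie_mem hm) n

namespace LieSpecialization

variable (T : LieSpecialization R k (𝔩 := 𝔩) (𝔩' := 𝔩') v q)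

theorem toFun_mem (n : ℕ) : ∀ (m : M) (hm : m ∈ cyclicFiltration R 𝔩 v n),
    T.toFun ⟨m, cyclicFiltration_le_of_mem T.mem n hm⟩ ∈ cyclicFiltration k 𝔩' q n := by
  induction n with
  | zero =>
    intro m hm
    have hm' := hm
    rw [cyclicFiltration_zero, Submodule.mem_span_singleton] at hm'
    obtain ⟨r, rfl⟩ := hm'
    have := T.toFun.map_smulₛₗ r ⟨v, T.mem⟩
    rw [T.map_gen] at this
    exact this ▸ Submodule.smul_mem _ _ (self_mem_cyclicFiltration k 𝔩' q 0)
  | succ n ih =>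
    intro m hm
    have hm' := hm
    rw [cyclicFiltration_succ, Submodule.mem_sup] at hm'
    obtain ⟨a, ha, c, hc, rfl⟩ := hm'
    have hle : Submodule.span R {w | ∃ x : 𝔩, ∃ m ∈ cyclicFiltration R 𝔩 v n, w = ⁅x, m⁆} ≤
        cyclicFiltration R 𝔩 v (n + 1) := by
      rw [cyclicFiltration_succ]; exact le_sup_right
    have hall : ∀ c (hc : c ∈ Submodule.span R
        {w | ∃ x : 𝔩, ∃ m ∈ cyclicFiltration R 𝔩 v n, w = ⁅x, m⁆}),
        T.toFun ⟨c, cyclicFiltration_le_of_mem T.mem (n + 1) (hle hc)⟩ ∈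
          cyclicFiltration k 𝔩' q (n + 1) := by
      intro c hc
      induction hc using Submodule.span_induction with
      | mem c hc =>
        obtain ⟨x, m, hm, rfl⟩ := hc
        have := T.map_lie x ⟨m, cyclicFiltration_le_of_mem T.mem n hm⟩
        exact this ▸ lie_mem_cyclicFiltration q n _ (ih m hm)
      | zero =>
        convert Submodule.zero_mem _
        exact T.toFun.map_zero
      | add c c' hc hc' h h' =>
        have := T.toFun.map_add ⟨c, cyclicFiltration_le_of_mem T.mem _ (hle hc)⟩
          ⟨c', cyclicFiltration_le_of_mem T.mem _ (hle hc')⟩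
        exact this ▸ Submodule.add_mem _ h h'
      | smul r c hc h =>
        have := T.toFun.map_smulₛₗ r ⟨c, cyclicFiltration_le_of_mem T.mem _ (hle hc)⟩
        exact this ▸ Submodule.smul_mem _ _ h
    have := T.toFun.map_add ⟨a, cyclicFiltration_le_of_mem T.mem _ ha⟩
      ⟨c, cyclicFiltration_le_of_mem T.mem _ (hle hc)⟩
    exact this ▸ Submodule.add_mem _ (cyclicFiltration_mono k 𝔩' q n.le_succ (ih a ha))
      (hall c hc)

/-- The map induced on the filtration steps. -/
noncomputable def filtrationMap (n : ℕ) : cyclicFiltration R 𝔩 v n →+ cyclicFiltration k 𝔩' q n where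
  toFun m := ⟨T.toFun ⟨m, cyclicFiltration_le_of_mem T.mem n m.2⟩, T.toFun_mem n m m.2⟩
  map_zero' := Subtype.ext T.toFun.map_zero
  map_add' a b := Subtype.ext (T.toFun.map_add ⟨a, cyclicFiltration_le_of_mem T.mem n a.2⟩
    ⟨b, cyclicFiltration_le_of_mem T.mem n b.2⟩)

theorem coe_filtrationMap (n : ℕ) (m : cyclicFiltration R 𝔩 v n) :
    (T.filtrationMap n m : Q) = T.toFun ⟨m, cyclicFiltration_le_of_mem T.mem n m.2⟩ := rfl

theorem grMk_filtrationMap_eq_zero (n : ℕ) (m : cyclicFiltration R 𝔩 v n)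
    (hm : (m : M) ∈ cyclicFiltrationLT R 𝔩 v n) :
    grMk (R := k) (𝔩 := 𝔩') q n (T.filtrationMap n m) = 0 := by
  rw [grMk_eq_zero_iff, coe_filtrationMap]
  cases n with
  | zero =>
    rw [cyclicFiltrationLT, Submodule.mem_bot] at hm ⊢
    have h0 : (⟨m, cyclicFiltration_le_of_mem T.mem 0 m.2⟩ : T.N) = 0 := Subtype.ext hm
    rw [h0, map_zero]
  | succ n => exact T.toFun_mem n m hm

/-- The map induced on the associated graded modules. -/
noncomputable def grMap : GrModule R 𝔩 v →+ GrModule k 𝔩' q :=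
  DirectSum.toAddMonoid fun n => QuotientAddGroup.lift _
    ((grMk (R := k) (𝔩 := 𝔩') q n).toAddMonoidHom.comp (T.filtrationMap n))
    fun m hm => T.grMk_filtrationMap_eq_zero n m hm

theorem grMap_grMk (n : ℕ) (m : cyclicFiltration R 𝔩 v n) :
    T.grMap (grMk v n m) = grMk q n (T.filtrationMap n m) := by
  exact DirectSum.toAddMonoid_of _ n _

theorem grMap_grGen : T.grMap (grGen R 𝔩 v) = grGen k 𝔩' q := by
  rw [grGen, grMap_grMk, grGen]
  congr 1
  exact Subtype.ext T.map_gen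

theorem induction_grMk {motive : GrModule R 𝔩 v → Prop} (hmk : ∀ n m, motive (grMk v n m))
    (hadd : ∀ g h, motive g → motive h → motive (g + h)) (g : GrModule R 𝔩 v) : motive g := by
  induction g using DirectSum.induction_on with
  | zero => simpa using hmk 0 0
  | of n q =>
    obtain ⟨m, rfl⟩ := Submodule.Quotient.mk_surjective _ q
    exact hmk n m
  | add g h hg hh => exact hadd g h hg hh

theorem grMap_smul (r : R) (g : GrModule R 𝔩 v) :
    T.grMap (r • g) = algebraMap R k r • T.grMap g := by
  induction g using induction_grMk with
  | hmk n m =>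
    rw [← map_smul, grMap_grMk, grMap_grMk, ← map_smul]
    congr 1
    exact Subtype.ext (T.toFun.map_smulₛₗ r ⟨m, cyclicFiltration_le_of_mem T.mem n m.2⟩)
  | hadd g h hg hh => rw [smul_add, map_add, map_add, smul_add, hg, hh]

theorem grMap_grAct (x : 𝔩) (g : GrModule R 𝔩 v) :
    T.grMap (grAct R 𝔩 v x g) = grAct k 𝔩' q (T.toLie x) (T.grMap g) := by
  induction g using induction_grMk with
  | hmk n m =>
    rw [grAct_grMk, grMap_grMk, grMap_grMk, grAct_grMk]
    congr 1
    exact Subtype.ext (T.map_lie x ⟨m, cyclicFiltration_le_of_mem T.mem n m.2⟩)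
  | hadd g h hg hh => simp only [map_add, hg, hh]

/-- Only the existence of some `s'` inducing the same operator is used, so no ring homomorphism
between the two symmetric algebras has to be chosen. -/
theorem exists_grMap_grSymAct (s : SymmetricAlgebra R 𝔩) : ∃ s' : SymmetricAlgebra k 𝔩',
    ∀ g, T.grMap (grSymAct R 𝔩 v s g) = grSymAct k 𝔩' q s' (T.grMap g) := by
  induction s using SymmetricAlgebra.induction with
  | algebraMap r => exact ⟨algebraMap k _ (algebraMap R k r), fun g => by
      simp [Algebra.algebraMap_eq_smul_one, grMap_smul]⟩
  | ι x => exact ⟨SymmetricAlgebra.ι k 𝔩' (T.toLie x), fun g => by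
      rw [grSymAct_ι, grSymAct_ι, grMap_grAct]⟩
  | mul a b ha hb =>
    obtain ⟨a', ha⟩ := ha
    obtain ⟨b', hb⟩ := hb
    exact ⟨a' * b', fun g => by simp only [map_mul, Module.End.mul_apply, ha, hb]⟩
  | add a b ha hb =>
    obtain ⟨a', ha⟩ := ha
    obtain ⟨b', hb⟩ := hb
    exact ⟨a' + b', fun g => by simp only [map_add, LinearMap.add_apply, ha, hb]⟩

/-- Positive degree lets `s` be written as a sum of products with a linear factor. Each product has
its `p`-th power in the annihilator because the linear factor does, and `p`-th powers are additive
in characteristic `p`. -/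
theorem exists_pow_mem_grAnnihilator {p : ℕ} [CharP k p] [Fact p.Prime]
    (hp : ∀ x, SymmetricAlgebra.ι k 𝔩' (T.toLie x) ^ p ∈ grAnnihilator k 𝔩' q) {n : ℕ}
    (hn : n ≠ 0) {s : SymmetricAlgebra R 𝔩} (hs : s ∈ symPow R 𝔩 n) :
    ∃ s' : SymmetricAlgebra k 𝔩', s' ^ p ∈ grAnnihilator k 𝔩' q ∧
      ∀ g, T.grMap (grSymAct R 𝔩 v s g) = grSymAct k 𝔩' q s' (T.grMap g) := by
  have : CharP (SymmetricAlgebra k 𝔩') p :=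
    charP_of_injective_algebraMap (algebraMap k (SymmetricAlgebra k 𝔩')).injective p
  obtain ⟨n, rfl⟩ := Nat.exists_eq_succ_of_ne_zero hn
  rw [symPow, pow_succ'] at hs
  refine Submodule.mul_induction_on hs ?_ ?_
  · rintro _ ⟨x, rfl⟩ t -
    obtain ⟨t', ht⟩ := T.exists_grMap_grSymAct t
    refine ⟨SymmetricAlgebra.ι k 𝔩' (T.toLie x) * t', ?_, fun g => ?_⟩
    · rw [mul_pow]
      exact Ideal.mul_mem_right _ _ (hp x)
    · simp only [map_mul, Module.End.mul_apply, grSymAct_ι, grMap_grAct, ht]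
  · rintro a b ⟨a', ha, ha'⟩ ⟨b', hb, hb'⟩
    refine ⟨a' + b', ?_, fun g => ?_⟩
    · rw [add_pow_char]
      exact Ideal.add_mem _ ha hb
    · simp only [map_add, LinearMap.add_apply, ha', hb']

/-- The symbol of `x^p` on the generator is the class of `x^p q` in `U_p / U_{p-1}`. It vanishes
since `x^p q` already lies in `U_1 ⊆ U_{p-1}`; this is where `2 ≤ p` enters. -/
theorem ι_pow_mem_grAnnihilator {p : ℕ} (hp : 2 ≤ p) (x : 𝔩')
    (hx : (LieModule.toEnd k 𝔩' Q x ^ p) q ∈ cyclicFiltration k 𝔩' q 1) :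
    SymmetricAlgebra.ι k 𝔩' x ^ p ∈ grAnnihilator k 𝔩' q := by
  have key : ∀ i, ∃ m : cyclicFiltration k 𝔩' q i, (m : Q) = (LieModule.toEnd k 𝔩' Q x ^ i) q ∧
      grSymAct k 𝔩' q (SymmetricAlgebra.ι k 𝔩' x ^ i) (grGen k 𝔩' q) = grMk q i m := by
    intro i
    induction i with
    | zero => exact ⟨⟨q, self_mem_cyclicFiltration k 𝔩' q 0⟩, rfl, by simp [grGen]⟩
    | succ i ih =>
      obtain ⟨m, h, ih⟩ := ih
      refine ⟨⟨⁅x, (m : Q)⁆, lie_mem_cyclicFiltration q i x m.2⟩, ?_, ?_⟩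
      · rw [pow_succ', Module.End.mul_apply, ← h]; rfl
      · rw [pow_succ', map_mul, Module.End.mul_apply, ih, grSymAct_ι, grAct_grMk]
  rw [mem_grAnnihilator_iff]
  obtain ⟨m, h, hk⟩ := key p
  rw [hk, grMk_eq_zero_iff, h]
  obtain ⟨i, rfl⟩ : ∃ i, p = (i + 1) + 1 := ⟨p - 2, by omega⟩
  exact cyclicFiltration_mono k 𝔩' q (by omega) hx

/-- The span contains the generator and is stable under all of `𝔩'`, which the image of `𝔩` spans.
-/
theorem span_range_grMap (hT : Submodule.span k (Set.range T.toLie) = ⊤) :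
    Submodule.span k (Set.range T.grMap) = ⊤ := by
  have hstep : ∀ x g, g ∈ Submodule.span k (Set.range T.grMap) →
      grAct k 𝔩' q x g ∈ Submodule.span k (Set.range T.grMap) := by
    intro x g hg
    have hx : x ∈ Submodule.span k (Set.range T.toLie) := hT ▸ Submodule.mem_top
    induction hx using Submodule.span_induction with
    | mem x hx =>
      obtain ⟨x, rfl⟩ := hx
      induction hg using Submodule.span_induction with
      | mem g hg =>
        obtain ⟨g, rfl⟩ := hg
        exact Submodule.subset_span ⟨grAct R 𝔩 v x g, T.grMap_grAct x g⟩
      | zero => rw [map_zero]; exact Submodule.zero_mem _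
      | add a b _ _ ha hb => rw [map_add]; exact Submodule.add_mem _ ha hb
      | smul r a _ ha => rw [map_smul]; exact Submodule.smul_mem _ r ha
    | zero => rw [map_zero]; exact Submodule.zero_mem _
    | add a b _ _ ha hb => rw [map_add]; exact Submodule.add_mem _ ha hb
    | smul r a _ ha => rw [map_smul]; exact Submodule.smul_mem _ r ha
  rw [eq_top_iff, ← iSup_range_grMk q, iSup_le_iff]
  intro n
  induction n with
  | zero =>
    rw [range_grMk_zero, Submodule.span_singleton_le_iff_mem]
    exact Submodule.subset_span ⟨_, T.grMap_grGen⟩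
  | succ n ih =>
    refine (range_grMk_succ_le q n).trans (Submodule.span_le.2 ?_)
    rintro _ ⟨x, m, rfl⟩
    exact hstep x _ (ih ⟨m, rfl⟩)

/-- The source of the number `D p^d`: the graded module is finite over the `y_i`, and each `y_i`
acts with vanishing `p`-th power. -/
theorem rank_grModule_le {p : ℕ} [CharP k p] [Fact p.Prime]
    (hp : ∀ x, SymmetricAlgebra.ι k 𝔩' (T.toLie x) ^ p ∈ grAnnihilator k 𝔩' q)
    (hT : Submodule.span k (Set.range T.toLie) = ⊤) {d D : ℕ}
    (y : Fin d → SymmetricAlgebra R 𝔩 ⧸ grAnnihilator R 𝔩 v)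
    (w : Fin D → SymmetricAlgebra R 𝔩 ⧸ grAnnihilator R 𝔩 v)
    (hy : ∀ i, ∃ n ≠ 0, ∃ s ∈ symPow R 𝔩 n, Ideal.Quotient.mk _ s = y i)
    (hspan : Submodule.span (Algebra.adjoin R (Set.range y)) (Set.range w) = ⊤) :
    Module.rank k (GrModule k 𝔩' q) ≤ ((D * p ^ d : ℕ) : Cardinal) := by
  classical
  choose n hn s hs hys using hy
  choose s' hs'p hs' using fun i => T.exists_pow_mem_grAnnihilator hp (hn i) (hs i)
  let ev : (SymmetricAlgebra R 𝔩 ⧸ grAnnihilator R 𝔩 v) →ₗ[R] GrModule R 𝔩 v :=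
    (LinearMap.applyₗ (grGen R 𝔩 v)).comp
      (Ideal.Quotient.liftₐ (grAnnihilator R 𝔩 v) (grSymAct R 𝔩 v) fun s hs => hs).toLinearMap
  have hev_mk : ∀ t, ev (Ideal.Quotient.mk _ t) = grSymAct R 𝔩 v t (grGen R 𝔩 v) := fun _ => rfl
  have hev_mul : ∀ t r, ev (Ideal.Quotient.mk _ t * r) = grSymAct R 𝔩 v t (ev r) := by
    intro t r
    obtain ⟨r, rfl⟩ := Ideal.Quotient.mk_surjective r
    rw [← map_mul, hev_mk, hev_mk, map_mul, Module.End.mul_apply]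
  -- There are `p^d · D` such vectors. Their span `W` is shown to be stable under every `s' i` and
  -- to contain the image of `R_A`.
  let F : (Fin d → Fin p) × Fin D → GrModule k 𝔩' q := fun a =>
    grSymAct k 𝔩' q (∏ i, s' i ^ (a.1 i : ℕ)) (T.grMap (ev (w a.2)))
  set W := Submodule.span k (Set.range F) with hW
  have hWs : ∀ i, ∀ g ∈ W, grSymAct k 𝔩' q (s' i) g ∈ W := by
    intro i g hg
    induction hg using Submodule.span_induction with
    | mem g hg =>
      obtain ⟨⟨a, b⟩, rfl⟩ := hg
      have hprod : s' i * ∏ i, s' i ^ (a i : ℕ) =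
          s' i ^ ((a i : ℕ) + 1) * ∏ l ∈ Finset.univ.erase i, s' l ^ (a l : ℕ) := by
        rw [← Finset.mul_prod_erase Finset.univ _ (Finset.mem_univ i), ← mul_assoc, pow_succ']
      simp only [F]
      rw [← Module.End.mul_apply, ← map_mul, hprod]
      by_cases h : (a i : ℕ) + 1 < p
      · refine Submodule.subset_span ⟨(Function.update a i ⟨a i + 1, h⟩, b), ?_⟩
        simp only [F]
        rw [← Finset.mul_prod_erase Finset.univ _ (Finset.mem_univ i)]
        congr 3
        · simp
        · refine Finset.prod_congr rfl fun l hl => ?_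
          rw [Function.update_of_ne (Finset.ne_of_mem_erase hl)]
      -- The exponent of `s' i` has reached `p`, and its `p`-th power annihilates the module.
      · have h' : (a i : ℕ) + 1 = p := by have := (a i).2; omega
        have hz : s' i ^ ((a i : ℕ) + 1) * ∏ l ∈ Finset.univ.erase i, s' l ^ (a l : ℕ) ∈
            grAnnihilator k 𝔩' q := by
          rw [h']
          exact Ideal.mul_mem_right _ _ (hs'p i)
        rw [grAnnihilator, RingHom.mem_ker] at hz
        rw [hz, LinearMap.zero_apply]
        exact Submodule.zero_mem _
    | zero => rw [map_zero]; exact Submodule.zero_mem _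
    | add a b _ _ ha hb => rw [map_add]; exact Submodule.add_mem _ ha hb
    | smul r a _ ha => rw [map_smul]; exact Submodule.smul_mem _ r ha
  have hW_top : ∀ r, T.grMap (ev r) ∈ W := by
    intro r
    have hr : r ∈ Submodule.span (Algebra.adjoin R (Set.range y)) (Set.range w) :=
      hspan ▸ Submodule.mem_top
    induction hr using Submodule.span_induction with
    | mem r hr =>
      obtain ⟨b, rfl⟩ := hr
      refine Submodule.subset_span ⟨(fun _ => ⟨0, (Fact.out : p.Prime).pos⟩, b), ?_⟩
      simp [F]
    | zero => rw [map_zero, map_zero]; exact Submodule.zero_mem _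
    | add a b _ _ ha hb => rw [map_add, map_add]; exact Submodule.add_mem _ ha hb
    | smul c r _ hr =>
      obtain ⟨c, hc⟩ := c
      change T.grMap (ev (c * r)) ∈ W
      induction hc using Algebra.adjoin_induction generalizing r with
      | mem c hc =>
        obtain ⟨i, rfl⟩ := hc
        rw [← hys, hev_mul, hs']
        exact hWs i _ hr
      | algebraMap t =>
        rw [← Algebra.smul_def, map_smul, grMap_smul]
        exact Submodule.smul_mem _ _ hr
      | add a b _ _ ha hb =>
        rw [add_mul, map_add, map_add]
        exact Submodule.add_mem _ (ha _ ‹_› hr) (hb _ ‹_› hr)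
      | mul a b _ _ ha hb =>
        rw [mul_assoc]
        exact ha _ (hspan ▸ Submodule.mem_top) (hb _ ‹_› hr)
  have htop : W = ⊤ := by
    rw [eq_top_iff, ← T.span_range_grMap hT, Submodule.span_le]
    rintro _ ⟨g, rfl⟩
    obtain ⟨t, rfl⟩ := grSymAct_grGen_surjective v g
    exact hW_top (Ideal.Quotient.mk _ t)
  rw [← rank_top, ← htop, hW]
  refine (rank_span_le _).trans ?_
  rw [Cardinal.mk_fintype, Nat.cast_le]
  refine (Fintype.card_range_le F).trans ?_
  simp [mul_comm]

end LieSpecialization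

end Specialization

/-! ### Reduced modules and the dimension bound `D p^d`. -/

section ReducedModules

variable {k 𝔩 : Type*} [Field k] [LieRing 𝔩] [LieAlgebra k 𝔩]

/-- The subspace `I_η M` as a Lie submodule. -/
def reducedLieSubmodule (p : ℕ) (η : Dual k 𝔩) (M : Type*) [AddCommGroup M] [Module k M]
    [LieRingModule 𝔩 M] [LieModule k 𝔩 M] : LieSubmodule k 𝔩 M where
  toSubmodule := reducedSubspace p η M
  lie_mem {x m} hm := by
    change m ∈ reducedSubspace p η M at hm
    change ⁅x, m⁆ ∈ reducedSubspace p η M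
    rw [reducedSubspace] at hm ⊢
    induction hm using Submodule.span_induction with
    | mem m hm =>
      obtain ⟨u, hu, m, rfl⟩ := hm
      refine Submodule.subset_span
        ⟨UniversalEnvelopingAlgebra.ι k x * u, TwoSidedIdeal.mul_mem_left _ _ _ hu, m, ?_⟩
      rw [map_mul, Module.End.mul_apply]
      exact (envAct_ι_apply k 𝔩 M x _).symm
    | zero => rw [lie_zero]; exact Submodule.zero_mem _
    | add a b _ _ ha hb => rw [lie_add]; exact Submodule.add_mem _ ha hb
    | smul r a _ ha => rw [lie_smul]; exact Submodule.smul_mem _ r ha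

theorem toEnd_pow_quotient_reducedLieSubmodule {p : ℕ} {η : Dual k 𝔩} {M : Type*} [AddCommGroup M]
    [Module k M] [LieRingModule 𝔩 M] [LieModule k 𝔩 M] {x y : 𝔩}
    (h : LieAlgebra.ad k 𝔩 y = LieAlgebra.ad k 𝔩 x ^ p) (q : M ⧸ reducedLieSubmodule p η M) :
    (LieModule.toEnd k 𝔩 (M ⧸ reducedLieSubmodule p η M) x ^ p) q = ⁅y, q⁆ + η x ^ p • q := by
  obtain ⟨m, rfl⟩ := LieSubmodule.Quotient.surjective_mk' _ q
  have hpow : ∀ n, (LieModule.toEnd k 𝔩 (M ⧸ reducedLieSubmodule p η M) x ^ n)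
      (LieSubmodule.Quotient.mk' _ m) =
      LieSubmodule.Quotient.mk' _ ((LieModule.toEnd k 𝔩 M x ^ n) m) := by
    intro n
    induction n with
    | zero => simp
    | succ n ih =>
      rw [pow_succ', Module.End.mul_apply, ih, pow_succ', Module.End.mul_apply]
      exact (LieModuleHom.map_lie (LieSubmodule.Quotient.mk' (reducedLieSubmodule p η M)) x _).symm
  rw [hpow, ← LieModuleHom.map_lie, ← map_smul, ← map_add, ← sub_eq_zero, ← map_sub]
  refine (LieSubmodule.Quotient.mk_eq_zero' (N := reducedLieSubmodule p η M)).2 ?_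
  refine Submodule.subset_span ⟨UniversalEnvelopingAlgebra.ι k x ^ p -
    UniversalEnvelopingAlgebra.ι k y - algebraMap k _ (η x ^ p),
    TwoSidedIdeal.subset_span ⟨x, y, h, rfl⟩, m, ?_⟩
  have hx : envAct k 𝔩 M (UniversalEnvelopingAlgebra.ι k x) = LieModule.toEnd k 𝔩 M x :=
    LinearMap.ext fun m => envAct_ι_apply k 𝔩 M x m
  rw [map_sub, map_sub, map_pow, hx, AlgHom.commutes, LinearMap.sub_apply, LinearMap.sub_apply,
    envAct_ι_apply, Module.algebraMap_end_apply, sub_sub]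

end ReducedModules

section BaseChange

variable {R k : Type*} [CommRing R] [Field k] [Algebra R k]
  {𝔩 : Type*} [LieRing 𝔩] [LieAlgebra R 𝔩]
  {M : Type*} [AddCommGroup M] [Module R M] [LieRingModule 𝔩 M] [LieModule R 𝔩 M]

theorem iSup_cyclicFiltration_eq_lieSpan (v : M) :
    ⨆ n, cyclicFiltration R 𝔩 v n = (LieSubmodule.lieSpan R 𝔩 {v}).toSubmodule := by
  have hmono := cyclicFiltration_mono R 𝔩 v
  apply le_antisymm
  · exact iSup_le fun n => cyclicFiltration_le_of_mem
      (LieSubmodule.subset_lieSpan (Set.mem_singleton v)) n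
  · let N : LieSubmodule R 𝔩 M :=
      { toSubmodule := ⨆ n, cyclicFiltration R 𝔩 v n
        lie_mem := fun {x m} hm => by
          obtain ⟨n, hn⟩ := (Submodule.mem_iSup_of_directed _ hmono.directed_le).1 hm
          exact Submodule.mem_iSup_of_mem (n + 1) (lie_mem_cyclicFiltration v n x hn) }
    have : LieSubmodule.lieSpan R 𝔩 {v} ≤ N := by
      rw [LieSubmodule.lieSpan_le, Set.singleton_subset_iff]
      exact Submodule.mem_iSup_of_mem 0 (self_mem_cyclicFiltration R 𝔩 v 0)
    exact this

/-- The specialization `N → k ⊗ N → (k ⊗ N) / I_η (k ⊗ N)`, where `N` is generated by `v`. -/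
noncomputable def reducedSpecialization (v : M) (p : ℕ) (η : Dual k (k ⊗[R] 𝔩)) :
    LieSpecialization R k (𝔩 := 𝔩) (𝔩' := k ⊗[R] 𝔩) v (LieSubmodule.Quotient.mk'
      (reducedLieSubmodule p η (k ⊗[R] LieSubmodule.lieSpan R 𝔩 {v}))
      (1 ⊗ₜ ⟨v, LieSubmodule.subset_lieSpan (Set.mem_singleton v)⟩)) where
  N := LieSubmodule.lieSpan R 𝔩 {v}
  mem := LieSubmodule.subset_lieSpan (Set.mem_singleton v)
  toLie :=
    { toFun := fun x => 1 ⊗ₜ x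
      map_add' := TensorProduct.tmul_add 1
      map_smul' := fun r x => by
        rw [TensorProduct.tmul_smul, ← algebraMap_smul k r] }
  toFun :=
    { toFun := fun m => LieSubmodule.Quotient.mk' _ (1 ⊗ₜ m)
      map_add' := fun a b => by rw [TensorProduct.tmul_add, map_add]
      map_smul' := fun r x => by
        rw [TensorProduct.tmul_smul, ← algebraMap_smul k r, map_smul] }
  map_lie x m := by
    change LieSubmodule.Quotient.mk' _ _ = ⁅_, LieSubmodule.Quotient.mk' _ _⁆
    rw [← LieModuleHom.map_lie]
    simp
  map_gen := rfl

/-- A `p`-th power in the sense of `ad` is only required on a spanning set `B`: on symbols the map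
`x ↦ x^p` is additive, and a scalar factor stays inside the annihilating ideal. -/
theorem rank_quotient_reducedSubspace_le (v : M) {p : ℕ} [CharP k p] [Fact p.Prime]
    (η : Dual k (k ⊗[R] 𝔩)) {B : Set 𝔩} (hB : Submodule.span R B = ⊤)
    (hBp : ∀ x ∈ B, ∃ y, LieAlgebra.ad k (k ⊗[R] 𝔩) y =
      LieAlgebra.ad k (k ⊗[R] 𝔩) (1 ⊗ₜ x) ^ p) {d D : ℕ}
    (y : Fin d → SymmetricAlgebra R 𝔩 ⧸ grAnnihilator R 𝔩 v)
    (w : Fin D → SymmetricAlgebra R 𝔩 ⧸ grAnnihilator R 𝔩 v)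
    (hy : ∀ i, ∃ n ≠ 0, ∃ s ∈ symPow R 𝔩 n, Ideal.Quotient.mk _ s = y i)
    (hspan : Submodule.span (Algebra.adjoin R (Set.range y)) (Set.range w) = ⊤) :
    Module.rank k ((k ⊗[R] LieSubmodule.lieSpan R 𝔩 {v}) ⧸
      reducedSubspace p η (k ⊗[R] LieSubmodule.lieSpan R 𝔩 {v})) ≤ ((D * p ^ d : ℕ) : Cardinal) := by
  let T := reducedSpecialization (k := k) (𝔩 := 𝔩) v p η
  have hp2 : 2 ≤ p := (Fact.out : p.Prime).two_le
  have hT : Submodule.span k (Set.range T.toLie) = ⊤ := by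
    rw [eq_top_iff]
    rintro z -
    induction z using TensorProduct.induction_on with
    | zero => exact Submodule.zero_mem _
    | tmul c x =>
      rw [← mul_one c, ← smul_eq_mul, ← TensorProduct.smul_tmul']
      exact Submodule.smul_mem _ _ (Submodule.subset_span ⟨x, rfl⟩)
    | add a b ha hb => exact Submodule.add_mem _ ha hb
  have hpow : ∀ x, SymmetricAlgebra.ι k (k ⊗[R] 𝔩) (T.toLie x) ^ p ∈
      grAnnihilator k (k ⊗[R] 𝔩) (LieSubmodule.Quotient.mk'
      (reducedLieSubmodule p η (k ⊗[R] LieSubmodule.lieSpan R 𝔩 {v}))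
      (1 ⊗ₜ ⟨v, LieSubmodule.subset_lieSpan (Set.mem_singleton v)⟩)) := by
    have : CharP (SymmetricAlgebra k (k ⊗[R] 𝔩)) p :=
      charP_of_injective_algebraMap (algebraMap k (SymmetricAlgebra k (k ⊗[R] 𝔩))).injective p
    intro x
    have hx : x ∈ Submodule.span R B := hB ▸ Submodule.mem_top
    induction hx using Submodule.span_induction with
    | mem x hx =>
      obtain ⟨y, hy⟩ := hBp x hx
      refine LieSpecialization.ι_pow_mem_grAnnihilator hp2 _ ?_
      change (LieModule.toEnd k (k ⊗[R] 𝔩) _ (1 ⊗ₜ x) ^ p) _ ∈ _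
      rw [toEnd_pow_quotient_reducedLieSubmodule hy]
      exact Submodule.add_mem _ (lie_mem_cyclicFiltration _ 0 y (self_mem_cyclicFiltration _ _ _ 0))
        (Submodule.smul_mem _ _ (self_mem_cyclicFiltration _ _ _ 1))
    | zero => simp only [map_zero, zero_pow (by omega : p ≠ 0)]; exact Ideal.zero_mem _
    | add a b _ _ ha hb => rw [map_add, map_add, add_pow_char]; exact Ideal.add_mem _ ha hb
    | smul r a _ ha =>
      rw [LinearMap.map_smulₛₗ, map_smul, Algebra.smul_def, mul_pow]
      exact Ideal.mul_mem_left _ _ ha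
  refine le_trans ?_ (T.rank_grModule_le hpow hT y w hy hspan)
  refine rank_le_rank_grModule (K := k) (𝔩 := k ⊗[R] 𝔩)
    (M := (k ⊗[R] LieSubmodule.lieSpan R 𝔩 {v}) ⧸
      reducedLieSubmodule p η (k ⊗[R] LieSubmodule.lieSpan R 𝔩 {v})) _ ?_
  rw [eq_top_iff]
  rintro z -
  obtain ⟨z, rfl⟩ := LieSubmodule.Quotient.surjective_mk' _ z
  induction z using TensorProduct.induction_on with
  | zero => rw [map_zero]; exact Submodule.zero_mem _
  | tmul c m =>
    rw [← mul_one c, ← smul_eq_mul, ← TensorProduct.smul_tmul', map_smul]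
    refine Submodule.smul_mem _ _ ?_
    obtain ⟨m, hm⟩ := m
    have hm' := hm
    rw [← LieSubmodule.mem_toSubmodule, ← iSup_cyclicFiltration_eq_lieSpan,
      Submodule.mem_iSup_of_directed _ (cyclicFiltration_mono R 𝔩 v).directed_le] at hm'
    obtain ⟨n, hn⟩ := hm'
    exact Submodule.mem_iSup_of_mem n (T.toFun_mem n m hn)
  | add a b ha hb => rw [map_add]; exact Submodule.add_mem _ ha hb

end BaseChange

/-! ### Eigenvectors, and linear independence over a subring. -/

section EigenSplit

variable {K V : Type*} [Field K] [AddCommGroup V] [Module K V]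

/-- In an `A`-combination equal to an eigenvector of eigenvalue `c`, the terms with other
eigenvalues sum to an element of two independent subspaces, hence to zero. Discarding them leaves
the coefficients in `A`. -/
theorem mem_span_of_mem_eigenspace (A : Subring K) (T : Module.End K V) {κ : Type*} (z : κ → V)
    (a : κ → K) (hz : ∀ i, T (z i) = a i • z i) {y : V} (hy : y ∈ Submodule.span A (Set.range z))
    {c : K} (hyc : T y = c • y) : y ∈ Submodule.span A (z '' {i | a i = c}) := by
  classical
  obtain ⟨l, rfl⟩ := (Finsupp.mem_span_range_iff_exists_finsupp).1 hy
  have hsplit : (l.sum fun i r => r • z i) =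
      (∑ i ∈ l.support with a i = c, l i • z i) + ∑ i ∈ l.support with ¬ a i = c, l i • z i :=
    (Finset.sum_filter_add_sum_filter_not _ _ _).symm
  set y := l.sum fun i r => r • z i
  have h1 : ∑ i ∈ l.support with a i = c, l i • z i ∈ T.eigenspace c := by
    refine Submodule.sum_mem _ fun i hi => ?_
    rw [Module.End.mem_eigenspace_iff]
    change T ((l i : K) • z i) = c • ((l i : K) • z i)
    rw [map_smul, hz, (Finset.mem_filter.1 hi).2, smul_comm]
  have h2 : ∑ i ∈ l.support with ¬ a i = c, l i • z i ∈ ⨆ (b : K) (_ : b ≠ c), T.eigenspace b := by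
    refine Submodule.sum_mem _ fun i hi => Submodule.mem_iSup_of_mem (a i)
      (Submodule.mem_iSup_of_mem (Finset.mem_filter.1 hi).2 ?_)
    rw [Module.End.mem_eigenspace_iff]
    change T ((l i : K) • z i) = a i • ((l i : K) • z i)
    rw [map_smul, hz, smul_comm]
  have h3 : ∑ i ∈ l.support with ¬ a i = c, l i • z i = 0 := by
    have hy' : y ∈ T.eigenspace c := Module.End.mem_eigenspace_iff.2 hyc
    have h4 : ∑ i ∈ l.support with ¬ a i = c, l i • z i ∈ T.eigenspace c := by
      rw [← add_sub_cancel_left (∑ i ∈ l.support with a i = c, l i • z i)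
        (∑ i ∈ l.support with ¬ a i = c, l i • z i), ← hsplit]
      exact Submodule.sub_mem _ hy' h1
    exact Submodule.disjoint_def.1 (T.eigenspaces_iSupIndep c) _ h4 h2
  rw [hsplit, h3, add_zero]
  exact Submodule.sum_mem _ fun i hi => Submodule.smul_mem _ _
    (Submodule.subset_span ⟨i, (Finset.mem_filter.1 hi).2, rfl⟩)

theorem exists_dual_eq_one_of_eigenvector (T : Module.End K V) {v : V} {c : K} (hv : v ≠ 0)
    (hT : T v = c • v) : ∃ φ : Dual K V, φ v = 1 ∧ ∀ b u, b ≠ c → T u = b • u → φ u = 0 := by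
  have hnot : v ∉ ⨆ (b : K) (_ : b ≠ c), T.eigenspace b := fun h => hv <|
    Submodule.disjoint_def.1 (T.eigenspaces_iSupIndep c) _ (Module.End.mem_eigenspace_iff.2 hT) h
  obtain ⟨f, hf, hle⟩ := Submodule.exists_le_ker_of_notMem hnot
  refine ⟨(f v)⁻¹ • f, by simp [hf], fun b u hb hu => ?_⟩
  have : u ∈ LinearMap.ker f := hle (Submodule.mem_iSup_of_mem b (Submodule.mem_iSup_of_mem hb
    (Module.End.mem_eigenspace_iff.2 hu)))
  rw [LinearMap.mem_ker] at this
  simp [this]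

/-- A family of vectors with values in a subring of a field which is linearly independent over the
subring, as detected by functionals, is linearly independent over the field. -/
theorem linearIndependent_of_dual_mem (A : Subring K) {κ σ : Type*} {w : κ → V}
    (hw : LinearIndependent A w) (ψ : σ → Dual K V) (hψ : ∀ u i, ψ u (w i) ∈ A)
    (hsep : ∀ y, (∀ u, ψ u y = 0) → y = 0) : LinearIndependent K w := by
  rw [linearIndependent_iff'] at hw ⊢
  intro s c hc
  classical
  let : Algebra (FractionRing A) K := FractionRing.liftAlgebra A K
  -- Applying `ℓ` to the coefficients and clearing denominators by `b` turns the `K`-relation into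
  -- an `A`-relation: pair with `ψ u`, whose values lie in `A` and so pass through `ℓ`, then use
  -- that the `ψ u` separate points. Functionals over the fraction field detect nonzero elements of
  -- `K`, so the `c i` vanish.
  have key : ∀ ℓ : K →ₗ[FractionRing A] FractionRing A, ∀ i ∈ s, ℓ (c i) = 0 := by
    intro ℓ
    obtain ⟨b, hb⟩ := IsLocalization.exist_integer_multiples_of_finset (nonZeroDivisors A)
      (s.image fun i => ℓ (c i))
    have hb' : ∀ i ∈ s, ∃ a : A, algebraMap A (FractionRing A) a = (b : A) • ℓ (c i) := fun i hi =>
      hb _ (Finset.mem_image_of_mem (fun i => ℓ (c i)) hi)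
    choose! a ha using hb'
    have hzero : ∑ i ∈ s, a i • w i = 0 := by
      refine hsep _ fun u => ?_
      have h0 : ∑ i ∈ s, (⟨ψ u (w i), hψ u i⟩ : A) • c i = 0 := by
        have := congrArg (ψ u) hc
        rw [map_sum, map_zero] at this
        rw [← this]
        refine Finset.sum_congr rfl fun i _ => ?_
        rw [map_smul, smul_eq_mul, mul_comm]
        rfl
      have h1 := congrArg ℓ h0
      rw [map_zero, map_sum] at h1
      have h2 : ∑ i ∈ s, algebraMap A (FractionRing A) (⟨ψ u (w i), hψ u i⟩ * a i) = 0 := by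
        rw [← smul_zero (b : A), ← h1, Finset.smul_sum]
        refine Finset.sum_congr rfl fun i hi => ?_
        rw [map_mul, ha i hi, LinearMap.map_smul_of_tower, smul_comm, Algebra.smul_def, Algebra.smul_def]
      rw [← map_sum] at h2
      have h3 := (IsFractionRing.injective A (FractionRing A)) (h2.trans (map_zero _).symm)
      rw [map_sum, ← Subring.coe_zero A, ← h3, AddSubmonoidClass.coe_finsetSum]
      refine Finset.sum_congr rfl fun i _ => ?_
      change ψ u ((a i : K) • w i) = ψ u (w i) * (a i : K)
      rw [map_smul, smul_eq_mul, mul_comm]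
    intro i hi
    have h4 := ha i hi
    rw [hw s a hzero i hi, map_zero, Algebra.smul_def, eq_comm, mul_eq_zero] at h4
    exact h4.resolve_left fun h => nonZeroDivisors.coe_ne_zero b
      ((IsFractionRing.injective A (FractionRing A)) (h.trans (map_zero _).symm))
  intro i hi
  exact (Module.forall_dual_apply_eq_zero_iff (FractionRing A) (c i)).1 fun ℓ => key ℓ i hi

end EigenSplit

/-! ### Simple highest weight modules: the lattice and its separating functionals. -/

section HighestWeightDatum

/-- A simple highest weight module over a Lie algebra graded by the eigenvalues of an element `h₀`,
with a spanning family of eigenvectors `x` of integral degrees whose structure constants lie in a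
subring `A`. -/
structure HighestWeightDatum {K : Type*} (𝔤 L : Type*) [Field K] [CharZero K] [LieRing 𝔤]
    [LieAlgebra K 𝔤] [AddCommGroup L] [Module K L] [LieRingModule 𝔤 L] [LieModule K 𝔤 L]
    (A : Subring K) (ι : Type*) where
  x : ι → 𝔤
  ht : ι → ℤ
  h₀ : 𝔤
  v : L
  wt : K
  c : ι → K
  lie_h₀ (i : ι) : ⁅h₀, x i⁆ = (ht i : K) • x i
  span_x : Submodule.span K (Set.range x) = ⊤
  lie_mem (i j : ι) : ⁅x i, x j⁆ ∈ Submodule.span A (Set.range x)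
  simple (N : LieSubmodule K 𝔤 L) : N = ⊥ ∨ N = ⊤
  v_ne : v ≠ 0
  lie_v_pos (i : ι) : 0 < ht i → ⁅x i, v⁆ = 0
  lie_v_zero (i : ι) : ht i = 0 → ⁅x i, v⁆ = c i • v
  c_mem (i : ι) : c i ∈ A
  h₀_v : ⁅h₀, v⁆ = wt • v

namespace HighestWeightDatum

variable {K : Type*} {𝔤 L : Type*} [Field K] [CharZero K] [LieRing 𝔤]
  [LieAlgebra K 𝔤] [AddCommGroup L] [Module K L] [LieRingModule 𝔤 L] [LieModule K 𝔤 L]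
  {A : Subring K} {ι : Type*} (T : HighestWeightDatum 𝔤 L A ι)

/-- The operator given by a word in the spanning family. -/
def act (w : List ι) : Module.End K L := (w.map fun i => LieModule.toEnd K 𝔤 L (T.x i)).prod

/-- The degree of a word. -/
def deg (w : List ι) : ℤ := (w.map T.ht).sum

/-- Words in elements of negative degree. -/
def IsNeg (w : List ι) : Prop := ∀ i ∈ w, T.ht i < 0

/-- Words in elements of positive degree. -/
def IsPos (w : List ι) : Prop := ∀ i ∈ w, 0 < T.ht i

theorem act_nil : T.act [] = 1 := rfl

theorem act_cons (i : ι) (w : List ι) (u : L) : T.act (i :: w) u = ⁅T.x i, T.act w u⁆ := by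
  simp [act]

theorem act_append (w w' : List ι) : T.act (w ++ w') = T.act w * T.act w' := by
  simp [act]

theorem act_singleton (i : ι) (u : L) : T.act [i] u = ⁅T.x i, u⁆ := by
  simp [act]

theorem deg_cons (i : ι) (w : List ι) : T.deg (i :: w) = T.ht i + T.deg w := by
  simp [deg]

theorem deg_nil : T.deg [] = 0 := rfl

variable {T} in
-- Each letter has integral degree at most `-1`. A bound on the degree therefore bounds the length,
-- hence also the filtration degree in `U(𝔤)`.
theorem IsNeg.length_le {w : List ι} (h : T.IsNeg w) : (w.length : ℤ) ≤ -T.deg w := by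
  induction w with
  | nil => simp [deg_nil]
  | cons i w ih =>
    have h1 := h i (by simp)
    have h2 := ih fun j hj => h j (by simp [hj])
    rw [deg_cons, List.length_cons]
    push_cast
    omega

variable {T} in
theorem IsPos.length_le {w : List ι} (h : T.IsPos w) : (w.length : ℤ) ≤ T.deg w := by
  induction w with
  | nil => simp [deg_nil]
  | cons i w ih =>
    have h1 := h i (by simp)
    have h2 := ih fun j hj => h j (by simp [hj])
    rw [deg_cons, List.length_cons]
    push_cast
    omega

theorem lie_h₀_lie {i : ι} {u : L} {a : K} (hu : ⁅T.h₀, u⁆ = a • u) :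
    ⁅T.h₀, ⁅T.x i, u⁆⁆ = (a + T.ht i) • ⁅T.x i, u⁆ := by
  rw [leibniz_lie, T.lie_h₀, smul_lie, hu, lie_smul, add_smul, add_comm]

theorem lie_h₀_act (w : List ι) {u : L} {a : K} (hu : ⁅T.h₀, u⁆ = a • u) :
    ⁅T.h₀, T.act w u⁆ = (a + T.deg w) • T.act w u := by
  induction w with
  | nil => simpa [act_nil, deg_nil] using hu
  | cons i w ih =>
    rw [act_cons, T.lie_h₀_lie ih, deg_cons]
    push_cast
    congr 1
    ring

/-- The `A`-form of the module: the `A`-span of all negative words applied to the generator. -/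
def lattice : Submodule A L :=
  Submodule.span A (Set.range fun w : {w : List ι // T.IsNeg w} => T.act w T.v)

theorem act_mem_lattice {w : List ι} (hw : T.IsNeg w) : T.act w T.v ∈ T.lattice :=
  Submodule.subset_span ⟨⟨w, hw⟩, rfl⟩

theorem v_mem_lattice : T.v ∈ T.lattice := T.act_mem_lattice (w := []) (by simp [IsNeg])

theorem lie_mem_lattice_of_neg {j : ι} (hj : T.ht j < 0) {u : L} (hu : u ∈ T.lattice) :
    ⁅T.x j, u⁆ ∈ T.lattice := by
  rw [lattice] at hu
  induction hu using Submodule.span_induction with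
  | mem u hu =>
    obtain ⟨⟨w, hw⟩, rfl⟩ := hu
    simp only [← act_cons]
    refine T.act_mem_lattice fun i hi => ?_
    rcases List.mem_cons.1 hi with rfl | h
    · exact hj
    · exact hw i h
  | zero => rw [lie_zero]; exact Submodule.zero_mem _
  | add a b _ _ ha hb => rw [lie_add]; exact Submodule.add_mem _ ha hb
  | smul r a _ ha =>
    change ⁅T.x j, (r : K) • a⁆ ∈ _
    rw [lie_smul]
    exact Submodule.smul_mem _ r ha

/-- Move `g` to the right past the letters of the word. The statement is for all `g` in the
`A`-span, not only for basis elements, because the induction meets the commutators `[x_i, x_j]`. -/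
theorem lie_act_mem_lattice (w : List ι) (hw : T.IsNeg w) :
    ∀ g ∈ Submodule.span A (Set.range T.x), ⁅g, T.act w T.v⁆ ∈ T.lattice := by
  have hred : ∀ u : L, (∀ i, ⁅T.x i, u⁆ ∈ T.lattice) →
      ∀ g ∈ Submodule.span A (Set.range T.x), ⁅g, u⁆ ∈ T.lattice := by
    intro u hu g hg
    induction hg using Submodule.span_induction with
    | mem g hg => obtain ⟨i, rfl⟩ := hg; exact hu i
    | zero => rw [zero_lie]; exact Submodule.zero_mem _
    | add a b _ _ ha hb => rw [add_lie]; exact Submodule.add_mem _ ha hb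
    | smul r a _ ha =>
      change ⁅(r : K) • a, u⁆ ∈ _
      rw [smul_lie]
      exact Submodule.smul_mem _ r ha
  induction w with
  | nil =>
    refine hred _ fun i => ?_
    rw [act_nil, Module.End.one_apply]
    rcases lt_trichotomy (T.ht i) 0 with h | h | h
    · exact T.lie_mem_lattice_of_neg h T.v_mem_lattice
    · rw [T.lie_v_zero i h]
      exact Submodule.smul_mem _ (⟨T.c i, T.c_mem i⟩ : A) T.v_mem_lattice
    · rw [T.lie_v_pos i h]
      exact Submodule.zero_mem _
  | cons j w ih =>
    have ih' := ih fun i hi => hw i (by simp [hi])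
    refine hred _ fun i => ?_
    rw [act_cons, leibniz_lie]
    exact Submodule.add_mem _ (ih' _ (T.lie_mem i j))
      (T.lie_mem_lattice_of_neg (hw j (by simp)) (ih' _ (Submodule.subset_span ⟨i, rfl⟩)))

theorem lie_mem_lattice (i : ι) {u : L} (hu : u ∈ T.lattice) : ⁅T.x i, u⁆ ∈ T.lattice := by
  rw [lattice] at hu
  induction hu using Submodule.span_induction with
  | mem u hu =>
    obtain ⟨⟨w, hw⟩, rfl⟩ := hu
    exact T.lie_act_mem_lattice w hw _ (Submodule.subset_span ⟨i, rfl⟩)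
  | zero => rw [lie_zero]; exact Submodule.zero_mem _
  | add a b _ _ ha hb => rw [lie_add]; exact Submodule.add_mem _ ha hb
  | smul r a _ ha =>
    change ⁅T.x i, (r : K) • a⁆ ∈ _
    rw [lie_smul]
    exact Submodule.smul_mem _ r ha

theorem act_mem_lattice_of_mem (w : List ι) {u : L} (hu : u ∈ T.lattice) :
    T.act w u ∈ T.lattice := by
  induction w with
  | nil => simpa [act_nil] using hu
  | cons i w ih => rw [act_cons]; exact T.lie_mem_lattice i ih

/-- The bracket is a combination of negative words and an eigenvector of `h₀`, so only words of the
matching degree are needed; degrees can be read from eigenvalues because `K` has characteristic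
zero. -/
theorem lie_act_mem_span (i : ι) {w : List ι} (hw : T.IsNeg w) :
    ⁅T.x i, T.act w T.v⁆ ∈
      Submodule.span K {u | ∃ w', T.IsNeg w' ∧ T.deg w' = T.deg w + T.ht i ∧ u = T.act w' T.v} := by
  have h1 := T.lie_act_mem_lattice w hw _ (Submodule.subset_span ⟨i, rfl⟩)
  have h2 := mem_span_of_mem_eigenspace A (LieModule.toEnd K 𝔤 L T.h₀)
    (fun w : {w : List ι // T.IsNeg w} => T.act w T.v) (fun w => T.wt + T.deg w)
    (fun w => T.lie_h₀_act w T.h₀_v) h1 (T.lie_h₀_lie (T.lie_h₀_act w T.h₀_v))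
  refine Submodule.span_subset_span A K _ (Submodule.span_mono ?_ h2)
  rintro _ ⟨⟨w', hw'⟩, h, rfl⟩
  refine ⟨w', hw', ?_, rfl⟩
  change T.wt + (T.deg w' : K) = _ at h
  rw [add_assoc, add_right_inj] at h
  exact_mod_cast h

theorem span_act_eq_top :
    Submodule.span K (Set.range fun w : {w : List ι // T.IsNeg w} => T.act w T.v) = ⊤ := by
  have hlie : ∀ g : 𝔤, ∀ u ∈ Submodule.span K (Set.range fun w : {w : List ι // T.IsNeg w} =>
      T.act w T.v), ⁅g, u⁆ ∈ Submodule.span K (Set.range fun w : {w : List ι // T.IsNeg w} =>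
      T.act w T.v) := by
    intro g u hu
    have hg : g ∈ Submodule.span K (Set.range T.x) := T.span_x ▸ Submodule.mem_top
    induction hg using Submodule.span_induction with
    | mem g hg =>
      obtain ⟨i, rfl⟩ := hg
      induction hu using Submodule.span_induction with
      | mem u hu =>
        obtain ⟨⟨w, hw⟩, rfl⟩ := hu
        refine Submodule.span_mono ?_ (T.lie_act_mem_span i hw)
        rintro _ ⟨w', hw', -, rfl⟩
        exact ⟨⟨w', hw'⟩, rfl⟩
      | zero => rw [lie_zero]; exact Submodule.zero_mem _
      | add a b _ _ ha hb => rw [lie_add]; exact Submodule.add_mem _ ha hb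
      | smul r a _ ha => rw [lie_smul]; exact Submodule.smul_mem _ r ha
    | zero => rw [zero_lie]; exact Submodule.zero_mem _
    | add a b _ _ ha hb => rw [add_lie]; exact Submodule.add_mem _ ha hb
    | smul r a _ ha => rw [smul_lie]; exact Submodule.smul_mem _ r ha
  let N : LieSubmodule K 𝔤 L :=
    { toSubmodule := Submodule.span K (Set.range fun w : {w : List ι // T.IsNeg w} => T.act w T.v)
      lie_mem := fun {g u} hu => hlie g u hu }
  have hv : T.v ∈ N := Submodule.subset_span ⟨⟨[], by simp [IsNeg]⟩, rfl⟩
  rcases T.simple N with h | h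
  · rw [h, LieSubmodule.mem_bot] at hv
    exact absurd hv T.v_ne
  · exact congrArg LieSubmodule.toSubmodule h

/-- The coefficient of the generator. -/
noncomputable def coeff : Dual K L :=
  (exists_dual_eq_one_of_eigenvector (LieModule.toEnd K 𝔤 L T.h₀) T.v_ne T.h₀_v).choose

theorem coeff_v : T.coeff T.v = 1 :=
  (exists_dual_eq_one_of_eigenvector (LieModule.toEnd K 𝔤 L T.h₀) T.v_ne T.h₀_v).choose_spec.1

theorem coeff_eq_zero {a : ℤ} {u : L} (ha : a ≠ 0) (hu : ⁅T.h₀, u⁆ = (T.wt + a) • u) :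
    T.coeff u = 0 :=
  (exists_dual_eq_one_of_eigenvector (LieModule.toEnd K 𝔤 L T.h₀) T.v_ne T.h₀_v).choose_spec.2
    (T.wt + a) u (by simpa using ha) hu

theorem coeff_act_eq_zero {w : List ι} (hw : T.deg w ≠ 0) : T.coeff (T.act w T.v) = 0 :=
  T.coeff_eq_zero hw (T.lie_h₀_act w T.h₀_v)

variable {T} in
theorem IsNeg.deg_neg {w : List ι} (h : T.IsNeg w) (hw : w ≠ []) : T.deg w < 0 := by
  have h1 := h.length_le
  have h2 := List.length_pos_iff.2 hw
  omega

theorem induction_act {motive : L → Prop} (u : L)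
    (hact : ∀ w, T.IsNeg w → motive (T.act w T.v)) (hzero : motive 0)
    (hadd : ∀ a b, motive a → motive b → motive (a + b))
    (hsmul : ∀ (r : K) a, motive a → motive (r • a)) : motive u := by
  have hu : u ∈ Submodule.span K (Set.range fun w : {w : List ι // T.IsNeg w} => T.act w T.v) :=
    T.span_act_eq_top ▸ Submodule.mem_top
  induction hu using Submodule.span_induction with
  | mem u hu => obtain ⟨⟨w, hw⟩, rfl⟩ := hu; exact hact w hw
  | zero => exact hzero
  | add a b _ _ ha hb => exact hadd a b ha hb
  | smul r a _ ha => exact hsmul r a ha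

/-- The module is spanned by vectors of degree at most zero, so nothing can be lowered onto `v`. -/
theorem coeff_lie_of_neg {i : ι} (hi : T.ht i < 0) (u : L) : T.coeff ⁅T.x i, u⁆ = 0 := by
  induction u using T.induction_act with
  | hact w hw =>
    rw [← act_cons]
    refine T.coeff_act_eq_zero (ne_of_lt (IsNeg.deg_neg (T := T) (fun j hj => ?_) (by simp)))
    rcases List.mem_cons.1 hj with rfl | h
    · exact hi
    · exact hw j h
  | hzero => simp
  | hadd a b ha hb => rw [lie_add, map_add, ha, hb, add_zero]
  | hsmul r a ha => rw [lie_smul, map_smul, ha, smul_zero]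

theorem coeff_lie_of_zero {i : ι} (hi : T.ht i = 0) (u : L) :
    T.coeff ⁅T.x i, u⁆ = T.c i * T.coeff u := by
  induction u using T.induction_act with
  | hact w hw =>
    by_cases h : w = []
    · subst h
      rw [act_nil, Module.End.one_apply, T.lie_v_zero i hi, map_smul, smul_eq_mul]
    · have := hw.deg_neg h
      rw [T.coeff_act_eq_zero (ne_of_lt this), ← act_cons, T.coeff_act_eq_zero, mul_zero]
      rw [deg_cons, hi]
      omega
  | hzero => simp
  | hadd a b ha hb => rw [lie_add, map_add, ha, hb, map_add, mul_add]
  | hsmul r a ha => rw [lie_smul, map_smul, ha, map_smul, smul_eq_mul, smul_eq_mul]; ring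

/-- The functional `u ↦ coeff (w u)` attached to a word `w`. -/
noncomputable def wordDual (w : List ι) : Dual K L := T.coeff ∘ₗ T.act w

/-- Dual counterpart of the stability of the lattice: commute `g` to the left through the raising
word until it meets `coeff`, where degree zero gives a scalar and negative degree gives zero.
Stability makes the common kernel of these functionals a submodule. -/
theorem wordDual_comp_mem (w : List ι) (hw : T.IsPos w) : ∀ g : 𝔤,
    T.wordDual w ∘ₗ LieModule.toEnd K 𝔤 L g ∈
      Submodule.span K (Set.range fun w : {w : List ι // T.IsPos w} => T.wordDual w) := by
  set Λ := Submodule.span K (Set.range fun w : {w : List ι // T.IsPos w} => T.wordDual w) with hΛ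
  have hmem : ∀ w, T.IsPos w → T.wordDual w ∈ Λ := fun w hw => Submodule.subset_span ⟨⟨w, hw⟩, rfl⟩
  have hred : ∀ ψ : Dual K L, (∀ i, ψ ∘ₗ LieModule.toEnd K 𝔤 L (T.x i) ∈ Λ) →
      ∀ g, ψ ∘ₗ LieModule.toEnd K 𝔤 L g ∈ Λ := by
    intro ψ hψ g
    have hg : g ∈ Submodule.span K (Set.range T.x) := T.span_x ▸ Submodule.mem_top
    induction hg using Submodule.span_induction with
    | mem g hg => obtain ⟨i, rfl⟩ := hg; exact hψ i
    | zero => rw [map_zero, LinearMap.comp_zero]; exact Submodule.zero_mem _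
    | add a b _ _ ha hb => rw [map_add, LinearMap.comp_add]; exact Submodule.add_mem _ ha hb
    | smul r a _ ha => rw [map_smul, LinearMap.comp_smul]; exact Submodule.smul_mem _ r ha
  have hpos : ∀ j, 0 < T.ht j → ∀ ψ ∈ Λ, ψ ∘ₗ LieModule.toEnd K 𝔤 L (T.x j) ∈ Λ := by
    intro j hj ψ hψ
    rw [hΛ] at hψ
    induction hψ using Submodule.span_induction with
    | mem ψ hψ =>
      obtain ⟨⟨w, hw⟩, rfl⟩ := hψ
      have : T.wordDual w ∘ₗ LieModule.toEnd K 𝔤 L (T.x j) = T.wordDual (w ++ [j]) := by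
        refine LinearMap.ext fun u => ?_
        simp only [wordDual, LinearMap.comp_apply, act_append, Module.End.mul_apply, act_singleton]
        rfl
      simp only [this]
      refine hmem _ fun i hi => ?_
      rcases List.mem_append.1 hi with h | h
      · exact hw i h
      · rw [List.mem_singleton.1 h]; exact hj
    | zero => rw [LinearMap.zero_comp]; exact Submodule.zero_mem _
    | add a b _ _ ha hb => rw [LinearMap.add_comp]; exact Submodule.add_mem _ ha hb
    | smul r a _ ha => rw [LinearMap.smul_comp]; exact Submodule.smul_mem _ r ha
  induction w using List.reverseRecOn with
  | nil =>
    refine hred _ fun i => ?_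
    rcases lt_trichotomy (T.ht i) 0 with h | h | h
    · convert Submodule.zero_mem Λ
      exact LinearMap.ext fun u => T.coeff_lie_of_neg h u
    · convert Submodule.smul_mem Λ (T.c i) (hmem [] hw)
      exact LinearMap.ext fun u => T.coeff_lie_of_zero h u
    · exact hpos i h _ (hmem [] hw)
  | append_singleton w j ih =>
    have ih' := ih fun i hi => hw i (by simp [hi])
    refine hred _ fun i => ?_
    have : T.wordDual (w ++ [j]) ∘ₗ LieModule.toEnd K 𝔤 L (T.x i) =
        T.wordDual w ∘ₗ LieModule.toEnd K 𝔤 L ⁅T.x j, T.x i⁆ +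
        (T.wordDual w ∘ₗ LieModule.toEnd K 𝔤 L (T.x i)) ∘ₗ LieModule.toEnd K 𝔤 L (T.x j) := by
      refine LinearMap.ext fun u => ?_
      simp only [wordDual, LinearMap.comp_apply, act_append, Module.End.mul_apply, act_singleton,
        LinearMap.add_apply, LieModule.toEnd_apply_apply, ← map_add]
      rw [leibniz_lie (T.x j)]
    rw [this]
    exact Submodule.add_mem _ (ih' _) (hpos j (hw j (by simp)) _ (ih' _))

/-- The common kernel is a submodule missing `v`, hence zero by simplicity. This plays the role of
nondegeneracy of the contravariant form. -/
theorem eq_zero_of_wordDual_eq_zero {u : L} (hu : ∀ w, T.IsPos w → T.wordDual w u = 0) :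
    u = 0 := by
  let N : LieSubmodule K 𝔤 L :=
    { carrier := {u | ∀ ψ ∈ Submodule.span K
        (Set.range fun w : {w : List ι // T.IsPos w} => T.wordDual w), ψ u = 0}
      zero_mem' := fun ψ _ => map_zero ψ
      add_mem' := fun {a b} ha hb ψ hψ => by rw [map_add, ha ψ hψ, hb ψ hψ, add_zero]
      smul_mem' := fun r a ha ψ hψ => by rw [map_smul, ha ψ hψ, smul_zero]
      lie_mem := fun {g a} ha ψ hψ => by
        induction hψ using Submodule.span_induction with
        | mem ψ hψ =>
          obtain ⟨⟨w, hw⟩, rfl⟩ := hψ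
          exact ha _ (T.wordDual_comp_mem w hw g)
        | zero => rfl
        | add a b _ _ ha hb => rw [LinearMap.add_apply, ha, hb, add_zero]
        | smul r a _ ha => rw [LinearMap.smul_apply, ha, smul_zero] }
  have huN : u ∈ N := by
    intro ψ hψ
    induction hψ using Submodule.span_induction with
    | mem ψ hψ => obtain ⟨⟨w, hw⟩, rfl⟩ := hψ; exact hu w hw
    | zero => rfl
    | add a b _ _ ha hb => rw [LinearMap.add_apply, ha, hb, add_zero]
    | smul r a _ ha => rw [LinearMap.smul_apply, ha, smul_zero]
  rcases T.simple N with h | h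
  · rwa [h, LieSubmodule.mem_bot] at huN
  · have hv : T.v ∈ N := h ▸ LieSubmodule.mem_top _
    have h1 : T.wordDual [] T.v = 0 := hv _ (Submodule.subset_span ⟨⟨[], by simp [IsPos]⟩, rfl⟩)
    have h2 : T.wordDual [] T.v = 1 := T.coeff_v
    exact absurd (h2.symm.trans h1) one_ne_zero

theorem coeff_mem {u : L} (hu : u ∈ T.lattice) : T.coeff u ∈ A := by
  rw [lattice] at hu
  induction hu using Submodule.span_induction with
  | mem u hu =>
    obtain ⟨⟨w, hw⟩, rfl⟩ := hu
    by_cases h : w = []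
    · subst h
      change T.coeff T.v ∈ A
      rw [T.coeff_v]
      exact A.one_mem
    · change T.coeff (T.act w T.v) ∈ A
      rw [T.coeff_act_eq_zero (ne_of_lt (hw.deg_neg h))]
      exact A.zero_mem
  | zero => rw [map_zero]; exact A.zero_mem
  | add a b _ _ ha hb => rw [map_add]; exact A.add_mem ha hb
  | smul r a _ ha =>
    change T.coeff ((r : K) • a) ∈ A
    rw [map_smul]
    exact A.mul_mem r.2 ha

/-- Raising words preserve the lattice and `coeff` is `A`-valued on it, so the separating
functionals take values in `A`. -/
theorem linearIndependent_of_mem_lattice {κ : Type*} {w : κ → L} (hmem : ∀ i, w i ∈ T.lattice)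
    (hw : LinearIndependent A w) : LinearIndependent K w :=
  linearIndependent_of_dual_mem A hw (fun u : {u : List ι // T.IsPos u} => T.wordDual u)
    (fun u i => T.coeff_mem (T.act_mem_lattice_of_mem u (hmem i)))
    fun _ hy => T.eq_zero_of_wordDual_eq_zero fun u hu => hy ⟨u, hu⟩

end HighestWeightDatum

end HighestWeightDatum

theorem finite_cyclicFiltration {K 𝔩 M : Type*} [Field K] [LieRing 𝔩] [LieAlgebra K 𝔩]
    [FiniteDimensional K 𝔩] [AddCommGroup M] [Module K M] [LieRingModule 𝔩 M] [LieModule K 𝔩 M]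
    (v : M) (n : ℕ) : FiniteDimensional K (cyclicFiltration K 𝔩 v n) := by
  refine Module.Finite.iff_fg.2 (Submodule.FG.map _ (Submodule.FG.pow (Submodule.FG.sup ?_ ?_) n))
  · rw [Submodule.one_eq_span]
    exact Submodule.fg_span_singleton _
  · rw [LinearMap.range_eq_map]
    exact (Module.Finite.fg_top (R := K) (M := 𝔩)).map _

/-! ### Quadratic growth comparison between the module and `U(𝔤)` modulo its annihilator. -/

namespace HighestWeightDatum

variable {K : Type*} {𝔤 L : Type*} [Field K] [CharZero K] [LieRing 𝔤]
  [LieAlgebra K 𝔤] [AddCommGroup L] [Module K L] [LieRingModule 𝔤 L] [LieModule K 𝔤 L]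
  {A : Subring K} {ι : Type*} (T : HighestWeightDatum 𝔤 L A ι)

/-- The span of all negative words of degree at least `-m` applied to the generator. -/
def negSpan (m : ℕ) : Submodule K L :=
  Submodule.span K ((fun w => T.act w T.v) '' {w | T.IsNeg w ∧ -T.deg w ≤ m})

theorem act_mem_negSpan {m : ℕ} {w : List ι} (hw : T.IsNeg w) (h : -T.deg w ≤ m) :
    T.act w T.v ∈ T.negSpan m := Submodule.subset_span ⟨w, ⟨hw, h⟩, rfl⟩

theorem negSpan_mono : Monotone T.negSpan := fun a b h =>
  Submodule.span_mono (Set.image_mono fun w hw => ⟨hw.1, hw.2.trans (by exact_mod_cast h)⟩)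

instance finite_negSpan [Finite ι] (m : ℕ) : FiniteDimensional K (T.negSpan m) := by
  refine FiniteDimensional.span_of_finite K (Set.Finite.image _ ?_)
  refine (List.finite_length_le ι m).subset fun w hw => ?_
  have := hw.1.length_le.trans hw.2
  simpa using this

/-- Here `C` bounds how far one element of `𝔤` can lower the degree. -/
theorem lie_mem_negSpan {C : ℕ} (hC : ∀ i, -T.ht i ≤ C) (g : 𝔤) {m : ℕ} {u : L}
    (hu : u ∈ T.negSpan m) : ⁅g, u⁆ ∈ T.negSpan (m + C) := by
  have hg : g ∈ Submodule.span K (Set.range T.x) := T.span_x ▸ Submodule.mem_top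
  induction hg using Submodule.span_induction with
  | mem g hg =>
    obtain ⟨i, rfl⟩ := hg
    rw [negSpan] at hu
    induction hu using Submodule.span_induction with
    | mem u hu =>
      obtain ⟨w, hw, rfl⟩ := hu
      refine Submodule.span_mono ?_ (T.lie_act_mem_span i hw.1)
      rintro _ ⟨w', hw', hdeg, rfl⟩
      refine ⟨w', ⟨hw', ?_⟩, rfl⟩
      have h1 := hC i
      have h2 := hw.2
      rw [hdeg]
      push_cast
      omega
    | zero => rw [lie_zero]; exact Submodule.zero_mem _
    | add a b _ _ ha hb => rw [lie_add]; exact Submodule.add_mem _ ha hb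
    | smul r a _ ha => rw [lie_smul]; exact Submodule.smul_mem _ r ha
  | zero => rw [zero_lie]; exact Submodule.zero_mem _
  | add a b _ _ ha hb => rw [add_lie]; exact Submodule.add_mem _ ha hb
  | smul r a _ ha => rw [smul_lie]; exact Submodule.smul_mem _ r ha

theorem deg_append (w w' : List ι) : T.deg (w ++ w') = T.deg w + T.deg w' := by
  simp [deg]

theorem wordDual_act_eq_zero {w u : List ι} (h : T.deg u + T.deg w ≠ 0) :
    T.wordDual u (T.act w T.v) = 0 := by
  rw [wordDual, LinearMap.comp_apply, ← Module.End.mul_apply, ← act_append]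
  refine T.coeff_act_eq_zero ?_
  rwa [deg_append]

theorem act_act_eq_zero {w u : List ι} (h : 0 < T.deg u + T.deg w) :
    T.act u (T.act w T.v) = 0 := by
  refine T.eq_zero_of_wordDual_eq_zero fun u' hu' => ?_
  rw [← Module.End.mul_apply, ← act_append]
  refine T.wordDual_act_eq_zero ?_
  have := hu'.length_le
  rw [deg_append]
  omega

/-- A vector of total degree zero is a multiple of `v`: after its `coeff` multiple of `v` is
subtracted, every raising functional vanishes on it. -/
theorem act_act_eq_wordDual_smul {w u : List ι} (h : T.deg u + T.deg w = 0) :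
    T.act u (T.act w T.v) = T.wordDual u (T.act w T.v) • T.v := by
  rw [← sub_eq_zero]
  refine T.eq_zero_of_wordDual_eq_zero fun u' hu' => ?_
  rw [map_sub, map_smul, smul_eq_mul, sub_eq_zero]
  by_cases hnil : u' = []
  · subst hnil
    have h1 : T.wordDual [] T.v = 1 := T.coeff_v
    rw [h1, mul_one]
    rfl
  · have h2 := hu'.length_le
    have h3 := List.length_pos_iff.2 hnil
    have h1 : T.wordDual u' T.v = 0 := T.wordDual_act_eq_zero (w := []) (by rw [deg_nil]; omega)
    rw [h1, mul_zero, ← Module.End.mul_apply, ← act_append]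
    refine T.wordDual_act_eq_zero ?_
    rw [deg_append]
    omega

theorem exists_negSpan_basis [Finite ι] (m : ℕ) : ∃ w : Fin (finrank K (T.negSpan m)) → List ι,
    (∀ a, T.IsNeg (w a) ∧ -T.deg (w a) ≤ m) ∧ LinearIndependent K fun a => T.act (w a) T.v := by
  have : FiniteDimensional K (Submodule.span K ((fun w => T.act w T.v) ''
    {w | T.IsNeg w ∧ -T.deg w ≤ m})) := T.finite_negSpan m
  obtain ⟨f, hf, -, hind⟩ := Submodule.exists_fun_fin_finrank_span_eq K
    ((fun w => T.act w T.v) '' {w | T.IsNeg w ∧ -T.deg w ≤ m})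
  choose w hw hwf using hf
  refine ⟨w, hw, ?_⟩
  rw [← funext hwf] at hind
  exact hind

/-- Raising words of degree above `m` pair to zero with `negSpan m`, so those of degree at most `m`
already separate its points. Their restrictions then span the dual, and a basis can be chosen among
them. -/
theorem exists_posWord_basis [Finite ι] (m : ℕ) : ∃ u : Fin (finrank K (T.negSpan m)) → List ι,
    (∀ a, T.IsPos (u a) ∧ T.deg (u a) ≤ m) ∧
      LinearIndependent K fun a => (T.wordDual (u a)).comp (T.negSpan m).subtype := by
  set S : Set (Dual K (T.negSpan m)) := (fun u => (T.wordDual u).comp (T.negSpan m).subtype) ''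
    {u | T.IsPos u ∧ T.deg u ≤ m} with hS
  obtain ⟨f, hf, -, hind⟩ := Submodule.exists_fun_fin_finrank_span_eq K S
  have hbot : (Submodule.span K S).dualCoannihilator = ⊥ := by
    rw [eq_bot_iff]
    rintro ⟨z, hz⟩ h
    rw [Submodule.mem_dualCoannihilator] at h
    rw [Submodule.mem_bot]
    refine Subtype.ext (T.eq_zero_of_wordDual_eq_zero fun u hu => ?_)
    change T.wordDual u z = 0
    by_cases hdeg : T.deg u ≤ m
    · exact h _ (Submodule.subset_span ⟨u, ⟨hu, hdeg⟩, rfl⟩)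
    · have hle : T.negSpan m ≤ LinearMap.ker (T.wordDual u) := by
        refine Submodule.span_le.2 ?_
        rintro _ ⟨w, hw, rfl⟩
        exact T.wordDual_act_eq_zero (by have := hw.2; omega)
      exact hle hz
  have hrank : finrank K (Submodule.span K S) = finrank K (T.negSpan m) := by
    have := Subspace.finrank_add_finrank_dualCoannihilator_eq (Submodule.span K S)
    rwa [hbot, finrank_bot, add_zero] at this
  choose u hu huf using hf
  refine ⟨fun a => u (Fin.cast hrank.symm a), fun a => hu _, ?_⟩
  have h : (fun a => (T.wordDual (u (Fin.cast hrank.symm a))).comp (T.negSpan m).subtype) =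
      f ∘ Fin.cast hrank.symm := funext fun a => huf _
  rw [h]
  exact hind.comp (Fin.cast hrank.symm) (Fin.cast_injective _)

/-- Triangularity in the degree of the raising word. On a vector of degree `-n`, raising words of
degree above `n` act by zero and those of degree exactly `n` give multiples of `v`. -/
theorem linearIndependent_act_mul_act {r : ℕ} {m : ℕ} {w u : Fin r → List ι}
    (hwind : LinearIndependent K fun a => T.act (w a) T.v)
    (huind : LinearIndependent K fun a => (T.wordDual (u a)).comp (T.negSpan m).subtype)
    (hu : ∀ a, T.IsPos (u a)) :
    LinearIndependent K fun q : Fin r × Fin r => T.act (w q.1) * T.act (u q.2) := by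
  rw [Fintype.linearIndependent_iff]
  intro c hc
  -- Strong induction removes the raising words of degree below `n`. What remains of the relation on
  -- a degree `-n` vector is a combination of the `w_a v`, whose coefficients must vanish one by
  -- one.
  have key : ∀ n : ℕ, ∀ b, T.deg (u b) = n → ∀ a, c (a, b) = 0 := by
    intro n
    induction n using Nat.strong_induction_on with
    | _ n ih =>
      have hzero : ∀ y, T.IsNeg y → T.deg y = -n → ∀ a,
          ∑ b with T.deg (u b) = n, c (a, b) * T.wordDual (u b) (T.act y T.v) = 0 := by
        intro y hy hdeg
        have h1 := LinearMap.congr_fun hc (T.act y T.v)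
        rw [LinearMap.sum_apply, LinearMap.zero_apply, Fintype.sum_prod_type] at h1
        have h2 : ∀ a, ∑ b, (c (a, b) • (T.act (w a) * T.act (u b))) (T.act y T.v) =
            (∑ b with T.deg (u b) = n, c (a, b) * T.wordDual (u b) (T.act y T.v)) •
              T.act (w a) T.v := by
          intro a
          rw [Finset.sum_smul, Finset.sum_filter]
          refine Finset.sum_congr rfl fun b _ => ?_
          rw [LinearMap.smul_apply, Module.End.mul_apply]
          have hb := (hu b).length_le
          split_ifs with hn
          · rw [T.act_act_eq_wordDual_smul (by omega), map_smul, smul_smul]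
          · rcases lt_or_gt_of_ne hn with h | h
            · rw [ih (T.deg (u b)).toNat (by omega) b (by omega) a, zero_smul]
            · rw [T.act_act_eq_zero (by omega), map_zero, smul_zero]
        simp only [h2] at h1
        exact Fintype.linearIndependent_iff.1 hwind _ h1
      intro b hb a
      -- The degree `n` functionals also vanish on words of degree other than `-n`, so the relation
      -- holds on all of `negSpan m`.
      have hsum : ∑ b, (if T.deg (u b) = n then c (a, b) else 0) •
          (T.wordDual (u b)).comp (T.negSpan m).subtype = 0 := by
        refine LinearMap.ext fun ⟨z, hz⟩ => ?_
        have hle : T.negSpan m ≤ LinearMap.ker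
            (∑ b, (if T.deg (u b) = n then c (a, b) else 0) • T.wordDual (u b)) := by
          refine Submodule.span_le.2 ?_
          rintro _ ⟨y, hy, rfl⟩
          rw [SetLike.mem_coe, LinearMap.mem_ker, LinearMap.sum_apply]
          by_cases hd : T.deg y = -n
          · refine Eq.trans ?_ (hzero y hy.1 hd a)
            rw [Finset.sum_filter]
            refine Finset.sum_congr rfl fun b _ => ?_
            split_ifs <;> simp
          · refine Finset.sum_eq_zero fun b _ => ?_
            split_ifs with hn
            · rw [LinearMap.smul_apply, T.wordDual_act_eq_zero (by omega), smul_zero]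
            · simp
        have := hle hz
        rw [LinearMap.mem_ker] at this
        rw [LinearMap.sum_apply] at this ⊢
        exact this
      have := Fintype.linearIndependent_iff.1 huind _ hsum b
      rwa [if_pos hb] at this
  rintro ⟨a, b⟩
  have := (hu b).length_le
  exact key (T.deg (u b)).toNat b (by omega) a

/-- The element of the enveloping algebra given by a word. -/
noncomputable def wordEnv (w : List ι) : UniversalEnvelopingAlgebra K 𝔤 :=
  (w.map fun i => UniversalEnvelopingAlgebra.ι K (T.x i)).prod

theorem envAct_wordEnv (w : List ι) : envAct K 𝔤 L (T.wordEnv w) = T.act w := by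
  rw [wordEnv, map_list_prod, List.map_map, act]
  congr 1
  refine List.map_congr_left fun i _ => LinearMap.ext fun u => envAct_ι_apply K 𝔤 L _ u

theorem mk_wordEnv_mem (J : Submodule (UniversalEnvelopingAlgebra K 𝔤)
    (UniversalEnvelopingAlgebra K 𝔤)) (w : List ι) :
    (Submodule.Quotient.mk (T.wordEnv w) : UniversalEnvelopingAlgebra K 𝔤 ⧸ J) ∈
      cyclicFiltration K 𝔤 (EnvQuot.gen J) w.length := by
  induction w with
  | nil => exact self_mem_cyclicFiltration K 𝔤 (EnvQuot.gen J) 0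
  | cons i w ih =>
    rw [wordEnv, List.map_cons, List.prod_cons]
    exact lie_mem_cyclicFiltration (EnvQuot.gen J) _ (T.x i) ih

/-- The square is the origin of the factor `2` in `2d ≤ dim O_χ`. Lowering and raising words of
degree at most `m` in absolute value have length at most `m`, so their products lie in filtration
degree `m + m`. -/
theorem finrank_negSpan_sq_le [Finite ι] (m : ℕ) :
    finrank K (T.negSpan m) * finrank K (T.negSpan m) ≤ finrank K
      (cyclicFiltration K 𝔤 (EnvQuot.gen (RingHom.ker (envAct K 𝔤 L))) (m + m)) := by
  have hfd : FiniteDimensional K 𝔤 :=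
    Module.finite_def.2 (T.span_x ▸ Submodule.fg_span (Set.finite_range _))
  have hfin := finite_cyclicFiltration (K := K) (𝔩 := 𝔤) (EnvQuot.gen (RingHom.ker (envAct K 𝔤 L))) (m + m)
  obtain ⟨w, hw, hwind⟩ := T.exists_negSpan_basis m
  obtain ⟨u, hu, huind⟩ := T.exists_posWord_basis m
  have hind := T.linearIndependent_act_mul_act hwind huind fun a => (hu a).1
  let π : UniversalEnvelopingAlgebra K 𝔤 →ₗ[K] EnvQuot (RingHom.ker (envAct K 𝔤 L)) :=
    (Submodule.mkQ (RingHom.ker (envAct K 𝔤 L))).restrictScalars K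
  have hmem : ∀ q : Fin (finrank K (T.negSpan m)) × Fin (finrank K (T.negSpan m)),
      π (T.wordEnv (w q.1 ++ u q.2)) ∈
        cyclicFiltration K 𝔤 (EnvQuot.gen (RingHom.ker (envAct K 𝔤 L))) (m + m) := by
    intro q
    refine cyclicFiltration_mono _ _ _ ?_ (T.mk_wordEnv_mem _ (w q.1 ++ u q.2))
    have h1 := (hw q.1).1.length_le.trans (hw q.1).2
    have h2 := (hu q.2).1.length_le.trans (hu q.2).2
    rw [List.length_append]
    omega
  have hπ : LinearIndependent K fun q => (⟨_, hmem q⟩ :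
      cyclicFiltration K 𝔤 (EnvQuot.gen (RingHom.ker (envAct K 𝔤 L))) (m + m)) := by
    rw [Fintype.linearIndependent_iff] at hind ⊢
    intro c hc
    refine hind c ?_
    have h1 := congrArg (Submodule.subtype _) hc
    rw [map_sum, map_zero] at h1
    have h2 : π (∑ q, c q • T.wordEnv (w q.1 ++ u q.2)) = 0 := by
      rw [map_sum, ← h1]
      exact Finset.sum_congr rfl fun q _ => map_smul π _ _
    have h3 : (∑ q, c q • T.wordEnv (w q.1 ++ u q.2)) ∈ RingHom.ker (envAct K 𝔤 L) :=
      (Submodule.Quotient.mk_eq_zero _).1 h2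
    rw [RingHom.mem_ker, map_sum] at h3
    rw [← h3]
    refine Finset.sum_congr rfl fun q _ => ?_
    rw [map_smul, envAct_wordEnv, act_append]
  simpa using hπ.fintype_card_le_finrank

end HighestWeightDatum

/-! ### Lifting homogeneous monomials to the filtered module. -/

section HomogeneousMonomials

variable {R : Type*} {𝔩 : Type*} [CommRing R] [LieRing 𝔩] [LieAlgebra R 𝔩]
  {M : Type*} [AddCommGroup M] [Module R M] [LieRingModule 𝔩 M] [LieModule R 𝔩 M] {v : M}

/-- Take the terms of highest degree `N` among those with nonzero coefficient. Their sum lies in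
`U_{N-1} v`, which gives a nontrivial relation between the classes in `gr_N`. -/
theorem linearIndependent_of_grMk {κ : Type*} {n : κ → ℕ} {m : κ → M}
    (hm : ∀ a, m a ∈ cyclicFiltration R 𝔩 v (n a))
    (h : LinearIndependent R fun a => grMk (R := R) (𝔩 := 𝔩) v (n a) ⟨m a, hm a⟩) :
    LinearIndependent R m := by
  classical
  have h := linearIndependent_iff'ₛ.1 h
  rw [linearIndependent_iff']
  intro s c hc
  by_contra! hne
  have hs : (s.filter fun a => c a ≠ 0).Nonempty := by
    obtain ⟨i, hi, hci⟩ := hne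
    exact ⟨i, Finset.mem_filter.2 ⟨hi, hci⟩⟩
  obtain ⟨a₀, ha₀, hmax⟩ := Finset.exists_max_image _ n hs
  set s' := s.filter fun a => c a ≠ 0 with hs'
  have hc' : ∑ a ∈ s', c a • m a = 0 := by
    rw [← hc, hs', Finset.sum_filter]
    exact Finset.sum_congr rfl fun a _ => by by_cases h : c a = 0 <;> simp [h]
  set N := n a₀ with hN
  have hsplit := Finset.sum_filter_add_sum_filter_not s' (fun a => n a = N) fun a => c a • m a
  rw [hc', add_eq_zero_iff_eq_neg] at hsplit
  have hlow : ∑ a ∈ s' with ¬ n a = N, c a • m a ∈ cyclicFiltrationLT R 𝔩 v N := by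
    refine Submodule.sum_mem _ fun a ha => Submodule.smul_mem _ _ ?_
    have h1 := hmax a (Finset.mem_filter.1 ha).1
    have h2 := (Finset.mem_filter.1 ha).2
    obtain ⟨k, hk⟩ : ∃ k, N = k + 1 := ⟨N - 1, by omega⟩
    rw [hk]
    exact cyclicFiltration_mono R 𝔩 v (by omega) (hm a)
  let g : κ → cyclicFiltration R 𝔩 v N := fun a =>
    if ha : n a = N then ⟨m a, ha ▸ hm a⟩ else 0
  have hg : ∀ a, n a = N → (g a : M) = m a := fun a ha => by simp [g, ha]
  have hgr : ∀ a, n a = N → grMk v N (g a) = grMk (R := R) (𝔩 := 𝔩) v (n a) ⟨m a, hm a⟩ := by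
    intro a ha
    simp only [g, ha, dite_true]
    generalize_proofs h1 h2
    generalize n a = k at ha h2
    subst ha
    rfl
  have hzero : ∑ a ∈ s' with n a = N, c a • grMk (R := R) (𝔩 := 𝔩) v (n a) ⟨m a, hm a⟩ = 0 := by
    have h1 : ∑ a ∈ s' with n a = N, c a • grMk (R := R) (𝔩 := 𝔩) v (n a) ⟨m a, hm a⟩ =
        grMk v N (∑ a ∈ s' with n a = N, c a • g a) := by
      rw [map_sum]
      refine Finset.sum_congr rfl fun a ha => ?_
      rw [LinearMap.map_smul, hgr a (Finset.mem_filter.1 ha).2]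
    rw [h1, grMk_eq_zero_iff, AddSubmonoidClass.coe_finsetSum]
    have h2 : ∑ a ∈ s' with n a = N, ((c a • g a : cyclicFiltration R 𝔩 v N) : M) =
        ∑ a ∈ s' with n a = N, c a • m a :=
      Finset.sum_congr rfl fun a ha => by
        rw [Submodule.coe_smul, hg a (Finset.mem_filter.1 ha).2]
    rw [h2, hsplit]
    exact Submodule.neg_mem _ hlow
  exact (Finset.mem_filter.1 ha₀).2 (h (s'.filter fun a => n a = N) c 0
    (by simpa using hzero) a₀ (Finset.mem_filter.2 ⟨ha₀, rfl⟩))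

theorem prod_pow_mem_symPow {d : ℕ} {s : Fin d → SymmetricAlgebra R 𝔩} {n : Fin d → ℕ}
    (hs : ∀ i, s i ∈ symPow R 𝔩 (n i)) (a : Fin d → ℕ) (S : Finset (Fin d)) :
    ∏ i ∈ S, s i ^ a i ∈ symPow R 𝔩 (∑ i ∈ S, n i * a i) := by
  classical
  induction S using Finset.induction_on with
  | empty => rw [Finset.prod_empty, Finset.sum_empty, symPow, pow_zero]; exact Submodule.one_le.1 le_rfl
  | insert i S hi ih =>
    rw [Finset.prod_insert hi, Finset.sum_insert hi, symPow, pow_add, pow_mul]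
    exact Submodule.mul_mem_mul (Submodule.pow_mem_pow _ (hs i) _) ih

/-- The monomials with exponents below `t` are independent in `S(𝔩)/Ann`, which embeds in the graded
module. Homogeneity places each in a single degree, at most `(∑ n_i) t`, where it lifts. -/
theorem exists_linearIndependent_cyclicFiltration {d : ℕ}
    {y : Fin d → SymmetricAlgebra R 𝔩 ⧸ grAnnihilator R 𝔩 v} (hind : AlgebraicIndependent R y)
    {n : Fin d → ℕ} (hy : ∀ i, ∃ s ∈ symPow R 𝔩 (n i), Ideal.Quotient.mk _ s = y i) (t : ℕ) :
    ∃ m : (Fin d → Fin t) → M, (∀ a, m a ∈ cyclicFiltration R 𝔩 v ((∑ i, n i) * t)) ∧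
      LinearIndependent R m := by
  choose s hs hsy using hy
  let ev : (SymmetricAlgebra R 𝔩 ⧸ grAnnihilator R 𝔩 v) →ₗ[R] GrModule R 𝔩 v :=
    (LinearMap.applyₗ (grGen R 𝔩 v)).comp
      (Ideal.Quotient.liftₐ (grAnnihilator R 𝔩 v) (grSymAct R 𝔩 v) fun s hs => hs).toLinearMap
  have hev_mk : ∀ t, ev (Ideal.Quotient.mk _ t) = grSymAct R 𝔩 v t (grGen R 𝔩 v) := fun _ => rfl
  have hev : Function.Injective ev := by
    rw [injective_iff_map_eq_zero]
    intro r hr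
    obtain ⟨r, rfl⟩ := Ideal.Quotient.mk_surjective r
    rw [hev_mk, ← mem_grAnnihilator_iff] at hr
    exact Ideal.Quotient.eq_zero_iff_mem.2 hr
  have hmon : LinearIndependent R fun a : Fin d → Fin t => ev (∏ i, y i ^ (a i : ℕ)) := by
    have h1 := (MvPolynomial.basisMonomials (Fin d) R).linearIndependent
    have h2 := h1.comp (fun a : Fin d → Fin t => Finsupp.equivFunOnFinite.symm fun i => (a i : ℕ))
      fun a b hab => by
        funext i
        exact Fin.ext (congrFun (Finsupp.equivFunOnFinite.symm.injective hab) i)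
    have h3 := h2.map_injOn (ev.comp (MvPolynomial.aeval y).toLinearMap)
      (hev.comp hind).injOn
    convert h3 with a
    simp [MvPolynomial.aeval_monomial, Finsupp.prod_fintype]
  have hex : ∀ a : Fin d → Fin t, ∃ m : cyclicFiltration R 𝔩 v (0 + ∑ i, n i * (a i : ℕ)),
      grMk v _ m = ev (∏ i, y i ^ (a i : ℕ)) := by
    intro a
    have h1 := grSymAct_grMk_mem v (prod_pow_mem_symPow hs (fun i => (a i : ℕ)) Finset.univ) 0
      ⟨v, self_mem_cyclicFiltration R 𝔩 v 0⟩
    obtain ⟨m, hm⟩ := h1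
    refine ⟨m, hm.trans ?_⟩
    simp only [← hsy, ← map_pow, ← map_prod, hev_mk]
    rfl
  choose m hm using hex
  refine ⟨fun a => m a, fun a => cyclicFiltration_mono R 𝔩 v ?_ (m a).2,
    linearIndependent_of_grMk (fun a => (m a).2) ?_⟩
  · rw [zero_add, Finset.sum_mul]
    exact Finset.sum_le_sum fun i _ => Nat.mul_le_mul_left _ (a i).2.le
  · convert hmon with a
    exact hm a

end HomogeneousMonomials

theorem two_mul_le_of_pow_sq_le {d s c C : ℕ} (h : ∀ t : ℕ, t ^ d * t ^ d ≤ C * (c * t + c * t + 1) ^ s) :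
    2 * d ≤ s := by
  by_contra! hlt
  -- If `s < 2d`, the hypothesis yields `t^(s+1) ≤ C (2c+1)^s t^s` for every `t ≥ 1`; this `t` is
  -- one more than the resulting bound.
  set t := C * (2 * c + 1) ^ s + 1 with ht
  have ht1 : 1 ≤ t := by omega
  have h1 : t ^ (s + 1) ≤ t ^ d * t ^ d := by
    rw [← pow_add]
    exact Nat.pow_le_pow_right ht1 (by omega)
  have h2 : C * (c * t + c * t + 1) ^ s ≤ C * (2 * c + 1) ^ s * t ^ s := by
    rw [mul_assoc, ← mul_pow]
    gcongr
    nlinarith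
  have h3 := h1.trans ((h t).trans h2)
  rw [pow_succ', mul_le_mul_iff_left₀ (by positivity)] at h3
  omega

namespace HighestWeightDatum

variable {K : Type*} {𝔤 L : Type*} [Field K] [CharZero K] [LieRing 𝔤]
  [LieAlgebra K 𝔤] [AddCommGroup L] [Module K L] [LieRingModule 𝔤 L] [LieModule K 𝔤 L]
  {A : Subring K} {ι : Type*} (T : HighestWeightDatum 𝔤 L A ι)

theorem lie_mem_lattice_of_mem_span {g : 𝔤} (hg : g ∈ Submodule.span A (Set.range T.x)) {u : L}
    (hu : u ∈ T.lattice) : ⁅g, u⁆ ∈ T.lattice := by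
  induction hg using Submodule.span_induction with
  | mem g hg => obtain ⟨i, rfl⟩ := hg; exact T.lie_mem_lattice i hu
  | zero => rw [zero_lie]; exact Submodule.zero_mem _
  | add a b _ _ ha hb => rw [add_lie]; exact Submodule.add_mem _ ha hb
  | smul r a _ ha =>
    change ⁅(r : K) • a, u⁆ ∈ _
    rw [smul_lie]
    exact Submodule.smul_mem _ r ha

theorem two_mul_le_varietyDim [Finite ι] [IsAlgClosed K] {Z : Set (Dual K 𝔤)}
    (hZ : symZeroLocus (grAnnihilator K 𝔤 (EnvQuot.gen (RingHom.ker (envAct K 𝔤 L)))) =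
      zariskiClosure Z) {d c : ℕ}
    (h : ∀ t, ∃ m : (Fin d → Fin t) → L, (∀ a, m a ∈ T.lattice ∧ m a ∈ T.negSpan (c * t)) ∧
      LinearIndependent A m) : 2 * d ≤ varietyDim Z := by
  have hfd : FiniteDimensional K 𝔤 :=
    Module.finite_def.2 (T.span_x ▸ Submodule.fg_span (Set.finite_range _))
  have hgen : EnvQuot.gen (RingHom.ker (envAct K 𝔤 L)) ≠ 0 := by
    intro h0
    have h1 : (1 : UniversalEnvelopingAlgebra K 𝔤) ∈ RingHom.ker (envAct K 𝔤 L) :=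
      (Submodule.Quotient.mk_eq_zero _).1 h0
    rw [RingHom.mem_ker, map_one] at h1
    exact T.v_ne (LinearMap.congr_fun h1 T.v)
  obtain ⟨s, C, hs, hC⟩ := exists_finrank_cyclicFiltration_le_varietyDim hgen hZ
  refine le_trans (two_mul_le_of_pow_sq_le (c := c) (C := C) fun t => ?_) hs
  obtain ⟨m, hm, hind⟩ := h t
  have hindK := T.linearIndependent_of_mem_lattice (fun a => (hm a).1) hind
  have hcard : t ^ d ≤ finrank K (T.negSpan (c * t)) := by
    have h1 : LinearIndependent K fun a => (⟨m a, (hm a).2⟩ : T.negSpan (c * t)) :=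
      LinearIndependent.of_comp (T.negSpan (c * t)).subtype hindK
    simpa using h1.fintype_card_le_finrank
  exact (Nat.mul_le_mul hcard hcard).trans ((T.finrank_negSpan_sq_le (c * t)).trans (hC _))

end HighestWeightDatum

/-! ### The highest weight module `L(μ)` with its Chevalley basis. -/

section ChevalleyDatum

open LieAlgebra LieAlgebra.IsKilling

variable {𝔤 : Type*} [LieRing 𝔤] [LieAlgebra ℂ 𝔤] [FiniteDimensional ℂ 𝔤] [IsKilling ℂ 𝔤]
  {H : LieSubalgebra ℂ 𝔤} [H.IsCartanSubalgebra]

theorem IsChevalleySystem.ne_zero {X : H.root → 𝔤} (hX : IsChevalleySystem X) (γ : H.root) :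
    X γ ≠ 0 := by
  intro h
  have h1 := hX.lie_neg γ ((rootSystem H).reflectionPerm γ γ)
    (by rw [RootPairing.root_reflectionPerm, RootPairing.reflection_apply_self])
  rw [h, zero_lie] at h1
  have h2 : (rootSystem H).coroot γ = 0 := Subtype.ext h1.symm
  exact (rootSystem H).ne_zero' γ h2

theorem span_chevalleyBasis (b : (rootSystem H).Base) {X : H.root → 𝔤}
    (hX : IsChevalleySystem X) : Submodule.span ℂ (Set.range (chevalleyBasis b X)) = ⊤ := by
  have h := congrArg LieSubmodule.toSubmodule (LieModule.iSup_genWeightSpace_eq_top' ℂ H 𝔤)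
  rw [LieSubmodule.iSup_toSubmodule, LieSubmodule.top_toSubmodule] at h
  rw [eq_top_iff, ← h, iSup_le_iff]
  intro χ
  by_cases hχ : χ.IsZero
  · intro x hx
    have hx' : x ∈ H := by
      rw [LieModule.Weight.IsZero] at hχ
      rw [hχ] at hx
      have hx0 : x ∈ rootSpace H 0 := hx
      rwa [rootSpace_zero_eq] at hx0
    have htop : (⟨x, hx'⟩ : H) ∈ Submodule.span ℂ ((rootSystem H).coroot '' b.support) := by
      rw [b.span_coroot_support]
      exact (RootPairing.IsRootSystem.span_coroot_eq_top (P := rootSystem H)).ge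
        Submodule.mem_top
    have hmap := Submodule.mem_map_of_mem (f := H.toSubmodule.subtype) htop
    rw [Submodule.map_span] at hmap
    refine Submodule.span_mono ?_ hmap
    rintro _ ⟨_, ⟨i, hi, rfl⟩, rfl⟩
    exact ⟨Sum.inl ⟨i, hi⟩, rfl⟩
  · intro x hx
    have hmem : χ ∈ H.root := by simpa [LieSubalgebra.root] using hχ
    obtain ⟨c, hc⟩ := (finrank_eq_one_iff_of_nonzero' (⟨X ⟨χ, hmem⟩, hX.mem_rootSpace ⟨χ, hmem⟩⟩ :
      rootSpace H χ) (fun h0 => hX.ne_zero _ (congrArg Subtype.val h0))).1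
      (finrank_rootSpace_eq_one χ hχ) ⟨x, hx⟩
    have hx2 : c • X ⟨χ, hmem⟩ = x := congrArg Subtype.val hc
    rw [← hx2]
    exact Submodule.smul_mem _ _ (Submodule.subset_span ⟨Sum.inr ⟨χ, hmem⟩, rfl⟩)

/-- Simple roots form a basis of `𝔥*`, so height extends to a linear form on `𝔥*`, that is, to an
element of `𝔥`. It supplies the integral grading. -/
theorem exists_root_apply_eq_height (b : (rootSystem H).Base) :
    ∃ h₀ : H, ∀ γ : H.root, γ.1 h₀ = (b.height γ : ℂ) := by
  let B := b.toWeightBasis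
  let ℓ : Dual ℂ (Dual ℂ H) := B.constr ℂ fun _ => (1 : ℂ)
  obtain ⟨h₀, hh₀⟩ := (Module.evalEquiv ℂ H).surjective ℓ
  refine ⟨h₀, fun γ => ?_⟩
  have hev : ∀ φ : Dual ℂ H, φ h₀ = ℓ φ := fun φ => by rw [← hh₀]; rfl
  obtain ⟨f, -, -, hf⟩ := b.exists_root_eq_sum_int γ
  have h1 : γ.1 h₀ = (rootSystem H).root γ h₀ := rfl
  rw [h1, hev, hf, RootPairing.Base.height_eq_sum hf, map_sum]
  push_cast
  refine Finset.sum_congr rfl fun i hi => ?_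
  have h2 : (rootSystem H).root i = B ⟨i, hi⟩ := by simp [B]
  rw [map_zsmul, h2, Basis.constr_basis, zsmul_eq_mul, mul_one]

theorem lie_eq_apply_smul {X : H.root → 𝔤} (hX : IsChevalleySystem X) (h : H) (γ : H.root) :
    ⁅(h : 𝔤), X γ⁆ = γ.1 h • X γ :=
  lie_eq_smul_of_mem_rootSpace (hX.mem_rootSpace γ) h

section

attribute [local instance 100] LieRing.ofAssociativeRing

/-- The elements of `U(𝔩)` preserving `N` form a subalgebra containing `𝔩`. The universal property
gives a map from `U(𝔩)` into it whose composite with the inclusion is the identity. -/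
theorem EnvQuot.smul_mem_lieSubmodule {R 𝔩 : Type*} [CommRing R] [LieRing 𝔩] [LieAlgebra R 𝔩]
    {J : Submodule (UniversalEnvelopingAlgebra R 𝔩) (UniversalEnvelopingAlgebra R 𝔩)}
    (N : LieSubmodule R 𝔩 (EnvQuot J)) (u : UniversalEnvelopingAlgebra R 𝔩) {m : EnvQuot J}
    (hm : m ∈ N) : u • m ∈ N := by
  let S : Subalgebra R (UniversalEnvelopingAlgebra R 𝔩) :=
    { carrier := {u | ∀ m ∈ N, u • m ∈ N}
      mul_mem' := fun {a c} ha hc m hm => by rw [mul_smul]; exact ha _ (hc _ hm)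
      add_mem' := fun {a c} ha hc m hm => by rw [add_smul]; exact N.add_mem (ha _ hm) (hc _ hm)
      algebraMap_mem' := fun r m hm => by
        rw [algebraMap_smul]; exact N.smul_mem r hm }
  let g : 𝔩 →ₗ⁅R⁆ S :=
    { toFun := fun x => ⟨UniversalEnvelopingAlgebra.ι R x, fun m hm => N.lie_mem (x := x) hm⟩
      map_add' := fun x y => Subtype.ext (map_add _ x y)
      map_smul' := fun r x => Subtype.ext (map_smul _ r x)
      map_lie' := fun {x y} => Subtype.ext (LieHom.map_lie _ x y) }
  have hid : S.val.comp (UniversalEnvelopingAlgebra.lift R g) = AlgHom.id R _ := by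
    refine UniversalEnvelopingAlgebra.hom_ext R (LieHom.ext fun x => ?_)
    simp [g]
  have := (UniversalEnvelopingAlgebra.lift R g u).2
  have h2 : ((UniversalEnvelopingAlgebra.lift R g u : S) : UniversalEnvelopingAlgebra R 𝔩) = u :=
    AlgHom.congr_fun hid u
  rw [h2] at this
  exact this m hm

end

theorem vermaIdeal_le_simpleIdeal (b : (rootSystem H).Base) (μ : Dual ℂ H) :
    vermaIdeal b μ ≤ simpleIdeal b μ := fun u hu => by
  have h1 : (vermaIdeal b μ).mkQ u = 0 := (Submodule.Quotient.mk_eq_zero _).2 hu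
  change (vermaIdeal b μ).mkQ u ∈ vermaMax b μ
  rw [h1]
  exact (vermaMax b μ).zero_mem

/-- The preimage of a submodule in the Verma module is either everything or one of the proper
submodules summed in `vermaMax`. The zero module is allowed here; that `v_μ ≠ 0` is a separate
input. -/
theorem simpleHighestWeight_eq_bot_or_top (b : (rootSystem H).Base) (μ : Dual ℂ H)
    (N : LieSubmodule ℂ 𝔤 (SimpleHighestWeight b μ)) : N = ⊥ ∨ N = ⊤ := by
  let N' : Submodule (UniversalEnvelopingAlgebra ℂ 𝔤) (UniversalEnvelopingAlgebra ℂ 𝔤) :=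
    { carrier := {u | u • highestVec b μ ∈ N}
      zero_mem' := by
        change (0 : UniversalEnvelopingAlgebra ℂ 𝔤) • highestVec b μ ∈ N
        rw [zero_smul]; exact N.zero_mem
      add_mem' := fun {a c} ha hc => by
        change (a + c) • highestVec b μ ∈ N
        rw [add_smul]; exact N.add_mem ha hc
      smul_mem' := fun a c hc => by
        change (a * c) • highestVec b μ ∈ N
        rw [mul_smul]; exact EnvQuot.smul_mem_lieSubmodule N a hc }
  have hmk : ∀ u : UniversalEnvelopingAlgebra ℂ 𝔤, u • highestVec b μ =
      (Submodule.Quotient.mk u : UniversalEnvelopingAlgebra ℂ 𝔤 ⧸ simpleIdeal b μ) := fun u => by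
    have h1 : u • (Submodule.Quotient.mk 1 : UniversalEnvelopingAlgebra ℂ 𝔤 ⧸ simpleIdeal b μ) =
      Submodule.Quotient.mk (u • 1) := rfl
    rw [smul_eq_mul, mul_one] at h1
    exact h1
  have hmem : ∀ u, u ∈ N' ↔
      (Submodule.Quotient.mk u : UniversalEnvelopingAlgebra ℂ 𝔤 ⧸ simpleIdeal b μ) ∈ N :=
    fun u => by rw [← hmk]; rfl
  have hsub : simpleIdeal b μ ≤ N' := fun u hu => by
    rw [hmem, (Submodule.Quotient.mk_eq_zero _).2 hu]
    exact N.zero_mem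
  have hcomap : (N'.map (vermaIdeal b μ).mkQ).comap (vermaIdeal b μ).mkQ = N' := by
    rw [Submodule.comap_map_eq, Submodule.ker_mkQ, sup_eq_left]
    exact (vermaIdeal_le_simpleIdeal b μ).trans hsub
  by_cases htop : N'.map (vermaIdeal b μ).mkQ = ⊤
  · right
    rw [htop, Submodule.comap_top] at hcomap
    rw [eq_top_iff]
    rintro m -
    obtain ⟨u, rfl⟩ := Submodule.Quotient.mk_surjective _ m
    exact (hmem u).1 (hcomap ▸ Submodule.mem_top)
  · left
    have h1 : N'.map (vermaIdeal b μ).mkQ ≤ vermaMax b μ := le_sSup htop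
    have h2 : N' ≤ simpleIdeal b μ := hcomap ▸ Submodule.comap_mono h1
    rw [eq_bot_iff]
    intro m hm
    obtain ⟨u, rfl⟩ := Submodule.Quotient.mk_surjective _ m
    exact (LieSubmodule.mem_bot _).2
      ((Submodule.Quotient.mk_eq_zero _).2 (h2 ((hmem u).2 hm)))

theorem highestVec_smul_eq_zero {b : (rootSystem H).Base} {μ : Dual ℂ H}
    {u : UniversalEnvelopingAlgebra ℂ 𝔤} (hu : u ∈ vermaIdeal b μ) :
    u • highestVec b μ = 0 := by
  have h1 : u • (Submodule.Quotient.mk 1 : UniversalEnvelopingAlgebra ℂ 𝔤 ⧸ simpleIdeal b μ) =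
    Submodule.Quotient.mk (u • 1) := rfl
  rw [smul_eq_mul, mul_one] at h1
  exact h1.trans ((Submodule.Quotient.mk_eq_zero _).2 (vermaIdeal_le_simpleIdeal b μ hu))

theorem lie_highestVec_of_mem_rootSpace (b : (rootSystem H).Base) (μ : Dual ℂ H) {γ : H.root}
    (hγ : b.IsPos γ) {x : 𝔤} (hx : x ∈ rootSpace H γ.1) : ⁅x, highestVec b μ⁆ = 0 :=
  highestVec_smul_eq_zero (Submodule.subset_span (Or.inl ⟨γ, hγ, x, hx, rfl⟩))

theorem lie_highestVec_of_mem (b : (rootSystem H).Base) (μ : Dual ℂ H) (h : H) :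
    ⁅(h : 𝔤), highestVec b μ⁆ = μ h • highestVec b μ := by
  have h1 := highestVec_smul_eq_zero (b := b) (μ := μ)
    (Submodule.subset_span (Or.inr ⟨h, rfl⟩))
  rw [sub_smul, algebraMap_smul, sub_eq_zero] at h1
  exact h1

/-- The simple highest weight module with its Chevalley basis, graded by height. -/
noncomputable def chevalleyDatum (b : (rootSystem H).Base) {X : H.root → 𝔤}
    (hX : IsChevalleySystem X) (μ : Dual ℂ H) (A : Subring ℂ)
    (hA : ∀ i ∈ b.support, μ ((rootSystem H).coroot i) ∈ A) (hv : highestVec b μ ≠ 0) :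
    HighestWeightDatum 𝔤 (SimpleHighestWeight b μ) A (b.support ⊕ H.root) where
  x := chevalleyBasis b X
  ht := Sum.elim (fun _ => 0) b.height
  h₀ := ((exists_root_apply_eq_height b).choose : 𝔤)
  v := highestVec b μ
  wt := μ (exists_root_apply_eq_height b).choose
  c := Sum.elim (fun i => μ ((rootSystem H).coroot i)) 0
  lie_h₀ := by
    rintro (i | γ)
    · have : ⁅(exists_root_apply_eq_height b).choose, (rootSystem H).coroot i.1⁆ = 0 :=
        trivial_lie_zero _ _ _ _
      have h0 : ⁅((exists_root_apply_eq_height b).choose : 𝔤),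
          ((rootSystem H).coroot i.1 : 𝔤)⁆ = 0 := by
        rw [← LieSubalgebra.coe_bracket, this]; rfl
      simpa [chevalleyBasis] using h0
    · simp only [chevalleyBasis, Sum.elim_inr]
      rw [lie_eq_apply_smul hX, (exists_root_apply_eq_height b).choose_spec γ]
  span_x := span_chevalleyBasis b hX
  lie_mem i j := lie_mem_span_chevalleyBasis hX A (Submodule.subset_span ⟨i, rfl⟩)
    (Submodule.subset_span ⟨j, rfl⟩)
  simple := simpleHighestWeight_eq_bot_or_top b μ
  v_ne := hv
  lie_v_pos := by
    rintro (i | γ) hi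
    · simp at hi
    · exact lie_highestVec_of_mem_rootSpace b μ hi (hX.mem_rootSpace γ)
  lie_v_zero := by
    rintro (i | γ) hi
    · exact lie_highestVec_of_mem b μ _
    · exact absurd hi (b.height_ne_zero γ)
  c_mem := by
    rintro (i | γ)
    · exact hA i i.2
    · exact A.zero_mem
  h₀_v := lie_highestVec_of_mem b μ _

end ChevalleyDatum

/-! ### The `p`-power map on the Chevalley lattice. -/

section PowerMap

open LieAlgebra LieAlgebra.IsKilling

variable {𝔤 : Type*} [LieRing 𝔤] [LieAlgebra ℂ 𝔤] [FiniteDimensional ℂ 𝔤] [IsKilling ℂ 𝔤]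
  {H : LieSubalgebra ℂ 𝔤} [H.IsCartanSubalgebra] {X : H.root → 𝔤}

theorem IsChevalleySystem.lie_eq_zero (hX : IsChevalleySystem X) {α β : H.root}
    (hneg : (rootSystem H).root β ≠ -(rootSystem H).root α)
    (hsum : ¬ ∃ γ : H.root, (rootSystem H).root γ = (rootSystem H).root α + (rootSystem H).root β) :
    ⁅X α, X β⁆ = 0 := by
  have hmem : ⁅X α, X β⁆ ∈ rootSpace H ((α.1 : H → ℂ) + (β.1 : H → ℂ)) :=
    lie_mem_genWeightSpace_of_mem_genWeightSpace (hX.mem_rootSpace α) (hX.mem_rootSpace β)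
  have hbot : rootSpace H ((α.1 : H → ℂ) + (β.1 : H → ℂ)) = ⊥ := by
    by_contra hne
    let γ : LieModule.Weight ℂ H 𝔤 := ⟨(α.1 : H → ℂ) + (β.1 : H → ℂ), hne⟩
    have hγ : γ.IsNonZero := by
      intro h0
      apply hneg
      ext z
      have h2 : α.1 z + β.1 z = 0 := congr_fun h0 z
      simpa using eq_neg_of_add_eq_zero_right h2
    refine hsum ⟨⟨γ, by simpa [LieSubalgebra.root] using hγ⟩, ?_⟩
    ext z
    rfl
  rwa [hbot, LieSubmodule.mem_bot] at hmem

/-- Iterated brackets along a root string: the coefficients are divisible by rising factorials. -/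
theorem IsChevalleySystem.ad_pow_apply (hX : IsChevalleySystem X) {α β : H.root}
    (hind : LinearIndependent ℂ ![(rootSystem H).root α, (rootSystem H).root β]) (n : ℕ) :
    LieAlgebra.ad ℂ 𝔤 (X α) ^ n • X β = 0 ∨ ∃ (γ : H.root) (c : ℤ),
      LinearIndependent ℂ ![(rootSystem H).root α, (rootSystem H).root γ] ∧
      (rootSystem H).chainBotCoeff α γ = (rootSystem H).chainBotCoeff α β + n ∧
      (((rootSystem H).chainBotCoeff α β + 1).ascFactorial n : ℤ) ∣ c ∧
      LieAlgebra.ad ℂ 𝔤 (X α) ^ n • X β = c • X γ := by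
  induction n with
  | zero => exact Or.inr ⟨β, 1, hind, rfl, by simp, by simp⟩
  | succ n ih =>
    rw [pow_succ', mul_smul]
    rcases ih with h0 | ⟨γ, c, hγ, hr, hc, heq⟩
    · left
      rw [h0, smul_zero]
    rw [heq, Module.End.smul_def, map_zsmul, LieAlgebra.ad_apply]
    by_cases hsum : ∃ δ : H.root,
        (rootSystem H).root δ = (rootSystem H).root α + (rootSystem H).root γ
    · obtain ⟨δ, hδ⟩ := hsum
      have hδ' : (rootSystem H).root δ = (rootSystem H).root γ + (rootSystem H).root α := by
        rw [hδ, add_comm]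
      obtain ⟨N, hN, -⟩ := hX.lie_add
      obtain ⟨h1, h2⟩ := hN α γ δ hδ
      refine Or.inr ⟨δ, c * N α γ, by simpa [hδ', add_comm] using hγ, ?_, ?_, ?_⟩
      · rw [RootPairing.chainBotCoeff_of_add hγ hδ', hr, add_assoc]
      · have h3 : (((rootSystem H).chainBotCoeff α β + 1 + n : ℕ) : ℤ) ∣ N α γ := by
          rw [hr] at h2
          rcases h2 with h2 | h2 <;> rw [h2]
          · exact dvd_of_eq (by push_cast; ring)
          · exact (dvd_neg).2 (dvd_of_eq (by push_cast; ring))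
        rw [Nat.ascFactorial_succ, Nat.cast_mul, mul_comm]
        exact mul_dvd_mul hc h3
      · rw [h1, mul_smul]
    · left
      rw [hX.lie_eq_zero ?_ hsum, smul_zero]
      intro hneg
      have := LinearIndependent.pair_iff.1 hγ 1 1 (by rw [hneg]; simp)
      exact one_ne_zero this.1

theorem IsChevalleySystem.lie_coroot (hX : IsChevalleySystem X) (α β : H.root) :
    ∃ n : ℤ, ⁅((rootSystem H).coroot α : 𝔤), X β⁆ = n • X β := by
  have h1 : ⁅((rootSystem H).coroot α : 𝔤), X β⁆ = β.1 (coroot α.1) • X β :=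
    lie_eq_smul_of_mem_rootSpace (hX.mem_rootSpace β) ((rootSystem H).coroot α)
  rw [h1, apply_coroot_eq_cast, Int.cast_smul_eq_zsmul]
  exact ⟨_, rfl⟩

theorem lie_coroot_coroot (α β : H.root) :
    ⁅((rootSystem H).coroot α : 𝔤), ((rootSystem H).coroot β : 𝔤)⁆ = 0 := by
  have h0 : ⁅(rootSystem H).coroot α, (rootSystem H).coroot β⁆ = 0 := trivial_lie_zero _ _ _ _
  rw [← LieSubalgebra.coe_bracket, h0]
  rfl

/-- Powers of the adjoint action of a root vector are divisible by `p` on the Chevalley lattice. -/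
theorem IsChevalleySystem.exists_ad_pow_eq_nsmul (hX : IsChevalleySystem X)
    (b : (rootSystem H).Base) (A : Subring ℂ) {p : ℕ} (hp : p.Prime) (α : H.root) {z : 𝔤}
    (hz : z ∈ Submodule.span A (Set.range (chevalleyBasis b X))) :
    ∃ w ∈ Submodule.span A (Set.range (chevalleyBasis b X)),
      LieAlgebra.ad ℂ 𝔤 (X α) ^ p • z = p • w := by
  have hroot : ∀ γ : H.root, X γ ∈ Submodule.span A (Set.range (chevalleyBasis b X)) :=
    fun γ => Submodule.subset_span ⟨Sum.inr γ, rfl⟩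
  obtain ⟨q, rfl⟩ : ∃ q, p = q + 2 := ⟨p - 2, by have := hp.two_le; omega⟩
  -- Since `[X α, h]` is a multiple of `X α`, the second power of `ad (X α)` already kills `𝔥`.
  have hcor : ∀ β : H.root,
      LieAlgebra.ad ℂ 𝔤 (X α) ^ (q + 2) • ((rootSystem H).coroot β : 𝔤) = 0 := by
    intro β
    obtain ⟨n, hn⟩ := hX.lie_coroot β α
    rw [pow_add, mul_smul, pow_two, mul_smul, Module.End.smul_def (_ : Module.End ℂ 𝔤) (_ : 𝔤),
      Module.End.smul_def, Module.End.smul_def]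
    simp only [LieAlgebra.ad_apply]
    rw [← lie_skew (X α) ((rootSystem H).coroot β : 𝔤), hn]
    simp
  induction hz using Submodule.span_induction with
  | zero => exact ⟨0, Submodule.zero_mem _, by simp⟩
  | add x y _ _ hx hy =>
    obtain ⟨u, hu, h1⟩ := hx
    obtain ⟨w, hw, h2⟩ := hy
    exact ⟨u + w, Submodule.add_mem _ hu hw, by rw [smul_add, smul_add, h1, h2]⟩
  | smul a x _ hx =>
    obtain ⟨u, hu, h1⟩ := hx
    refine ⟨a • u, Submodule.smul_mem _ a hu, ?_⟩
    rw [smul_comm (q + 2) a u, ← h1]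
    exact map_smul (LieAlgebra.ad ℂ 𝔤 (X α) ^ (q + 2)) (a : ℂ) x
  | mem z hz =>
    obtain ⟨i | β, rfl⟩ := hz
    · exact ⟨0, Submodule.zero_mem _, by simpa [chevalleyBasis] using hcor i.1⟩
    · simp only [chevalleyBasis, Sum.elim_inr]
      by_cases hαβ : α = β
      · subst hαβ
        refine ⟨0, Submodule.zero_mem _, ?_⟩
        rw [pow_succ, mul_smul, Module.End.smul_def (LieAlgebra.ad ℂ 𝔤 (X α)),
          LieAlgebra.ad_apply, lie_self, smul_zero, smul_zero]
      by_cases hneg : (rootSystem H).root α = -(rootSystem H).root β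
      · have hneg' : (rootSystem H).root β = -(rootSystem H).root α := by rw [hneg, neg_neg]
        have h1 : LieAlgebra.ad ℂ 𝔤 (X α) ^ 2 • X β = -((2 : ℕ) • X α) := by
          rw [pow_two, mul_smul, Module.End.smul_def, Module.End.smul_def, LieAlgebra.ad_apply,
            LieAlgebra.ad_apply, hX.lie_neg α β hneg', ← lie_skew,
            lie_eq_apply_smul hX ((rootSystem H).coroot α) α]
          have h2 : α.1 ((rootSystem H).coroot α) = 2 := by
            have := (rootSystem H).root_coroot_two α
            simpa using this
          rw [h2, ofNat_smul_eq_nsmul]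
        rw [pow_add, mul_smul, h1]
        -- On the opposite root vector `(ad X_α)^2` gives `-2 X_α`. For `p = 2` this is divisible by
        -- `p`; for larger `p` one more bracket kills it.
        rcases q with _ | q
        · exact ⟨-X α, Submodule.neg_mem _ (hroot α), by simp⟩
        · refine ⟨0, Submodule.zero_mem _, ?_⟩
          rw [pow_succ, mul_smul, Module.End.smul_def (LieAlgebra.ad ℂ 𝔤 (X α)),
            map_neg, map_nsmul, LieAlgebra.ad_apply, lie_self, smul_zero, neg_zero, smul_zero,
            smul_zero]
      · rcases hX.ad_pow_apply (RootPairing.IsReduced.linearIndependent (rootSystem H) hαβ hneg)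
          (q + 2) with h0 | ⟨γ, c, -, -, hc, heq⟩
        · exact ⟨0, Submodule.zero_mem _, by rw [h0, smul_zero]⟩
        -- A product of `p` consecutive positive integers is divisible by `p!`, hence by `p`.
        · have hpc : ((q + 2 : ℕ) : ℤ) ∣ c := by
            refine dvd_trans ?_ hc
            exact_mod_cast (Nat.dvd_factorial (by omega) le_rfl).trans
              (Nat.factorial_dvd_ascFactorial _ _)
          obtain ⟨c', rfl⟩ := hpc
          refine ⟨c' • X γ, zsmul_mem (hroot γ) c', ?_⟩
          rw [heq, mul_smul, natCast_zsmul]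

end PowerMap

section BaseChange

variable {R 𝔩 k : Type*} [CommRing R] [LieRing 𝔩] [LieAlgebra R 𝔩] [Field k] [Algebra R k]

theorem baseChange_linearMap_ext {B : Set 𝔩} (hB : Submodule.span R B = ⊤)
    {f g : k ⊗[R] 𝔩 →ₗ[k] k ⊗[R] 𝔩} (h : ∀ z ∈ B, f (1 ⊗ₜ z) = g (1 ⊗ₜ z)) : f = g := by
  have key : ∀ z, f (1 ⊗ₜ z) = g (1 ⊗ₜ z) := fun z => by
    have hz : z ∈ Submodule.span R B := hB ▸ Submodule.mem_top
    induction hz using Submodule.span_induction with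
    | zero => simp
    | add x y _ _ hx hy => rw [TensorProduct.tmul_add, map_add, map_add, hx, hy]
    | smul r x _ hx =>
      rw [TensorProduct.tmul_smul, ← algebraMap_smul k r, map_smul, map_smul, hx]
    | mem x hx => exact h x hx
  refine LinearMap.ext fun t => ?_
  induction t using TensorProduct.induction_on with
  | zero => simp
  | add x y hx hy => rw [map_add, map_add, hx, hy]
  | tmul r z =>
    have : r ⊗ₜ[R] z = r • (1 : k) ⊗ₜ[R] z := by rw [TensorProduct.smul_tmul', smul_eq_mul, mul_one]
    rw [this, map_smul, map_smul, key]

theorem ad_one_tmul_pow (x z : 𝔩) (n : ℕ) :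
    (LieAlgebra.ad k (k ⊗[R] 𝔩) (1 ⊗ₜ x) ^ n) (1 ⊗ₜ z) =
      1 ⊗ₜ ((LieAlgebra.ad R 𝔩 x ^ n) z) := by
  induction n with
  | zero => rfl
  | succ n ih =>
    rw [pow_succ', pow_succ', Module.End.mul_apply, Module.End.mul_apply, ih, LieAlgebra.ad_apply,
      LieAlgebra.ExtendScalars.bracket_tmul, one_mul, LieAlgebra.ad_apply]

theorem LieSubalgebra.coe_ad_pow_apply {K 𝔤 : Type*} [Field K] [LieRing 𝔤] [LieAlgebra K 𝔤]
    {A : Subring K} [LieAlgebra A 𝔤] (N : LieSubalgebra A 𝔤) (x z : N) (n : ℕ) :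
    ((LieAlgebra.ad A N x ^ n) z : 𝔤) = (LieAlgebra.ad K 𝔤 (x : 𝔤) ^ n) (z : 𝔤) := by
  induction n with
  | zero => rfl
  | succ n ih =>
    rw [pow_succ', pow_succ', Module.End.mul_apply, Module.End.mul_apply, ← ih,
      LieAlgebra.ad_apply, LieAlgebra.ad_apply, LieSubalgebra.coe_bracket]

/-- The eigenvalues are integers, and Fermat gives `n^p = n` in `k`. For coroots this says `h^{[p]}
= h`. -/
theorem ad_pow_eq_ad_of_lie_eq_zsmul {p : ℕ} [CharP k p] [Fact p.Prime] {B : Set 𝔩}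
    (hB : Submodule.span R B = ⊤) {x : 𝔩} (hx : ∀ z ∈ B, ∃ n : ℤ, ⁅x, z⁆ = n • z) :
    LieAlgebra.ad k (k ⊗[R] 𝔩) (1 ⊗ₜ x) = LieAlgebra.ad k (k ⊗[R] 𝔩) (1 ⊗ₜ x) ^ p := by
  refine baseChange_linearMap_ext hB fun z hz => ?_
  obtain ⟨n, hn⟩ := hx z hz
  have h1 : LieAlgebra.ad k (k ⊗[R] 𝔩) (1 ⊗ₜ x) (1 ⊗ₜ z) = (n : k) • (1 : k) ⊗ₜ[R] z := by
    rw [LieAlgebra.ad_apply, LieAlgebra.ExtendScalars.bracket_tmul, hn, one_mul,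
      Int.cast_smul_eq_zsmul, TensorProduct.tmul_smul]
  have h2 : ∀ m : ℕ, (LieAlgebra.ad k (k ⊗[R] 𝔩) (1 ⊗ₜ x) ^ m) (1 ⊗ₜ z) =
      (n : k) ^ m • (1 : k) ⊗ₜ[R] z := fun m => by
    induction m with
    | zero => simp
    | succ m ih =>
      rw [pow_succ', Module.End.mul_apply, ih, map_smul, h1, smul_smul, pow_succ]
  have h3 : (n : k) ^ p = n := by
    rw [← frobenius_def, map_intCast]
  rw [h1, h2, h3]

end BaseChange

section ChevalleyLattice

open LieAlgebra LieAlgebra.IsKilling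

variable {𝔤 : Type*} [LieRing 𝔤] [LieAlgebra ℂ 𝔤] [FiniteDimensional ℂ 𝔤] [IsKilling ℂ 𝔤]
  {H : LieSubalgebra ℂ 𝔤} [H.IsCartanSubalgebra]

/-- The Chevalley basis, as a spanning family of the lattice. -/
noncomputable def latticeBasis (b : (rootSystem H).Base) {X : H.root → 𝔤}
    (hX : IsChevalleySystem X) (A : Subring ℂ) (i : b.support ⊕ H.root) : latticeLie b hX A :=
  ⟨chevalleyBasis b X i, Submodule.subset_span ⟨i, rfl⟩⟩

theorem span_latticeBasis (b : (rootSystem H).Base) {X : H.root → 𝔤}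
    (hX : IsChevalleySystem X) (A : Subring ℂ) :
    Submodule.span A (Set.range (latticeBasis b hX A)) = ⊤ := by
  refine Submodule.map_injective_of_injective
    (f := (latticeLie b hX A).toSubmodule.subtype) Subtype.val_injective ?_
  rw [Submodule.map_span, ← Set.range_comp, Submodule.map_subtype_top]
  rfl

/-- The witnesses are `h_α^{[p]} = h_α` and `e_γ^{[p]} = 0`. -/
theorem exists_ad_eq_ad_latticeBasis_pow (b : (rootSystem H).Base) {X : H.root → 𝔤}
    (hX : IsChevalleySystem X) (A : Subring ℂ) {k : Type*} [Field k] [Algebra A k] {p : ℕ}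
    [CharP k p] [hp : Fact p.Prime] (i : b.support ⊕ H.root) :
    ∃ y, LieAlgebra.ad k (k ⊗[A] latticeLie b hX A) y =
      LieAlgebra.ad k (k ⊗[A] latticeLie b hX A) (1 ⊗ₜ latticeBasis b hX A i) ^ p := by
  rcases i with i | α
  · refine ⟨_, ad_pow_eq_ad_of_lie_eq_zsmul (span_latticeBasis b hX A) ?_⟩
    rintro _ ⟨j | β, rfl⟩
    · exact ⟨0, Subtype.ext ((lie_coroot_coroot i.1 j.1).trans
        (zero_smul ℤ ((rootSystem H).coroot j.1 : 𝔤)).symm)⟩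
    · obtain ⟨n, hn⟩ := hX.lie_coroot i.1 β
      exact ⟨n, Subtype.ext hn⟩
  · refine ⟨0, ?_⟩
    rw [map_zero]
    refine baseChange_linearMap_ext (span_latticeBasis b hX A) fun z _ => ?_
    rw [ad_one_tmul_pow]
    obtain ⟨w, hw, h⟩ := hX.exists_ad_pow_eq_nsmul b A hp.out α z.2
    have h1 : (LieAlgebra.ad A _ (latticeBasis b hX A (Sum.inr α)) ^ p) z =
        p • (⟨w, hw⟩ : latticeLie b hX A) :=
      Subtype.ext ((LieSubalgebra.coe_ad_pow_apply _ _ _ _).trans h)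
    rw [h1, TensorProduct.tmul_smul, ← Nat.cast_smul_eq_nsmul k, CharP.cast_eq_zero, zero_smul]
    rfl

end ChevalleyLattice

/-! ### Consequences of algebraic independence, and the conclusion. -/

section GrQuotientLemmas

variable {R 𝔩 M : Type*} [CommRing R] [LieRing 𝔩] [LieAlgebra R 𝔩] [AddCommGroup M] [Module R M]
  [LieRingModule 𝔩 M] [LieModule R 𝔩 M] {v : M} {d : ℕ}

theorem ne_zero_of_nontrivial_grQuotient
    [Nontrivial (SymmetricAlgebra R 𝔩 ⧸ grAnnihilator R 𝔩 v)] : v ≠ 0 := by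
  intro hv
  refine one_ne_zero (α := SymmetricAlgebra R 𝔩 ⧸ grAnnihilator R 𝔩 v) ?_
  rw [← map_one (Ideal.Quotient.mk _), Ideal.Quotient.eq_zero_iff_mem, mem_grAnnihilator_iff,
    map_one, Module.End.one_apply, grGen, grMk_eq_zero_iff]
  exact hv

/-- A degree zero element is a constant `a`, and then `X_i - a` would be a relation. Positive degree
is what makes the `p`-th power of `y_i` act by zero. -/
theorem degree_ne_zero_of_algebraicIndependent [Nontrivial R]
    {y : Fin d → SymmetricAlgebra R 𝔩 ⧸ grAnnihilator R 𝔩 v} (hy : AlgebraicIndependent R y)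
    {i : Fin d} {n : ℕ} {s : SymmetricAlgebra R 𝔩} (hs : s ∈ symPow R 𝔩 n)
    (hsy : Ideal.Quotient.mk _ s = y i) : n ≠ 0 := by
  rintro rfl
  rw [symPow, pow_zero, Submodule.mem_one] at hs
  obtain ⟨a, rfl⟩ := hs
  have h1 : MvPolynomial.aeval y (MvPolynomial.X i : MvPolynomial (Fin d) R) =
      MvPolynomial.aeval y (MvPolynomial.C a : MvPolynomial (Fin d) R) := by
    rw [MvPolynomial.aeval_X, MvPolynomial.aeval_C, ← hsy]
    rfl
  have h2 := congrArg (MvPolynomial.eval fun _ => a + 1) (hy h1)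
  rw [MvPolynomial.eval_X, MvPolynomial.eval_C] at h2
  exact one_ne_zero (add_eq_left.1 h2)

end GrQuotientLemmas

section ChevalleyFiltration

open LieAlgebra LieAlgebra.IsKilling

variable {𝔤 : Type*} [LieRing 𝔤] [LieAlgebra ℂ 𝔤] [FiniteDimensional ℂ 𝔤] [IsKilling ℂ 𝔤]
  {H : LieSubalgebra ℂ 𝔤} [H.IsCartanSubalgebra]

/-- Translates filtration degree over `A` into depth over `ℂ`; the constant `C` bounds the heights
of the negative roots in absolute value. -/
theorem exists_cyclicFiltration_latticeLie_le (b : (rootSystem H).Base) {X : H.root → 𝔤}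
    (hX : IsChevalleySystem X) (μ : Dual ℂ H) (A : Subring ℂ)
    (hA : ∀ i ∈ b.support, μ ((rootSystem H).coroot i) ∈ A) (hv : highestVec b μ ≠ 0) :
    ∃ C : ℕ, ∀ n, ∀ m ∈ cyclicFiltration A (latticeLie b hX A) (highestVec b μ) n,
      m ∈ (chevalleyDatum b hX μ A hA hv).lattice ∧
        m ∈ (chevalleyDatum b hX μ A hA hv).negSpan (C * n) := by
  set T := chevalleyDatum b hX μ A hA hv
  obtain ⟨C, hC⟩ : ∃ C : ℕ, ∀ i, -T.ht i ≤ C := by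
    obtain ⟨C, hC⟩ := (Set.finite_range fun i => (-T.ht i).toNat).bddAbove
    exact ⟨C, fun i => (Int.self_le_toNat _).trans (by exact_mod_cast hC ⟨i, rfl⟩)⟩
  refine ⟨C, fun n => cyclicFiltration_le_of_lie_mem
    (W := fun n => T.lattice ⊓ (T.negSpan (C * n)).restrictScalars A) ?_ ?_ ?_ n⟩
  · exact ⟨T.v_mem_lattice, T.act_mem_negSpan (w := []) (by simp [HighestWeightDatum.IsNeg])
      (by simp [T.deg_nil])⟩
  · exact fun i j hij => inf_le_inf_left _ (T.negSpan_mono (Nat.mul_le_mul_left C hij))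
  · rintro n x m ⟨h1, h2⟩
    exact ⟨T.lie_mem_lattice_of_mem_span x.2 h1, T.lie_mem_negSpan hC (x : 𝔤) h2⟩

end ChevalleyFiltration

theorem lemma3p3 {𝔤 : Type*} [LieRing 𝔤] [LieAlgebra ℂ 𝔤] [FiniteDimensional ℂ 𝔤]
    [LieAlgebra.IsSimple ℂ 𝔤] (H : LieSubalgebra ℂ 𝔤) [H.IsCartanSubalgebra]
    (b : (LieAlgebra.IsKilling.rootSystem H).Base)
    (X : H.root → 𝔤) (hX : IsChevalleySystem X)
    (e h f : 𝔤) (hsl : IsSl2Triple h e f)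
    (μ : Dual ℂ H)
    (hVA : assocVariety (primitiveIdeal b μ) =
      zariskiClosure (coadjointOrbit (normalizedForm e f e)))
    (A : Subring ℂ) (hA : IsAdmissibleRing b hX μ e f A)
    (d D : ℕ) (y : Fin d → GrQuotient b hX μ A) (v : Fin D → GrQuotient b hX μ A)
    (hyhom : ∀ i, IsHomogeneousElt b hX μ A (y i))
    (hyind : AlgebraicIndependent A y)
    (hspan : Submodule.span (Algebra.adjoin A (Set.range y)) (Set.range v) = ⊤)
    (p : ℕ) [Fact p.Prime] (hp : ¬ IsUnit (p : A)) [Algebra A (AlgebraicClosure (ZMod p))]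
    (η : Dual (AlgebraicClosure (ZMod p)) (ModularLie b hX A (AlgebraicClosure (ZMod p)))) :
    Module.rank (AlgebraicClosure (ZMod p))
        (ReducedModule b hX μ A (AlgebraicClosure (ZMod p)) p η) ≤
      ((D * p ^ halfOrbitDim e f : ℕ) : Cardinal) := by
  -- Algebraic independence embeds `A` in `R_A`, even for `d = 0`. Hence `gr L_A(μ)` is nonzero, and
  -- so is `v_μ`.
  have : Nontrivial (GrQuotient b hX μ A) := hyind.algebraMap_injective.nontrivial
  have hv : highestVec b μ ≠ 0 := ne_zero_of_nontrivial_grQuotient (R := A) (𝔩 := latticeLie b hX A)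
  choose n s hs hsy using hyhom
  have hdim : 2 * d ≤ varietyDim (coadjointOrbit (normalizedForm e f e)) := by
    obtain ⟨C, hC⟩ := exists_cyclicFiltration_latticeLie_le b hX μ A hA.weight_mem hv
    refine (chevalleyDatum b hX μ A hA.weight_mem hv).two_mul_le_varietyDim
      (c := C * ∑ i, n i) hVA fun t => ?_
    obtain ⟨m, hm, hmi⟩ := exists_linearIndependent_cyclicFiltration hyind
      (fun i => ⟨s i, hs i, hsy i⟩) t
    refine ⟨m, fun a => ?_, hmi⟩
    rw [mul_assoc]
    exact hC _ _ (hm a)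
  -- `halfOrbitDim` is an integer quotient by `2`; `2d ≤ dim` gives the bound without knowing that
  -- the dimension is even.
  have hd : d ≤ halfOrbitDim e f := by
    rw [halfOrbitDim]
    omega
  refine (rank_quotient_reducedSubspace_le (highestVec b μ) η (span_latticeBasis b hX A) ?_ y v
    (fun i => ⟨n i, degree_ne_zero_of_algebraicIndependent hyind (hs i) (hsy i), s i, hs i,
      hsy i⟩) hspan).trans ?_
  · rintro _ ⟨i, rfl⟩
    exact exists_ad_eq_ad_latticeBasis_pow b hX A i
  · exact_mod_cast Nat.mul_le_mul_left D
      (Nat.pow_le_pow_right (Fact.out : p.Prime).pos hd)
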